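/- Let $d$ be a positive integer and let $C=(c_{ij})$ be a $d\times d$-matrix of real-valued, measurable, locally bounded functions $c_{ij}=c_{ji}$ on $\mathbf R^d$ with $C(x)\ge 0$ for almost every $x\in\mathbf R^d$. Let $W^{1,2}_0(\mathbf R^d)$ be the space of functions in $W^{1,2}(\mathbf R^d)$ with compact support, and let $h$ be the quadratic form on the real space $L_2(\mathbf R^d)$ with domain $D(h)=W^{1,2}_0(\mathbf R^d)$ and $h(\varphi)=\sum_{i,j=1}^d(\partial_i\varphi,c_{ij}\,\partial_j\varphi)$. Let $h_0$ be the relaxation of $h$, i.e. the largest closed positive quadratic form with $D(h)\subseteq D(h_0)$ and $h_0(\varphi)\le h(\varphi)$ for all $\varphi\in D(h)$ (forms are ordered by $k\le q$ if $D(q)\subseteq D(k)$ and $k(\varphi)\leq q(\varphi)$ for all $\varphi\in D(q)$). Let $H_0$ be the positive self-adjoint operator on $L_2(\mathbf R^d)$ associated with $h_0$, and let $S^{(0)}_t=e^{-tH_0}$, $t\ge 0$. For $s\ge0$ put $\nu(s)=\operatorname{ess\,sup}_{|x|\le s}\|C(x)\|$, where $\|\cdot\|$ is the operator norm of matrices,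 and $\rho(s)=\int_0^s(1+\nu(t))^{-1/2}\,dt$, and let $B_\rho(r)=\{x\in\mathbf R^d:\rho(|x|)<r\}$. Assume the Tikhonov growth condition: there are $a,b>0$ such that the Lebesgue measure of $B_\rho(r)$ satisfies $|B_\rho(r)|\le a\,e^{b r^2}$ for all large $r$. Then the relaxation $h_0$ and the semigroup $S^{(0)}$ exist, and $S^{(0)}$ is conservative, i.e. for every $t>0$ the operator $S^{(0)}_t$ extends from $L_2(\mathbf R^d)\cap L_\infty(\mathbf R^d)$ to a bounded weak* continuous operator on $L_\infty(\mathbf R^d)$, and this (unique) extension satisfies $S^{(0)}_t 1=1$. -/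

import Mathlib

open MeasureTheory Filter Topology
open scoped ENNReal NNReal

noncomputable section

namespace DegenerateElliptic

/-! ### Positive quadratic forms on a real Hilbert space

A positive quadratic form with a domain is represented by the functional `q : H → [0, ∞]` that has
the value `∞` off the domain, so `D(q) = {u | q u ≠ ∞}`.  The pointwise order `k ≤ q` then says
that `D(q) ⊆ D(k)` and that `k(u) ≤ q(u)` for all `u ∈ D(q)`. -/

section Forms

variable {H : Type*} [NormedAddCommGroup H] [InnerProductSpace ℝ H]

/-- `q` is a positive quadratic form (whose domain `{u | q u ≠ ∞}` is then a linear subspace). -/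
structure IsQuadraticForm (q : H → ℝ≥0∞) : Prop where
  smul : ∀ (c : ℝ) (u : H), q (c • u) = ENNReal.ofReal (c ^ 2) * q u
  parallelogram : ∀ u v : H, q (u + v) + q (u - v) = 2 * q u + 2 * q v

/-- `q` is a closed positive quadratic form: its domain is complete for the form norm
`(q(u) + ‖u‖²)^{1/2}`. -/
structure IsClosedForm (q : H → ℝ≥0∞) : Prop extends IsQuadraticForm q where
  closed : ∀ (u : ℕ → H) (v : H), (∀ n, q (u n) ≠ ∞) → Tendsto u atTop (𝓝 v) →
    Tendsto (fun p : ℕ × ℕ => q (u p.1 - u p.2)) atTop (𝓝 0) →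
    q v ≠ ∞ ∧ Tendsto (fun n => q (u n - v)) atTop (𝓝 0)

/-- `q₀` is the relaxation of `q`: the largest closed positive quadratic form majorized by `q`. -/
def IsRelaxation (q q₀ : H → ℝ≥0∞) : Prop :=
  IsGreatest {k : H → ℝ≥0∞ | IsClosedForm k ∧ k ≤ q} q₀

/-- The bilinear form `q(u, v)`, for `u, v` in the domain of the quadratic form `q`. -/
def polar (q : H → ℝ≥0∞) (u v : H) : ℝ :=
  ((q (u + v)).toReal - (q (u - v)).toReal) / 4

/-- The graph of the operator `A` associated with the form `q`: `u ∈ D(A)` and `A u = f`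
if and only if `u ∈ D(q)` and `q(u, v) = (f, v)` for all `v ∈ D(q)`. -/
def FormOperatorGraph (q : H → ℝ≥0∞) (u f : H) : Prop :=
  q u ≠ ∞ ∧ ∀ v : H, q v ≠ ∞ → polar q u v = inner ℝ f v

/-- `S` is the semigroup associated with the form `q`: the strongly continuous semigroup
`S_t = e^{-tA}` whose generator is `-A`, where `A` is the operator associated with `q`. -/
structure IsFormSemigroup (q : H → ℝ≥0∞) (S : ℝ≥0 → H →L[ℝ] H) : Prop where
  zero : S 0 = ContinuousLinearMap.id ℝ H
  add : ∀ s t : ℝ≥0, S (s + t) = (S s).comp (S t)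
  continuous : ∀ u : H, Continuous fun t : ℝ≥0 => S t u
  generator : ∀ u f : H, FormOperatorGraph q u f ↔
    Tendsto (fun t : ℝ≥0 => (t : ℝ)⁻¹ • (u - S t u)) (𝓝[>] 0) (𝓝 f)

end Forms

/-! ### Function spaces on `ℝᵈ` -/

/-- The Euclidean space `ℝᵈ`. -/
abbrev E (d : ℕ) : Type := EuclideanSpace ℝ (Fin d)

/-- The real space `L_p(ℝᵈ)` with respect to Lebesgue measure. -/
abbrev L (d : ℕ) (p : ℝ≥0∞) : Type := Lp ℝ p (volume : Measure (E d))

variable {d : ℕ}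

/-- `G ∈ L_2(ℝᵈ; ℝᵈ)` is the weak gradient of `u ∈ L_2(ℝᵈ)`. -/
def IsWeakGradient (u : L d 2) (G : Lp (E d) 2 (volume : Measure (E d))) : Prop :=
  ∀ η : E d → ℝ, ContDiff ℝ (⊤ : ℕ∞) η → HasCompactSupport η → ∀ i : Fin d,
    ∫ x, u x * fderiv ℝ η x (EuclideanSpace.single i 1) = -∫ x, G x i * η x

/-- `W_0^{1,2}(ℝᵈ)`: the functions in `W^{1,2}(ℝᵈ)` that have compact support. -/
def W₀ (d : ℕ) : Set (L d 2) :=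
  {u | (∃ G, IsWeakGradient u G) ∧
    ∃ K : Set (E d), IsCompact K ∧ ∀ᵐ x : E d, x ∉ K → u x = 0}

open Classical in
/-- The weak gradient `∇u` of `u ∈ W^{1,2}(ℝᵈ)` (and `0` for other `u`). -/
def weakGradient (u : L d 2) : Lp (E d) 2 (volume : Measure (E d)) :=
  if h : ∃ G, IsWeakGradient u G then h.choose else 0

/-! ### The form with coefficients `C`, and the growth condition -/

/-- The standing assumptions on the coefficients `C = (c_ij)`: the `c_ij` are real-valued,
(Lebesgue) measurable and locally bounded, and `C(x)` is symmetric and `C(x) ≥ 0` for almost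
every `x`. -/
structure IsCoefficientMatrix (C : E d → Matrix (Fin d) (Fin d) ℝ) : Prop where
  locallyBounded : ∀ i j : Fin d, ∀ K : Set (E d), IsCompact K →
    MemLp (fun x => C x i j) ∞ (volume.restrict K)
  posSemidef : ∀ᵐ x : E d, (C x).PosSemidef

open Classical in
/-- The form `h` with domain `D(h) = W_0^{1,2}(ℝᵈ)` and
`h(u) = ∑_{i,j} (∂_i u, c_ij ∂_j u)`. -/
def form (C : E d → Matrix (Fin d) (Fin d) ℝ) (u : L d 2) : ℝ≥0∞ :=
  if u ∈ W₀ d then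
    ENNReal.ofReal (∑ i, ∑ j, ∫ x, weakGradient u x i * (C x i j * weakGradient u x j))
  else ∞

/-- `ν(s) = ess sup_{|x| ≤ s} ‖C(x)‖`, with the operator norm of the matrix `C(x)` on `ℝᵈ`. -/
def nu (C : E d → Matrix (Fin d) (Fin d) ℝ) (s : ℝ) : ℝ :=
  (essSup (fun x => ‖Matrix.toEuclideanCLM (𝕜 := ℝ) (C x)‖ₑ)
    (volume.restrict (Metric.closedBall (0 : E d) s))).toReal

/-- `ρ(s) = ∫_0^s (1 + ν(t))^{-1/2} dt`. -/
def rho (C : E d → Matrix (Fin d) (Fin d) ℝ) (s : ℝ) : ℝ :=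
  ∫ t in (0 : ℝ)..s, (1 + nu C t) ^ (-(1 / 2) : ℝ)

/-- The balls `B_ρ(r) = {x | ρ(|x|) < r}`. -/
def rhoBall (C : E d → Matrix (Fin d) (Fin d) ℝ) (r : ℝ) : Set (E d) :=
  {x | rho C ‖x‖ < r}

/-- The Tikhonov growth condition: `|B_ρ(r)| ≤ a e^{b r²}` for all large `r`. -/
def TikhonovGrowth (C : E d → Matrix (Fin d) (Fin d) ℝ) : Prop :=
  ∃ a b : ℝ, 0 < a ∧ 0 < b ∧ ∀ᶠ r : ℝ in atTop,
    volume (rhoBall C r) ≤ ENNReal.ofReal (a * Real.exp (b * r ^ 2))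

/-! ### Conservative semigroups -/

/-- `T` is the extension of the bounded operator `A` on `L_2(ℝᵈ)` to `L_∞(ℝᵈ)`: it agrees with
`A` on `L_2 ∩ L_∞` and it is weak* continuous, i.e. it is the adjoint of a map `L_1 → L_1`.
There is at most one such `T`, because `L_2 ∩ L_∞` is weak* dense in `L_∞`. -/
structure IsLinftyExtension (A : L d 2 →L[ℝ] L d 2) (T : L d ∞ →L[ℝ] L d ∞) : Prop where
  agrees : ∀ (u : L d 2) (f : L d ∞), u =ᵐ[volume] f → A u =ᵐ[volume] T f
  weakStar : ∀ g : L d 1, ∃ g' : L d 1, ∀ f : L d ∞,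
    ∫ x, T f x * g x = ∫ x, f x * g' x

/-- The constant function `1` as an element of `L_∞(ℝᵈ)`. -/
def oneLinfty (d : ℕ) : L d ∞ := MemLp.toLp (fun _ : E d => (1 : ℝ)) (memLp_top_const 1)

/-- `S` is conservative: each `S_t`, `t > 0`, extends to `L_∞(ℝᵈ)`, and `S_t 1 = 1`. -/
def IsConservative (S : ℝ≥0 → L d 2 →L[ℝ] L d 2) : Prop :=
  ∀ t : ℝ≥0, 0 < t →
    ∃ T : L d ∞ →L[ℝ] L d ∞, IsLinftyExtension (S t) T ∧ T (oneLinfty d) = oneLinfty d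

end DegenerateElliptic

end

/-!
The relaxation of the form is the lower semicontinuous envelope of the energy on Lipschitz
functions with compact support, which are a core by mollification. Normal contractions decrease
the energy, so that the semigroup is symmetric and sub-Markovian and extends to `L_∞`; it is
conservative if and only if it preserves the integral of enough functions `u ∈ L_1 ∩ L_2`.

This is the argument of Täcklind and Tikhonov. The function `x ↦ ρ(|x|)` has energy density at most
`1`. Let `u` be supported in a fixed ball and let `0 ≤ η ≤ 1` be a cutoff function that is `1` where
`ρ ≤ R` and `0` where `ρ ≥ R + 1`. The change of `(S_t u, η)` in time is an integral of the energy
density of `S_t u` and `η`, which lives at distance about `R`. Energy estimates with the weights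
`e^{2α min(ρ, R)}` show that the energy of `S_t u` there is at most `e^{-2αR}` times a constant if
`α² t` is moderate, whereas the volume is at most `e^{b (R + 2)²}`. With `α` proportional to `R / t`
the first factor wins for all `t` below a threshold that depends only on `b`, and the semigroup
property gives all other `t`.
-/

open MeasureTheory Filter Topology
open scoped ENNReal NNReal

noncomputable section

namespace DegenerateElliptic

/-! ### Quadratic forms and their polar forms -/

namespace IsQuadraticForm

variable {H : Type*} [NormedAddCommGroup H] [InnerProductSpace ℝ H] {q : H → ℝ≥0∞}

lemma map_zero (hq : IsQuadraticForm q) : q 0 = 0 := by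
  simpa using hq.smul 0 0

lemma map_neg (hq : IsQuadraticForm q) (u : H) : q (-u) = q u := by
  simpa using hq.smul (-1) u

lemma map_sub_rev (hq : IsQuadraticForm q) (u v : H) : q (u - v) = q (v - u) := by
  rw [← neg_sub, hq.map_neg]

lemma smul_ne_top (hq : IsQuadraticForm q) (c : ℝ) {u : H} (hu : q u ≠ ∞) : q (c • u) ≠ ∞ := by
  rw [hq.smul]
  exact ENNReal.mul_ne_top ENNReal.ofReal_ne_top hu

lemma add_ne_top (hq : IsQuadraticForm q) {u v : H} (hu : q u ≠ ∞) (hv : q v ≠ ∞) :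
    q (u + v) ≠ ∞ := by
  refine ne_top_of_le_ne_top ?_ (le_self_add.trans (hq.parallelogram u v).le)
  finiteness

lemma sub_ne_top (hq : IsQuadraticForm q) {u v : H} (hu : q u ≠ ∞) (hv : q v ≠ ∞) :
    q (u - v) ≠ ∞ := by
  rw [sub_eq_add_neg]
  exact hq.add_ne_top hu (by rwa [hq.map_neg])

lemma toReal_smul (hq : IsQuadraticForm q) (c : ℝ) (u : H) :
    (q (c • u)).toReal = c ^ 2 * (q u).toReal := by
  rw [hq.smul, ENNReal.toReal_mul, ENNReal.toReal_ofReal (sq_nonneg c)]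

lemma toReal_parallelogram (hq : IsQuadraticForm q) {u v : H} (hu : q u ≠ ∞) (hv : q v ≠ ∞) :
    (q (u + v)).toReal + (q (u - v)).toReal = 2 * (q u).toReal + 2 * (q v).toReal := by
  have := congrArg ENNReal.toReal (hq.parallelogram u v)
  rwa [ENNReal.toReal_add (hq.add_ne_top hu hv) (hq.sub_ne_top hu hv),
    ENNReal.toReal_add (by finiteness) (by finiteness), ENNReal.toReal_mul,
    ENNReal.toReal_mul, ENNReal.toReal_ofNat] at this

lemma polar_comm (hq : IsQuadraticForm q) (u v : H) : polar q u v = polar q v u := by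
  rw [polar, polar, add_comm u v, hq.map_sub_rev u v]

lemma polar_self (hq : IsQuadraticForm q) (u : H) : polar q u u = (q u).toReal := by
  have hdouble : (q (u + u)).toReal = 4 * (q u).toReal := by
    rw [← two_smul ℝ u, hq.toReal_smul]
    norm_num
  rw [polar, hdouble, sub_self, hq.map_zero, ENNReal.toReal_zero, sub_zero,
    mul_div_cancel_left₀ _ four_ne_zero]

lemma polar_zero_left (hq : IsQuadraticForm q) (u : H) : polar q 0 u = 0 := by
  rw [polar, zero_add, zero_sub, hq.map_neg, sub_self, zero_div]

lemma polar_add_polar (hq : IsQuadraticForm q) {x y z : H} (hx : q x ≠ ∞) (hy : q y ≠ ∞)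
    (hz : q z ≠ ∞) :
    polar q x z + polar q y z = 2 * polar q ((2⁻¹ : ℝ) • (x + y)) z := by
  have hplus := hq.toReal_parallelogram (hq.add_ne_top hx hz) (hq.add_ne_top hy hz)
  have hminus := hq.toReal_parallelogram (hq.sub_ne_top hx hz) (hq.sub_ne_top hy hz)
  rw [show x + z + (y + z) = (2 : ℝ) • ((2⁻¹ : ℝ) • (x + y) + z) by module, hq.toReal_smul,
    add_sub_add_right_eq_sub] at hplus
  rw [show x - z + (y - z) = (2 : ℝ) • ((2⁻¹ : ℝ) • (x + y) - z) by module, hq.toReal_smul,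
    sub_sub_sub_cancel_right] at hminus
  simp only [polar]
  linarith

lemma polar_add_left (hq : IsQuadraticForm q) {x y z : H} (hx : q x ≠ ∞) (hy : q y ≠ ∞)
    (hz : q z ≠ ∞) : polar q (x + y) z = polar q x z + polar q y z := by
  have hzero : q (0 : H) ≠ ∞ := hq.map_zero.trans_ne ENNReal.zero_ne_top
  have h := hq.polar_add_polar (hq.add_ne_top hx hy) hzero hz
  rw [hq.polar_zero_left, add_zero, add_zero] at h
  rw [h, hq.polar_add_polar hx hy hz]

lemma abs_polar_le (hq : IsQuadraticForm q) {u v : H} (hu : q u ≠ ∞) (hv : q v ≠ ∞) :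
    |polar q u v| ≤ ((q u).toReal + (q v).toReal) / 2 := by
  have := hq.toReal_parallelogram hu hv
  have : 0 ≤ (q (u + v)).toReal := ENNReal.toReal_nonneg
  have : 0 ≤ (q (u - v)).toReal := ENNReal.toReal_nonneg
  rw [polar, abs_le]
  constructor <;> linarith

/-- An additive function on `ℝ` that is bounded near `0` is linear. -/
lemma polar_smul_left (hq : IsQuadraticForm q) (c : ℝ) {x z : H} (hx : q x ≠ ∞)
    (hz : q z ≠ ∞) : polar q (c • x) z = c * polar q x z := by
  let f : ℝ →+ ℝ :=
    { toFun := fun c => polar q (c • x) z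
      map_zero' := by rw [zero_smul, hq.polar_zero_left]
      map_add' := fun a b => by
        rw [add_smul, hq.polar_add_left (hq.smul_ne_top a hx) (hq.smul_ne_top b hx) hz] }
  have hf : Continuous f := by
    refine f.continuous_of_isBounded_nhds_zero (s := Metric.closedBall 0 1)
      (Metric.closedBall_mem_nhds _ one_pos) ((Metric.isBounded_closedBall (x := (0 : ℝ))
        (r := ((q x).toReal + (q z).toReal) / 2)).subset ?_)
    rintro _ ⟨a, ha, rfl⟩
    rw [mem_closedBall_zero_iff, Real.norm_eq_abs] at ha ⊢
    refine (hq.abs_polar_le (hq.smul_ne_top a hx) hz).trans ?_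
    rw [hq.toReal_smul]
    gcongr
    exact mul_le_of_le_one_left ENNReal.toReal_nonneg (sq_le_one_iff_abs_le_one a |>.2 ha)
  simpa [f] using map_real_smul f hf c 1

lemma polar_sub_left (hq : IsQuadraticForm q) {x y z : H} (hx : q x ≠ ∞) (hy : q y ≠ ∞)
    (hz : q z ≠ ∞) : polar q (x - y) z = polar q x z - polar q y z := by
  rw [eq_sub_iff_add_eq, ← hq.polar_add_left (hq.sub_ne_top hx hy) hy hz, sub_add_cancel]

lemma toReal_add (hq : IsQuadraticForm q) {u v : H} (hu : q u ≠ ∞) (hv : q v ≠ ∞) :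
    (q (u + v)).toReal = (q u).toReal + 2 * polar q u v + (q v).toReal := by
  have := hq.toReal_parallelogram hu hv
  rw [polar]
  linarith

lemma toReal_add_smul (hq : IsQuadraticForm q) (c : ℝ) {u v : H} (hu : q u ≠ ∞) (hv : q v ≠ ∞) :
    (q (u + c • v)).toReal = (q u).toReal + 2 * c * polar q u v + c ^ 2 * (q v).toReal := by
  rw [hq.toReal_add hu (hq.smul_ne_top c hv), hq.polar_comm, hq.polar_smul_left c hv hu,
    hq.polar_comm, hq.toReal_smul]
  ring

lemma polar_sq_le (hq : IsQuadraticForm q) {u v : H} (hu : q u ≠ ∞) (hv : q v ≠ ∞) :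
    polar q u v ^ 2 ≤ (q u).toReal * (q v).toReal := by
  have hdiscrim : discrim (q v).toReal (2 * polar q u v) (q u).toReal ≤ 0 :=
    discrim_le_zero fun t => by
      have := hq.toReal_add_smul t hu hv
      have : 0 ≤ (q (u + t • v)).toReal := ENNReal.toReal_nonneg
      linarith
  rw [discrim] at hdiscrim
  linarith

lemma tendsto_toReal_of_tendsto_sub (hq : IsQuadraticForm q) {ι : Type*} {l : Filter ι}
    {v : ι → H} {u : H} {c : ℝ} (hv : ∀ i, q (v i) ≠ ∞) (hu : q u ≠ ∞)
    (hc : Tendsto (fun i => (q (v i)).toReal) l (𝓝 c))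
    (hsub : Tendsto (fun i => q (v i - u)) l (𝓝 0)) [l.NeBot] : (q u).toReal = c := by
  have hd : ∀ i, q (v i - u) ≠ ∞ := fun i => hq.sub_ne_top (hv i) hu
  have hsub' : Tendsto (fun i => (q (v i - u)).toReal) l (𝓝 0) :=
    (ENNReal.tendsto_toReal ENNReal.zero_ne_top).comp hsub
  have hpolar : Tendsto (fun i => polar q (v i) (v i - u)) l (𝓝 0) := by
    have hprod := (hc.mul hsub').sqrt
    rw [mul_zero, Real.sqrt_zero] at hprod
    exact squeeze_zero_norm (fun i => Real.abs_le_sqrt (hq.polar_sq_le (hv i) (hd i))) hprod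
  have hexpand : ∀ i, (q u).toReal =
      (q (v i)).toReal - 2 * polar q (v i) (v i - u) + (q (v i - u)).toReal := by
    intro i
    have h := hq.toReal_add_smul (-1) (hv i) (hd i)
    rw [show v i + (-1 : ℝ) • (v i - u) = u by module] at h
    linarith
  have hlim := (hc.sub (hpolar.const_mul 2)).add hsub'
  simp only [← hexpand, mul_zero, sub_zero, add_zero] at hlim
  exact tendsto_nhds_unique tendsto_const_nhds hlim

lemma of_ne_top (zero : q 0 ≠ ∞)
    (smul : ∀ (c : ℝ) (u : H), q u ≠ ∞ → q (c • u) = ENNReal.ofReal (c ^ 2) * q u)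
    (parallelogram : ∀ u v : H, q u ≠ ∞ → q v ≠ ∞ → q (u + v) + q (u - v) = 2 * q u + 2 * q v) :
    IsQuadraticForm q := by
  have smul_ne_top : ∀ (c : ℝ) {u : H}, q u ≠ ∞ → q (c • u) ≠ ∞ := fun c u hu => by
    rw [smul c u hu]
    exact ENNReal.mul_ne_top ENNReal.ofReal_ne_top hu
  have of_smul_ne_top : ∀ {c : ℝ} {u : H}, c ≠ 0 → q (c • u) ≠ ∞ → q u ≠ ∞ := fun {c u} hc hu => by
    simpa only [inv_smul_smul₀ hc] using smul_ne_top c⁻¹ hu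
  have add_sub_ne_top : ∀ {u v : H}, q u ≠ ∞ → q v ≠ ∞ → q (u + v) ≠ ∞ ∧ q (u - v) ≠ ∞ :=
    fun {u v} hu hv => by
      rw [← ENNReal.add_ne_top, parallelogram u v hu hv]
      exact ENNReal.add_ne_top.2
        ⟨ENNReal.mul_ne_top ENNReal.ofNat_ne_top hu, ENNReal.mul_ne_top ENNReal.ofNat_ne_top hv⟩
  refine ⟨fun c u => ?_, fun u v => ?_⟩
  · rcases eq_or_ne (q u) ∞ with hu | hu
    · rcases eq_or_ne c 0 with rfl | hc
      · have q_zero : q 0 = 0 := by simpa using smul 0 0 zero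
        simp [q_zero]
      · have hcu : q (c • u) = ∞ := not_not.1 fun h => of_smul_ne_top hc h hu
        rw [hcu, hu, ENNReal.mul_top (by positivity)]
    · exact smul c u hu
  · by_cases h : q u ≠ ∞ ∧ q v ≠ ∞
    · exact parallelogram u v h.1 h.2
    · have h_right : 2 * q u + 2 * q v = ∞ := by
        rcases not_and_or.1 h with h | h <;> simp [not_not.1 h]
      have h_left : q (u + v) + q (u - v) = ∞ := by
        by_contra h_fin
        obtain ⟨h_add, h_sub⟩ := ENNReal.add_ne_top.1 h_fin
        obtain ⟨hu, hv⟩ := add_sub_ne_top h_add h_sub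
        rw [add_add_sub_cancel, ← two_smul ℝ] at hu
        rw [add_sub_sub_cancel, ← two_smul ℝ] at hv
        exact h ⟨of_smul_ne_top two_ne_zero hu, of_smul_ne_top two_ne_zero hv⟩
      rw [h_left, h_right]

end IsQuadraticForm

/-! ### Lower semicontinuous envelopes and the relaxation -/

section LscEnvelope

variable {X : Type*} [TopologicalSpace X] {q : X → ℝ≥0∞}

/-- The lower semicontinuous envelope of `q`: the largest lower semicontinuous function
below `q`. -/
def lscEnvelope (q : X → ℝ≥0∞) (u : X) : ℝ≥0∞ := liminf q (𝓝 u)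

lemma le_of_lowerSemicontinuous_of_tendsto {ι : Type*} {l : Filter ι} [l.NeBot]
    (hq : LowerSemicontinuous q) {x : ι → X} {y : X} (hx : Tendsto x l (𝓝 y))
    {c : ι → ℝ≥0∞} {a : ℝ≥0∞} (hc : Tendsto c l (𝓝 a)) (h : ∀ i, q (x i) ≤ c i) : q y ≤ a :=
  calc q y ≤ liminf q (𝓝 y) := hq.le_liminf y
    _ ≤ liminf (q ∘ x) l := liminf_le_liminf_of_le hx
    _ ≤ liminf c l := liminf_le_liminf (.of_forall h)
    _ = a := hc.liminf_eq

lemma lowerSemicontinuous_lscEnvelope (q : X → ℝ≥0∞) : LowerSemicontinuous (lscEnvelope q) := by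
  intro u y hy
  obtain ⟨z, hyz, hz⟩ := exists_between hy
  filter_upwards [eventually_eventually_nhds.2 (eventually_lt_of_lt_liminf hz)] with w hw
  exact hyz.trans_le (le_liminf_of_le (by isBoundedDefault) (hw.mono fun _ hx => hx.le))

lemma lscEnvelope_le (q : X → ℝ≥0∞) : lscEnvelope q ≤ q := fun _ =>
  le_of_forall_lt fun _ hc => (eventually_lt_of_lt_liminf hc).self_of_nhds

lemma le_lscEnvelope {k : X → ℝ≥0∞} (hk : LowerSemicontinuous k) (hkq : k ≤ q) :
    k ≤ lscEnvelope q := fun u =>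
  (hk.le_liminf u).trans (liminf_le_liminf (.of_forall hkq))

lemma exists_tendsto_lscEnvelope [FirstCountableTopology X] {u : X} (hu : lscEnvelope q u ≠ ∞) :
    ∃ v : ℕ → X, (∀ n, q (v n) ≠ ∞) ∧ Tendsto v atTop (𝓝 u) ∧
      Tendsto (fun n => q (v n)) atTop (𝓝 (lscEnvelope q u)) := by
  obtain ⟨v, hqv, hv⟩ := exists_seq_tendsto_liminf (f := 𝓝 u) (u := q)
  obtain ⟨N, hN⟩ := eventually_atTop.1 (hqv.eventually_ne hu)
  exact ⟨fun n => v (n + N), fun n => hN _ (Nat.le_add_left N n),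
    hv.comp (tendsto_add_atTop_nat N), hqv.comp (tendsto_add_atTop_nat N)⟩

lemma tendsto_min_toReal {ι : Type*} {l : Filter ι} {x : ι → X} {u : X}
    (hx : Tendsto x l (𝓝 u)) (hfin : ∀ i, q (x i) ≠ ∞) :
    Tendsto (fun i => min (q (x i)).toReal (lscEnvelope q u).toReal) l
      (𝓝 (lscEnvelope q u).toReal) := by
  refine tendsto_order.2
    ⟨fun r hr => ?_, fun r hr => .of_forall fun _ => (min_le_right _ _).trans_lt hr⟩
  suffices ∀ᶠ i in l, r < (q (x i)).toReal from this.mono fun i hi => lt_min hi hr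
  rcases lt_or_ge r 0 with hneg | hpos
  · exact .of_forall fun _ => hneg.trans_le ENNReal.toReal_nonneg
  · have hlt : ENNReal.ofReal r < liminf q (𝓝 u) := (ENNReal.ofReal_lt_iff_lt_toReal hpos
      (ENNReal.toReal_pos_iff.1 (hpos.trans_lt hr)).2.ne).2 hr
    filter_upwards [hx.eventually (eventually_lt_of_lt_liminf hlt)] with i hi
    exact (ENNReal.ofReal_lt_iff_lt_toReal hpos (hfin i)).1 hi

end LscEnvelope

section Relaxation

variable {H : Type*} [NormedAddCommGroup H] [InnerProductSpace ℝ H] {q : H → ℝ≥0∞}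

namespace IsQuadraticForm

lemma lscEnvelope_smul_le (hq : IsQuadraticForm q) (c : ℝ) (u : H) :
    lscEnvelope q (c • u) ≤ ENNReal.ofReal (c ^ 2) * lscEnvelope q u := by
  rcases eq_or_ne c 0 with rfl | hc
  · rw [zero_smul]
    exact (lscEnvelope_le q 0).trans (hq.map_zero.trans_le zero_le)
  by_cases hu : lscEnvelope q u = ∞
  · rw [hu, ENNReal.mul_top (ENNReal.ofReal_pos.2 (by positivity)).ne']
    exact le_top
  obtain ⟨v, -, hv, hqv⟩ := exists_tendsto_lscEnvelope hu
  exact le_of_lowerSemicontinuous_of_tendsto (lowerSemicontinuous_lscEnvelope q)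
    (hv.const_smul c) (ENNReal.Tendsto.const_mul hqv (Or.inr ENNReal.ofReal_ne_top))
    fun n => (lscEnvelope_le q _).trans (hq.smul c (v n)).le

lemma lscEnvelope_smul (hq : IsQuadraticForm q) (c : ℝ) (u : H) :
    lscEnvelope q (c • u) = ENNReal.ofReal (c ^ 2) * lscEnvelope q u := by
  refine le_antisymm (hq.lscEnvelope_smul_le c u) ?_
  rcases eq_or_ne c 0 with rfl | hc
  · simp
  calc ENNReal.ofReal (c ^ 2) * lscEnvelope q u
      = ENNReal.ofReal (c ^ 2) * lscEnvelope q (c⁻¹ • c • u) := by rw [inv_smul_smul₀ hc]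
    _ ≤ ENNReal.ofReal (c ^ 2) * (ENNReal.ofReal (c⁻¹ ^ 2) * lscEnvelope q (c • u)) := by
      gcongr
      exact hq.lscEnvelope_smul_le c⁻¹ (c • u)
    _ = lscEnvelope q (c • u) := by
      rw [← mul_assoc, ← ENNReal.ofReal_mul (sq_nonneg c), ← mul_pow, mul_inv_cancel₀ hc,
        one_pow, ENNReal.ofReal_one, one_mul]

lemma lscEnvelope_add_lscEnvelope_sub_le (hq : IsQuadraticForm q) (u v : H) :
    lscEnvelope q (u + v) + lscEnvelope q (u - v) ≤
      2 * lscEnvelope q u + 2 * lscEnvelope q v := by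
  by_cases hu : lscEnvelope q u = ∞
  · simp [hu]
  by_cases hv : lscEnvelope q v = ∞
  · simp [hv]
  obtain ⟨a, -, ha, hqa⟩ := exists_tendsto_lscEnvelope hu
  obtain ⟨b, -, hb, hqb⟩ := exists_tendsto_lscEnvelope hv
  have hlsc : LowerSemicontinuous fun p : H × H => lscEnvelope q p.1 + lscEnvelope q p.2 :=
    ((lowerSemicontinuous_lscEnvelope q).comp continuous_fst).add
      ((lowerSemicontinuous_lscEnvelope q).comp continuous_snd)
  refine le_of_lowerSemicontinuous_of_tendsto hlsc (y := (u + v, u - v))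
    ((ha.add hb).prodMk_nhds (ha.sub hb))
    ((ENNReal.Tendsto.const_mul hqa (Or.inr ENNReal.ofNat_ne_top)).add
      (ENNReal.Tendsto.const_mul hqb (Or.inr ENNReal.ofNat_ne_top))) fun n => ?_
  rw [← hq.parallelogram]
  exact add_le_add (lscEnvelope_le q _) (lscEnvelope_le q _)

end IsQuadraticForm

/-- The two inequalities of the parallelogram law are exchanged by the substitution
`(u, v) ↦ (u + v, u - v)`. -/
lemma isQuadraticForm_lscEnvelope (hq : IsQuadraticForm q) :
    IsQuadraticForm (lscEnvelope q) := by
  refine ⟨hq.lscEnvelope_smul, fun u v =>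
    le_antisymm (hq.lscEnvelope_add_lscEnvelope_sub_le u v) ?_⟩
  have h := hq.lscEnvelope_add_lscEnvelope_sub_le (u + v) (u - v)
  rw [show u + v + (u - v) = (2 : ℝ) • u by module, show u + v - (u - v) = (2 : ℝ) • v by module,
    hq.lscEnvelope_smul, hq.lscEnvelope_smul, ← mul_add, ← mul_add, sq,
    ENNReal.ofReal_mul two_pos.le, ENNReal.ofReal_ofNat, mul_assoc] at h
  rw [← mul_add]
  exact (ENNReal.mul_le_mul_iff_right two_ne_zero ENNReal.ofNat_ne_top).1 h

lemma isClosedForm_of_lowerSemicontinuous (hq : IsQuadraticForm q)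
    (hlsc : LowerSemicontinuous q) : IsClosedForm q := by
  refine ⟨hq, fun u v hu huv hcauchy => ?_⟩
  have hlim : Tendsto (fun n => q (u n - v)) atTop (𝓝 0) := by
    refine ENNReal.tendsto_nhds_zero.2 fun ε hε => ?_
    have hε' := hcauchy.eventually_le_const hε
    rw [← prod_atTop_atTop_eq] at hε'
    filter_upwards [hε'.curry] with n hn
    by_contra! hlt
    obtain ⟨m, hlt', hle⟩ :=
      (((tendsto_const_nhds.sub huv).eventually (hlsc _ _ hlt)).and hn).exists
    exact hlt'.not_ge hle
  refine ⟨?_, hlim⟩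
  obtain ⟨n, hn⟩ := (hlim.eventually_ne ENNReal.zero_ne_top).exists
  simpa only [sub_sub_cancel] using hq.sub_ne_top (hu n) hn

/-- The midpoints `(v m + v n) / 2` converge to `u` as well, so that the parallelogram law bounds
`q (v m - v n)` by a null sequence. -/
lemma tendsto_sub_of_tendsto_lscEnvelope (hq : IsQuadraticForm q) {v : ℕ → H} {u : H}
    (hv : ∀ n, q (v n) ≠ ∞) (hvu : Tendsto v atTop (𝓝 u)) (hu : lscEnvelope q u ≠ ∞)
    (hqv : Tendsto (fun n => q (v n)) atTop (𝓝 (lscEnvelope q u))) :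
    Tendsto (fun p : ℕ × ℕ => q (v p.1 - v p.2)) atTop (𝓝 0) := by
  set c := (lscEnvelope q u).toReal
  have hqv' : Tendsto (fun n => (q (v n)).toReal) atTop (𝓝 c) :=
    (ENNReal.tendsto_toReal hu).comp hqv
  have hfst : Tendsto (Prod.fst : ℕ × ℕ → ℕ) atTop atTop := by
    rw [← prod_atTop_atTop_eq]; exact tendsto_fst
  have hsnd : Tendsto (Prod.snd : ℕ × ℕ → ℕ) atTop atTop := by
    rw [← prod_atTop_atTop_eq]; exact tendsto_snd
  set mid : ℕ × ℕ → H := fun p => (2⁻¹ : ℝ) • (v p.1 + v p.2)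
  have hmid : Tendsto mid atTop (𝓝 u) := by
    have := ((hvu.comp hfst).add (hvu.comp hsnd)).const_smul (2⁻¹ : ℝ)
    rwa [← two_smul ℝ u, inv_smul_smul₀ two_ne_zero] at this
  have hmidfin : ∀ p, q (mid p) ≠ ∞ := fun p => hq.smul_ne_top _ (hq.add_ne_top (hv _) (hv _))
  have hle : ∀ p : ℕ × ℕ, (q (v p.1 - v p.2)).toReal ≤
      2 * (q (v p.1)).toReal + 2 * (q (v p.2)).toReal - 4 * min (q (mid p)).toReal c := by
    intro p
    have hpar := hq.toReal_parallelogram (hv p.1) (hv p.2)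
    rw [show v p.1 + v p.2 = (2 : ℝ) • mid p by simp only [mid]; module, hq.toReal_smul] at hpar
    linarith [min_le_left (q (mid p)).toReal c]
  have hbound := (((hqv'.comp hfst).const_mul 2).add ((hqv'.comp hsnd).const_mul 2)).sub
    ((tendsto_min_toReal hmid hmidfin).const_mul 4)
  rw [show 2 * c + 2 * c - 4 * c = 0 by ring] at hbound
  rw [← ENNReal.tendsto_toReal_iff (fun p => hq.sub_ne_top (hv _) (hv _)) ENNReal.zero_ne_top]
  exact squeeze_zero (fun _ => ENNReal.toReal_nonneg) hle hbound

lemma lowerSemicontinuous_of_isClosedForm (hq : IsClosedForm q) : LowerSemicontinuous q := by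
  refine lowerSemicontinuous_iff_le_liminf.2 fun u => ?_
  change q u ≤ lscEnvelope q u
  by_cases htop : lscEnvelope q u = ∞
  · exact htop ▸ le_top
  obtain ⟨v, hv, hvu, hqv⟩ := exists_tendsto_lscEnvelope htop
  obtain ⟨hu, hlim⟩ := hq.closed v u hv hvu
    (tendsto_sub_of_tendsto_lscEnvelope hq.toIsQuadraticForm hv hvu htop hqv)
  exact ((ENNReal.toReal_eq_toReal_iff' hu htop).1 (hq.tendsto_toReal_of_tendsto_sub hv hu
    ((ENNReal.tendsto_toReal htop).comp hqv) hlim)).le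

theorem isRelaxation_lscEnvelope {k : H → ℝ≥0∞} (hk : IsQuadraticForm k) (hqk : q ≤ k)
    (hkq : lscEnvelope k ≤ q) : IsRelaxation q (lscEnvelope k) :=
  ⟨⟨isClosedForm_of_lowerSemicontinuous (isQuadraticForm_lscEnvelope hk)
    (lowerSemicontinuous_lscEnvelope k), hkq⟩,
    fun _ hp => le_lscEnvelope (lowerSemicontinuous_of_isClosedForm hp.1) (hp.2.trans hqk)⟩

lemma tendsto_of_two_mul_sub_sq_mul_le {ι : Type*} {l : Filter ι} {p : ι → ℝ} {p₀ N : ℝ}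
    (h : ∀ s r : ℝ, r < 2 * s * p₀ - s ^ 2 * N → ∀ᶠ i in l, r < 2 * s * p i) :
    Tendsto p l (𝓝 p₀) := by
  refine tendsto_order.2 ⟨fun r hr => ?_, fun r hr => ?_⟩
  all_goals
    obtain ⟨s, hs, hsN⟩ : ∃ s : ℝ, 0 < s ∧ s * N < 2 * |r - p₀| := by
      have habs : 0 < |r - p₀| := abs_pos.2 (sub_ne_zero.2 (by grind))
      refine ⟨|r - p₀| / (|N| + 1), by positivity, ?_⟩
      rw [div_mul_eq_mul_div, div_lt_iff₀ (by positivity)]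
      nlinarith [le_abs_self N, abs_nonneg N]
  · rw [abs_of_neg (sub_neg.2 hr)] at hsN
    filter_upwards [h s (2 * s * r) (by nlinarith)] with i hi
    exact lt_of_mul_lt_mul_left hi (by positivity)
  · rw [abs_of_pos (sub_pos.2 hr)] at hsN
    filter_upwards [h (-s) (-(2 * s * r)) (by nlinarith)] with i hi
    exact lt_of_mul_lt_mul_left (a := 2 * s) (by linarith) (by positivity)

lemma tendsto_polar_lscEnvelope (hq : IsQuadraticForm q) {ι : Type*} {l : Filter ι}
    {u v : H} {a b : ι → H} (ha : Tendsto a l (𝓝 u))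
    (hqa : Tendsto (fun n => q (a n)) l (𝓝 (lscEnvelope q u)))
    (hafin : ∀ n, q (a n) ≠ ∞) (hu : lscEnvelope q u ≠ ∞) (hb : Tendsto b l (𝓝 v))
    {M : ℝ≥0} (hM : ∀ n, q (b n) ≤ M) (hv : lscEnvelope q v ≠ ∞) :
    Tendsto (fun n => polar q (a n) (b n)) l (𝓝 (polar (lscEnvelope q) u v)) := by
  have hQ := isQuadraticForm_lscEnvelope hq
  have hbfin : ∀ n, q (b n) ≠ ∞ := fun n => ne_top_of_le_ne_top ENNReal.coe_ne_top (hM n)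
  refine tendsto_of_two_mul_sub_sq_mul_le (N := M) fun s r hr => ?_
  have hfin : ∀ n, q (a n + s • b n) ≠ ∞ := fun n =>
    hq.add_ne_top (hafin n) (hq.smul_ne_top s (hbfin n))
  have hlower := ((tendsto_min_toReal (ha.add (hb.const_smul s)) hfin).sub
    ((ENNReal.tendsto_toReal hu).comp hqa)).sub_const (s ^ 2 * M)
  have hr' : r < (lscEnvelope q (u + s • v)).toReal - (lscEnvelope q u).toReal - s ^ 2 * M := by
    rw [hQ.toReal_add_smul s hu hv]
    have : 0 ≤ s ^ 2 * (lscEnvelope q v).toReal := by positivity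
    linarith
  filter_upwards [hlower.eventually_const_lt hr'] with n hn
  have hexpand := hq.toReal_add_smul s (hafin n) (hbfin n)
  have hbM : s ^ 2 * (q (b n)).toReal ≤ s ^ 2 * M := by
    gcongr
    exact ENNReal.toReal_mono ENNReal.coe_ne_top (hM n)
  have hmin := min_le_left (q (a n + s • b n)).toReal (lscEnvelope q (u + s • v)).toReal
  simp only [Function.comp_apply] at hn
  linarith

end Relaxation

/-! ### Resolvents and the Yosida approximation -/

section Resolvent

variable {H : Type*} [NormedAddCommGroup H] [InnerProductSpace ℝ H] {q : H → ℝ≥0∞} {l : ℝ}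

/-- The domain of the quadratic form `q` as a linear subspace. -/
def IsQuadraticForm.domain (hq : IsQuadraticForm q) : Submodule ℝ H where
  carrier := {u | q u ≠ ∞}
  add_mem' := hq.add_ne_top
  zero_mem' := by simp [hq.map_zero]
  smul_mem' c _ := hq.smul_ne_top c

/-- The domain of the quadratic form `q`, to be equipped with the inner product
`q(u, v) + l (u, v)`. It is a copy of the subspace `domain`, whose norm is that of `H`. -/
def FormSpace (hq : IsQuadraticForm q) (_ : 0 < l) : Type _ := hq.domain

namespace FormSpace

variable {hq : IsQuadraticForm q} {hl : 0 < l}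

instance : AddCommGroup (FormSpace hq hl) := inferInstanceAs (AddCommGroup hq.domain)

instance : Module ℝ (FormSpace hq hl) := inferInstanceAs (Module ℝ hq.domain)

/-- The embedding of the domain of the form into the ambient Hilbert space. -/
def incl : FormSpace hq hl →ₗ[ℝ] H := hq.domain.subtype

lemma ne_top (u : FormSpace hq hl) : q (incl u) ≠ ∞ := u.2

/-- The inner product `q(u, v) + l (u, v)` on the domain of `q`. -/
@[reducible] def core : InnerProductSpace.Core ℝ (FormSpace hq hl) where
  inner u v := polar q (incl u) (incl v) + l * inner ℝ (incl u) (incl v)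
  conj_inner_symm u v := by
    simp only [conj_trivial, hq.polar_comm (incl v), real_inner_comm (incl u)]
  re_inner_nonneg u := by
    rw [hq.polar_self, real_inner_self_eq_norm_sq]
    exact add_nonneg ENNReal.toReal_nonneg (by positivity)
  add_left u v w := by
    rw [map_add, hq.polar_add_left u.ne_top v.ne_top w.ne_top, inner_add_left]
    ring
  smul_left u v c := by
    rw [map_smul, hq.polar_smul_left c u.ne_top v.ne_top, real_inner_smul_left, conj_trivial]
    ring
  definite u hu := by
    rw [hq.polar_self, real_inner_self_eq_norm_sq] at hu
    have hzero : l * ‖incl u‖ ^ 2 = 0 :=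
      le_antisymm (by linarith [ENNReal.toReal_nonneg (a := q (incl u))]) (by positivity)
    have hincl : incl u = 0 := by simpa [hl.ne'] using hzero
    exact Subtype.ext hincl

instance : NormedAddCommGroup (FormSpace hq hl) := core.toNormedAddCommGroup

instance : InnerProductSpace ℝ (FormSpace hq hl) := InnerProductSpace.ofCore core.toCore

lemma inner_def (u v : FormSpace hq hl) :
    inner ℝ u v = polar q (incl u) (incl v) + l * inner ℝ (incl u) (incl v) := rfl

lemma norm_sq (u : FormSpace hq hl) :
    ‖u‖ ^ 2 = (q (incl u)).toReal + l * ‖incl u‖ ^ 2 := by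
  rw [← real_inner_self_eq_norm_sq, inner_def, hq.polar_self, real_inner_self_eq_norm_sq]

lemma norm_incl_le (u : FormSpace hq hl) : ‖incl u‖ ≤ √l⁻¹ * ‖u‖ := by
  refine le_of_sq_le_sq ?_ (by positivity)
  rw [mul_pow, Real.sq_sqrt (by positivity), norm_sq, inv_mul_eq_div, le_div_iff₀ hl]
  linarith [ENNReal.toReal_nonneg (a := q (incl u))]

/-- The embedding of the domain of the form, as a bounded operator. -/
def inclCLM : FormSpace hq hl →L[ℝ] H := incl.mkContinuous _ norm_incl_le

lemma tendsto_form {ι : Type*} {F : Filter ι} {u : ι → FormSpace hq hl}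
    (hu : Tendsto (fun i => ‖u i‖) F (𝓝 0)) : Tendsto (fun i => q (incl (u i))) F (𝓝 0) := by
  rw [← ENNReal.tendsto_toReal_iff (fun i => (u i).ne_top) ENNReal.zero_ne_top]
  refine squeeze_zero (g := fun i => ‖u i‖ ^ 2) (fun _ => ENNReal.toReal_nonneg) (fun i => ?_)
    (by simpa using hu.pow 2)
  rw [norm_sq]
  exact le_add_of_nonneg_right (by positivity)

lemma tendsto_of_tendsto_incl {ι : Type*} {F : Filter ι} {u : ι → FormSpace hq hl}
    {v : FormSpace hq hl} (hincl : Tendsto (fun i => incl (u i)) F (𝓝 (incl v)))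
    (hform : Tendsto (fun i => q (incl (u i) - incl v)) F (𝓝 0)) : Tendsto u F (𝓝 v) := by
  have hsq : Tendsto (fun i => ‖u i - v‖ ^ 2) F (𝓝 0) := by
    simp only [norm_sq, map_sub]
    have hform' := (ENNReal.tendsto_toReal ENNReal.zero_ne_top).comp hform
    have hincl' := ((tendsto_iff_norm_sub_tendsto_zero.1 hincl).pow 2).const_mul l
    simpa using hform'.add hincl'
  rw [tendsto_iff_norm_sub_tendsto_zero]
  simpa using hsq.sqrt

lemma completeSpace [CompleteSpace H] {hq : IsClosedForm q} :
    CompleteSpace (FormSpace hq.toIsQuadraticForm hl) := by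
  refine Metric.complete_of_cauchySeq_tendsto fun u hu => ?_
  obtain ⟨v, hv⟩ := cauchySeq_tendsto_of_complete
    ((inclCLM (hq := hq.toIsQuadraticForm) (hl := hl)).uniformContinuous.comp_cauchySeq hu)
  have hcauchy : Tendsto (fun p : ℕ × ℕ => q (incl (u p.1) - incl (u p.2))) atTop (𝓝 0) := by
    simp only [← map_sub]
    refine tendsto_form ?_
    simpa only [dist_eq_norm] using cauchySeq_iff_tendsto_dist_atTop_0.1 hu
  obtain ⟨hfin, hlim⟩ := hq.closed (fun n => incl (u n)) v (fun n => (u n).ne_top) hv hcauchy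
  exact ⟨⟨v, hfin⟩, tendsto_of_tendsto_incl hv hlim⟩

end FormSpace

namespace FormOperatorGraph

lemma sub (hq : IsQuadraticForm q) {u v f g : H} (hu : FormOperatorGraph q u f)
    (hv : FormOperatorGraph q v g) : FormOperatorGraph q (u - v) (f - g) :=
  ⟨hq.sub_ne_top hu.1 hv.1, fun w hw => by
    rw [hq.polar_sub_left hu.1 hv.1 hw, hu.2 w hw, hv.2 w hw, inner_sub_left]⟩

lemma add (hq : IsQuadraticForm q) {u v f g : H} (hu : FormOperatorGraph q u f)
    (hv : FormOperatorGraph q v g) : FormOperatorGraph q (u + v) (f + g) :=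
  ⟨hq.add_ne_top hu.1 hv.1, fun w hw => by
    rw [hq.polar_add_left hu.1 hv.1 hw, hu.2 w hw, hv.2 w hw, inner_add_left]⟩

lemma smul (hq : IsQuadraticForm q) (c : ℝ) {u f : H} (hu : FormOperatorGraph q u f) :
    FormOperatorGraph q (c • u) (c • f) :=
  ⟨hq.smul_ne_top c hu.1, fun w hw => by
    rw [hq.polar_smul_left c hu.1 hw, hu.2 w hw, real_inner_smul_left]⟩

lemma inner_eq (hq : IsQuadraticForm q) {u f : H} (hu : FormOperatorGraph q u f) :
    inner ℝ f u = (q u).toReal := by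
  rw [← hu.2 u hu.1, hq.polar_self]

lemma inner_nonneg (hq : IsQuadraticForm q) {u f : H} (hu : FormOperatorGraph q u f) :
    0 ≤ inner ℝ f u := by
  rw [hu.inner_eq hq]
  exact ENNReal.toReal_nonneg

lemma inner_comm (hq : IsQuadraticForm q) {u v f g : H} (hu : FormOperatorGraph q u f)
    (hv : FormOperatorGraph q v g) : inner ℝ f v = inner ℝ u g := by
  rw [← hu.2 v hv.1, hq.polar_comm, hv.2 u hu.1, real_inner_comm]

lemma norm_le_of_resolvent (hq : IsQuadraticForm q) (hl : 0 < l) {u f : H}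
    (hu : FormOperatorGraph q u (l • (f - u))) : ‖u‖ ≤ ‖f‖ := by
  have hinner := hu.inner_nonneg hq
  rw [real_inner_smul_left, inner_sub_left, real_inner_self_eq_norm_sq] at hinner
  have hsq : ‖u‖ * ‖u‖ ≤ ‖f‖ * ‖u‖ := by
    linarith [nonneg_of_mul_nonneg_right hinner hl, real_inner_le_norm f u]
  rcases (norm_nonneg u).eq_or_lt with hzero | hpos
  · exact hzero ▸ norm_nonneg f
  · exact le_of_mul_le_mul_right hsq hpos

lemma eq_of_resolvent (hq : IsQuadraticForm q) (hl : 0 < l) {u v f : H}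
    (hu : FormOperatorGraph q u (l • (f - u))) (hv : FormOperatorGraph q v (l • (f - v))) :
    u = v := by
  have hzero : FormOperatorGraph q (u - v) (l • (0 - (u - v))) := by
    simpa only [← smul_sub, sub_sub_sub_cancel_left, zero_sub, neg_sub] using hu.sub hq hv
  simpa [sub_eq_zero] using hzero.norm_le_of_resolvent hq hl

lemma resolvent_minimal (hq : IsQuadraticForm q) (hl : 0 < l) {u f v : H}
    (hu : FormOperatorGraph q u (l • (f - u))) (hv : q v ≠ ∞) :
    (q u).toReal + l * ‖u - f‖ ^ 2 ≤ (q v).toReal + l * ‖v - f‖ ^ 2 := by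
  have hvu := hq.sub_ne_top hv hu.1
  have hform := hq.toReal_add hu.1 hvu
  have hnorm := norm_add_sq_real (u - f) (v - u)
  rw [add_sub_cancel, hu.2 _ hvu, real_inner_smul_left, ← neg_sub u f, inner_neg_left] at hform
  rw [sub_add_sub_cancel'] at hnorm
  have : 0 ≤ (q (v - u)).toReal := ENNReal.toReal_nonneg
  have : 0 ≤ l * ‖v - u‖ ^ 2 := by positivity
  rw [hform, hnorm]
  linarith

end FormOperatorGraph

/-- Riesz representation of `v ↦ l (f, v)` on the form domain. -/
lemma exists_resolvent [CompleteSpace H] (hq : IsClosedForm q) (hl : 0 < l) (f : H) :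
    ∃ u, FormOperatorGraph q u (l • (f - u)) := by
  have := FormSpace.completeSpace (hq := hq) (hl := hl)
  let φ : FormSpace hq.toIsQuadraticForm hl →L[ℝ] ℝ := (innerSL ℝ (l • f)).comp FormSpace.inclCLM
  let u := (InnerProductSpace.toDual ℝ _).symm φ
  refine ⟨FormSpace.incl u, u.ne_top, fun v hv => ?_⟩
  let w : FormSpace hq.toIsQuadraticForm hl := ⟨v, hv⟩
  have hriesz : inner ℝ u w = inner ℝ (l • f) v := InnerProductSpace.toDual_symm_apply
  rw [FormSpace.inner_def, show FormSpace.incl w = v from rfl] at hriesz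
  rw [smul_sub, inner_sub_left, real_inner_smul_left (FormSpace.incl u), ← hriesz,
    add_sub_cancel_right]

variable [CompleteSpace H]

/-- The operator `l (l + A)⁻¹`, where `A` is the operator associated with the closed form `q`. -/
def resolvent (hq : IsClosedForm q) (hl : 0 < l) : H →L[ℝ] H :=
  LinearMap.mkContinuous
    { toFun := fun f => (exists_resolvent hq hl f).choose
      map_add' := fun f g => by
        refine (exists_resolvent hq hl (f + g)).choose_spec.eq_of_resolvent
          hq.toIsQuadraticForm hl ?_
        convert (exists_resolvent hq hl f).choose_spec.add hq.toIsQuadraticForm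
          (exists_resolvent hq hl g).choose_spec using 1
        module
      map_smul' := fun c f => by
        refine (exists_resolvent hq hl (c • f)).choose_spec.eq_of_resolvent
          hq.toIsQuadraticForm hl ?_
        have hsmul := (exists_resolvent hq hl f).choose_spec.smul hq.toIsQuadraticForm c
        rwa [smul_comm c l, smul_sub c] at hsmul }
    1 fun f => by
      rw [one_mul]
      exact (exists_resolvent hq hl f).choose_spec.norm_le_of_resolvent hq.toIsQuadraticForm hl

lemma graph_resolvent (hq : IsClosedForm q) (hl : 0 < l) (f : H) :
    FormOperatorGraph q (resolvent hq hl f) (l • (f - resolvent hq hl f)) :=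
  (exists_resolvent hq hl f).choose_spec

lemma norm_resolvent_apply_le (hq : IsClosedForm q) (hl : 0 < l) (f : H) :
    ‖resolvent hq hl f‖ ≤ ‖f‖ :=
  (graph_resolvent hq hl f).norm_le_of_resolvent hq.toIsQuadraticForm hl

lemma resolvent_eq (hq : IsClosedForm q) (hl : 0 < l) {f u : H}
    (hu : FormOperatorGraph q u (l • (f - u))) : resolvent hq hl f = u :=
  (graph_resolvent hq hl f).eq_of_resolvent hq.toIsQuadraticForm hl hu

lemma inner_resolvent (hq : IsClosedForm q) (hl : 0 < l) (f g : H) :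
    inner ℝ (resolvent hq hl f) g = inner ℝ f (resolvent hq hl g) := by
  have h := (graph_resolvent hq hl f).inner_comm hq.toIsQuadraticForm (graph_resolvent hq hl g)
  rw [real_inner_smul_left, real_inner_smul_right, inner_sub_left, inner_sub_right] at h
  linarith [mul_left_cancel₀ hl.ne' h]

lemma smul_sub_resolvent (hq : IsClosedForm q) (hl : 0 < l) {u f : H}
    (hu : FormOperatorGraph q u f) : l • (u - resolvent hq hl u) = resolvent hq hl f :=
  (resolvent_eq hq hl ((hu.sub hq.toIsQuadraticForm (graph_resolvent hq hl u)).smul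
    hq.toIsQuadraticForm l)).symm

lemma graph_resolvent_of_graph (hq : IsClosedForm q) (hl : 0 < l) {u f : H}
    (hu : FormOperatorGraph q u f) :
    FormOperatorGraph q (resolvent hq hl u) (resolvent hq hl f) := by
  rw [← smul_sub_resolvent hq hl hu]
  exact graph_resolvent hq hl u

lemma resolvent_comm (hq : IsClosedForm q) (hl : 0 < l) {m : ℝ} (hm : 0 < m) :
    Commute (resolvent hq hl) (resolvent hq hm) := by
  ext f
  have hgraph := graph_resolvent_of_graph hq hl (graph_resolvent hq hm f)
  rw [map_smul, map_sub] at hgraph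
  exact (resolvent_eq hq hm hgraph).symm

/-- The Yosida approximations `-A_n` of `-A`, with parameter `n + 1`. -/
def yosida (hq : IsClosedForm q) (n : ℕ) : H →L[ℝ] H :=
  ((n : ℝ) + 1) • (resolvent hq (n.cast_add_one_pos : (0 : ℝ) < n + 1) - 1)

lemma yosida_apply (hq : IsClosedForm q) (n : ℕ) (u : H) :
    yosida hq n u = ((n : ℝ) + 1) • (resolvent hq n.cast_add_one_pos u - u) := rfl

lemma yosida_comm (hq : IsClosedForm q) (m n : ℕ) : Commute (yosida hq m) (yosida hq n) :=
  (((resolvent_comm hq _ _).sub_left (Commute.one_left _)).sub_right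
    (Commute.one_right _)).smul_left _ |>.smul_right _

lemma inner_yosida_nonpos (hq : IsClosedForm q) (n : ℕ) (u : H) :
    inner ℝ (yosida hq n u) u ≤ 0 := by
  have hn : (0 : ℝ) < n + 1 := n.cast_add_one_pos
  rw [yosida_apply, real_inner_smul_left, inner_sub_left, real_inner_self_eq_norm_mul_norm]
  refine mul_nonpos_of_nonneg_of_nonpos hn.le (sub_nonpos.2 ((real_inner_le_norm _ _).trans ?_))
  gcongr
  exact norm_resolvent_apply_le hq hn u

lemma inner_yosida (hq : IsClosedForm q) (n : ℕ) (u v : H) :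
    inner ℝ (yosida hq n u) v = inner ℝ u (yosida hq n v) := by
  simp only [yosida_apply, real_inner_smul_left, real_inner_smul_right, inner_sub_left,
    inner_sub_right, inner_resolvent]

lemma norm_resolvent_sub_self_le (hq : IsClosedForm q) (hl : 0 < l) {v : H} (hv : q v ≠ ∞) :
    ‖resolvent hq hl v - v‖ ≤ √((q v).toReal * l⁻¹) := by
  have hmin := (graph_resolvent hq hl v).resolvent_minimal hq.toIsQuadraticForm hl hv
  rw [sub_self, norm_zero] at hmin
  have : 0 ≤ (q (resolvent hq hl v)).toReal := ENNReal.toReal_nonneg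
  refine Real.le_sqrt_of_sq_le ?_
  rw [← div_eq_mul_inv, le_div_iff₀ hl]
  linarith

lemma tendsto_resolvent (hq : IsClosedForm q) (hd : Dense {u | q u ≠ ∞}) (f : H) :
    Tendsto (fun n : ℕ => resolvent hq (n.cast_add_one_pos : (0 : ℝ) < n + 1) f) atTop (𝓝 f) := by
  have hdom : ∀ v, q v ≠ ∞ →
      Tendsto (fun n : ℕ => resolvent hq (n.cast_add_one_pos : (0 : ℝ) < n + 1) v) atTop
        (𝓝 v) := fun v hv => by
    rw [tendsto_iff_norm_sub_tendsto_zero]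
    refine squeeze_zero (fun _ => norm_nonneg _)
      (fun n => norm_resolvent_sub_self_le hq n.cast_add_one_pos hv) ?_
    have hsqrt := ((tendsto_one_div_add_atTop_nhds_zero_nat (𝕜 := ℝ)).const_mul (q v).toReal).sqrt
    simpa using hsqrt
  rw [Metric.tendsto_atTop']
  intro ε hε
  obtain ⟨v, hv, hvf⟩ := hd.exists_dist_lt f (show 0 < ε / 3 by positivity)
  obtain ⟨N, hN⟩ := (Metric.tendsto_atTop'.1 (hdom v hv)) (ε / 3) (by positivity)
  refine ⟨N, fun n hn => ?_⟩
  set J := resolvent hq (n.cast_add_one_pos : (0 : ℝ) < n + 1)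
  have hcontr : dist (J f) (J v) ≤ dist f v := by
    rw [dist_eq_norm, dist_eq_norm, ← map_sub]
    exact norm_resolvent_apply_le hq _ _
  have htri := dist_triangle4 (J f) (J v) v f
  rw [dist_comm v f] at htri
  linarith [hN n hn]

lemma dense_graph (hq : IsClosedForm q) (hd : Dense {u | q u ≠ ∞}) :
    Dense {u | ∃ f, FormOperatorGraph q u f} := fun f =>
  mem_closure_of_tendsto (tendsto_resolvent hq hd f)
    (Eventually.of_forall fun _ => ⟨_, graph_resolvent hq _ f⟩)

lemma tendsto_yosida (hq : IsClosedForm q) (hd : Dense {u | q u ≠ ∞}) {u f : H}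
    (hu : FormOperatorGraph q u f) : Tendsto (fun n => yosida hq n u) atTop (𝓝 (-f)) := by
  refine ((tendsto_resolvent hq hd f).neg).congr fun n => ?_
  rw [← smul_sub_resolvent hq _ hu, ← smul_neg, neg_sub, yosida_apply]

end Resolvent

/-! ### Exponentials of bounded dissipative operators -/

section Exponential

open NormedSpace

variable {H : Type*} [NormedAddCommGroup H] [InnerProductSpace ℝ H] [CompleteSpace H]
  {B B' : H →L[ℝ] H} {t : ℝ}

lemma hasDerivAt_exp_apply (B : H →L[ℝ] H) (u : H) (t : ℝ) :
    HasDerivAt (fun s : ℝ => exp (s • B) u) (exp (t • B) (B u)) t :=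
  (hasDerivAt_exp_smul_const B t).clm_apply (hasDerivAt_const t u) |>.congr_deriv (by simp)

lemma norm_exp_apply_le (hB : ∀ u, inner ℝ (B u) u ≤ 0) (ht : 0 ≤ t) (u : H) :
    ‖exp (t • B) u‖ ≤ ‖u‖ := by
  have hder : ∀ s : ℝ, HasDerivAt (fun s : ℝ => ‖exp (s • B) u‖ ^ 2)
      (2 * inner ℝ (exp (s • B) u) (B (exp (s • B) u))) s := fun s => by
    have hcomm : Commute (exp (s • B)) B := ((Commute.refl B).smul_left s).exp_left
    rw [← show exp (s • B) (B u) = B (exp (s • B) u) from DFunLike.congr_fun hcomm.eq u]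
    exact (hasDerivAt_exp_apply B u s).norm_sq
  have hanti : Antitone fun s : ℝ => ‖exp (s • B) u‖ ^ 2 :=
    antitone_of_hasDerivAt_nonpos hder fun s => by
      rw [real_inner_comm]
      exact mul_nonpos_of_nonneg_of_nonpos zero_le_two (hB _)
  simpa only [zero_smul, exp_zero, one_apply_eq_self, sq_le_sq₀, norm_nonneg] using hanti ht

lemma exp_smul_mul_exp_smul_sub (hc : Commute B B') (s t : ℝ) :
    exp (t • B') * exp (s • (B - B')) = exp ((t - s) • B') * exp (s • B) := by
  let _ : NormedAlgebra ℚ (H →L[ℝ] H) := NormedAlgebra.restrictScalars ℚ ℝ _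
  rw [← exp_add_of_commute, ← exp_add_of_commute]
  · congr 1
    module
  · exact (hc.symm.smul_left _).smul_right _
  · exact ((hc.symm.sub_right (Commute.refl _)).smul_left _).smul_right _

lemma norm_exp_sub_exp_apply_le (hB : ∀ u, inner ℝ (B u) u ≤ 0)
    (hB' : ∀ u, inner ℝ (B' u) u ≤ 0) (hc : Commute B B') (ht : 0 ≤ t) (u : H) :
    ‖exp (t • B) u - exp (t • B') u‖ ≤ t * ‖B u - B' u‖ := by
  have hfactor : ∀ s v, exp (t • B') (exp (s • (B - B')) v) = exp ((t - s) • B') (exp (s • B) v) :=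
    fun s v => DFunLike.congr_fun (exp_smul_mul_exp_smul_sub hc s t) v
  have hder : ∀ s : ℝ, HasDerivAt (fun s : ℝ => exp (t • B') (exp (s • (B - B')) u))
      (exp (t • B') (exp (s • (B - B')) ((B - B') u))) s := fun s =>
    (exp (t • B')).hasFDerivAt.comp_hasDerivAt s (hasDerivAt_exp_apply (B - B') u s)
  have hbound : ∀ s ∈ Set.Ico 0 t,
      ‖exp (t • B') (exp (s • (B - B')) ((B - B') u))‖ ≤ ‖B u - B' u‖ := fun s hs => by
    rw [hfactor]
    exact (norm_exp_apply_le hB' (sub_nonneg.2 hs.2.le) _).trans (norm_exp_apply_le hB hs.1 _)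
  have h := norm_image_sub_le_of_norm_deriv_le_segment'
    (fun s _ => (hder s).hasDerivWithinAt) hbound t (Set.right_mem_Icc.2 ht)
  rw [hfactor] at h
  simpa only [sub_self, zero_smul, exp_zero, one_apply_eq_self, sub_zero, mul_comm t] using h

lemma norm_exp_sub_self_le (hB : ∀ u, inner ℝ (B u) u ≤ 0) (ht : 0 ≤ t) (u : H) :
    ‖exp (t • B) u - u‖ ≤ t * ‖B u‖ := by
  simpa using norm_exp_sub_exp_apply_le (B' := 0) hB (by simp) (Commute.zero_right B) ht u

/-- The vector `g` approximates `B u`; it is needed because `B` is not applied to `B u`. -/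
lemma norm_exp_sub_linear_le (hB : ∀ u, inner ℝ (B u) u ≤ 0) (ht : 0 ≤ t) (u g : H) :
    ‖exp (t • B) u - u - t • B u‖ ≤ t * (2 * ‖B u - g‖ + t * ‖B g‖) := by
  have hder : ∀ s : ℝ, HasDerivAt (fun s : ℝ => exp (s • B) u - s • B u)
      (exp (s • B) (B u) - (1 : ℝ) • B u) s := fun s =>
    (hasDerivAt_exp_apply B u s).sub ((hasDerivAt_id s).smul_const (B u))
  have hbound : ∀ s ∈ Set.Ico 0 t,
      ‖exp (s • B) (B u) - (1 : ℝ) • B u‖ ≤ 2 * ‖B u - g‖ + t * ‖B g‖ := fun s hs => calc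
    _ = ‖exp (s • B) (B u - g) + (exp (s • B) g - g) - (B u - g)‖ := by
      rw [one_smul, map_sub]
      congr 1
      abel
    _ ≤ ‖exp (s • B) (B u - g)‖ + ‖exp (s • B) g - g‖ + ‖B u - g‖ :=
      (norm_sub_le _ _).trans (by gcongr; exact norm_add_le _ _)
    _ ≤ ‖B u - g‖ + t * ‖B g‖ + ‖B u - g‖ := by
      gcongr
      · exact norm_exp_apply_le hB hs.1 _
      · exact (norm_exp_sub_self_le hB hs.1 g).trans (by gcongr; exact hs.2.le)
    _ = 2 * ‖B u - g‖ + t * ‖B g‖ := by ring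
  have h := norm_image_sub_le_of_norm_deriv_le_segment'
    (fun s _ => (hder s).hasDerivWithinAt) hbound t (Set.right_mem_Icc.2 ht)
  rw [mul_comm t, sub_right_comm]
  simpa only [zero_smul, exp_zero, one_apply_eq_self, sub_zero] using h

lemma inner_exp (hB : ∀ u v, inner ℝ (B u) v = inner ℝ u (B v)) (t : ℝ) (u v : H) :
    inner ℝ (exp (t • B) u) v = inner ℝ u (exp (t • B) v) := by
  have hsmul : IsSelfAdjoint (t • B) := by
    rw [ContinuousLinearMap.isSelfAdjoint_iff_isSymmetric]
    intro x y
    simp only [ContinuousLinearMap.coe_coe, _root_.smul_apply, real_inner_smul_left,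
      real_inner_smul_right, hB]
  have hexp : IsSelfAdjoint (exp (t • B)) := by
    rw [isSelfAdjoint_iff, star_exp, hsmul.star_eq]
  exact (ContinuousLinearMap.isSelfAdjoint_iff_isSymmetric.1 hexp) u v

end Exponential

/-! ### The semigroup of a densely defined closed form -/

section FormSemigroup

open NormedSpace

variable {H : Type*} [NormedAddCommGroup H] [InnerProductSpace ℝ H] {q : H → ℝ≥0∞}

lemma cauchySeq_of_dense_of_contractive {T : ℕ → H →L[ℝ] H} (hT : ∀ n u, ‖T n u‖ ≤ ‖u‖)
    {D : Set H} (hD : Dense D) (hcauchy : ∀ u ∈ D, CauchySeq fun n => T n u) (u : H) :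
    CauchySeq fun n => T n u := by
  rw [Metric.cauchySeq_iff]
  intro ε hε
  obtain ⟨v, hv, huv⟩ := hD.exists_dist_lt u (show 0 < ε / 3 by positivity)
  obtain ⟨N, hN⟩ := Metric.cauchySeq_iff.1 (hcauchy v hv) (ε / 3) (by positivity)
  have hcontr : ∀ n, dist (T n u) (T n v) ≤ dist u v := fun n => by
    rw [dist_eq_norm, dist_eq_norm, ← map_sub]
    exact hT n _
  refine ⟨N, fun m hm n hn => ?_⟩
  have htri := dist_triangle4 (T m u) (T m v) (T n v) (T n u)
  rw [dist_comm (T n v)] at htri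
  linarith [hN m hm n hn, hcontr m, hcontr n]

lemma FormOperatorGraph.of_tendsto_of_contractive [CompleteSpace H] (hq : IsClosedForm q)
    {T : ℝ≥0 → H →L[ℝ] H} (hT : ∀ t u, ‖T t u‖ ≤ ‖u‖)
    (hgen : ∀ u f, FormOperatorGraph q u f →
      Tendsto (fun t : ℝ≥0 => (t : ℝ)⁻¹ • (u - T t u)) (𝓝[>] 0) (𝓝 f)) {u f : H}
    (hu : Tendsto (fun t : ℝ≥0 => (t : ℝ)⁻¹ • (u - T t u)) (𝓝[>] 0) (𝓝 f)) :
    FormOperatorGraph q u f := by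
  have hv := graph_resolvent hq one_pos (u + f)
  set v := resolvent hq one_pos (u + f)
  rw [one_smul] at hv
  have hlim : Tendsto (fun t : ℝ≥0 => inner ℝ ((t : ℝ)⁻¹ • ((u - v) - T t (u - v))) (u - v))
      (𝓝[>] 0) (𝓝 (inner ℝ (f - (u + f - v)) (u - v))) := by
    refine ((hu.sub (hgen _ _ hv)).congr fun t => ?_).inner tendsto_const_nhds
    rw [map_sub]
    module
  have hnonneg : 0 ≤ inner ℝ (f - (u + f - v)) (u - v) := ge_of_tendsto' hlim fun t => by
    rw [real_inner_smul_left, inner_sub_left, real_inner_self_eq_norm_mul_norm]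
    refine mul_nonneg (inv_nonneg.2 t.2) (sub_nonneg.2 ((real_inner_le_norm _ _).trans ?_))
    gcongr
    exact hT t _
  have heq : u = v := by
    rw [show f - (u + f - v) = -(u - v) by abel, inner_neg_left, Left.nonneg_neg_iff,
      real_inner_self_nonpos] at hnonneg
    exact sub_eq_zero.1 hnonneg
  rw [← heq] at hv
  simpa using hv

variable [CompleteSpace H]

/-- The semigroup generated by the Yosida approximation `-A_n`. -/
def yosidaSemigroup (hq : IsClosedForm q) (n : ℕ) (t : ℝ≥0) : H →L[ℝ] H :=
  exp ((t : ℝ) • yosida hq n)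

lemma norm_yosidaSemigroup_apply_le (hq : IsClosedForm q) (n : ℕ) (t : ℝ≥0) (u : H) :
    ‖yosidaSemigroup hq n t u‖ ≤ ‖u‖ :=
  norm_exp_apply_le (inner_yosida_nonpos hq n) t.2 u

lemma yosidaSemigroup_add_apply (hq : IsClosedForm q) (n : ℕ) (s t : ℝ≥0) (u : H) :
    yosidaSemigroup hq n (s + t) u = yosidaSemigroup hq n s (yosidaSemigroup hq n t u) := by
  let _ : NormedAlgebra ℚ (H →L[ℝ] H) := NormedAlgebra.restrictScalars ℚ ℝ _
  have hexp : yosidaSemigroup hq n (s + t) = yosidaSemigroup hq n s * yosidaSemigroup hq n t := by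
    rw [yosidaSemigroup, NNReal.coe_add, add_smul,
      exp_add_of_commute (((Commute.refl _).smul_left _).smul_right _)]
    rfl
  rw [hexp]
  rfl

lemma cauchySeq_yosidaSemigroup (hq : IsClosedForm q) (hd : Dense {u | q u ≠ ∞}) (t : ℝ≥0)
    (u : H) : CauchySeq fun n => yosidaSemigroup hq n t u := by
  refine cauchySeq_of_dense_of_contractive (fun n => norm_yosidaSemigroup_apply_le hq n t)
    (dense_graph hq hd) ?_ u
  rintro u ⟨f, hf⟩
  have hcauchy := cauchySeq_iff_tendsto_dist_atTop_0.1 (tendsto_yosida hq hd hf).cauchySeq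
  rw [cauchySeq_iff_tendsto_dist_atTop_0]
  refine squeeze_zero (fun _ => dist_nonneg) (fun p => ?_)
    (by simpa using hcauchy.const_mul (t : ℝ))
  rw [dist_eq_norm, dist_eq_norm]
  exact norm_exp_sub_exp_apply_le (inner_yosida_nonpos hq p.1) (inner_yosida_nonpos hq p.2)
    (yosida_comm hq p.1 p.2) t.2 u

lemma exists_tendsto_yosidaSemigroup (hq : IsClosedForm q) (hd : Dense {u | q u ≠ ∞})
    (t : ℝ≥0) : ∃ F : H → H, Tendsto (fun n u => yosidaSemigroup hq n t u) atTop (𝓝 F) := by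
  choose F hF using fun u => cauchySeq_tendsto_of_complete (cauchySeq_yosidaSemigroup hq hd t u)
  exact ⟨F, tendsto_pi_nhds.2 hF⟩

/-- The semigroup `e^{-tA}` of the operator `A` associated with the densely defined closed form
`q`, as the strong limit of the semigroups of the Yosida approximations. -/
def formSemigroup (hq : IsClosedForm q) (hd : Dense {u | q u ≠ ∞}) (t : ℝ≥0) : H →L[ℝ] H :=
  continuousLinearMapOfTendsto (fun n => yosidaSemigroup hq n t)
    (exists_tendsto_yosidaSemigroup hq hd t).choose_spec

variable (hq : IsClosedForm q) (hd : Dense {u | q u ≠ ∞})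

lemma tendsto_yosidaSemigroup (t : ℝ≥0) (u : H) :
    Tendsto (fun n => yosidaSemigroup hq n t u) atTop (𝓝 (formSemigroup hq hd t u)) :=
  tendsto_pi_nhds.1 (exists_tendsto_yosidaSemigroup hq hd t).choose_spec u

lemma norm_formSemigroup_apply_le (t : ℝ≥0) (u : H) : ‖formSemigroup hq hd t u‖ ≤ ‖u‖ :=
  le_of_tendsto' (tendsto_yosidaSemigroup hq hd t u).norm fun n =>
    norm_yosidaSemigroup_apply_le hq n t u

lemma formSemigroup_zero : formSemigroup hq hd 0 = ContinuousLinearMap.id ℝ H := by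
  ext u
  exact tendsto_nhds_unique (tendsto_yosidaSemigroup hq hd 0 u) (by simp [yosidaSemigroup])

lemma formSemigroup_add_apply (s t : ℝ≥0) (u : H) :
    formSemigroup hq hd (s + t) u = formSemigroup hq hd s (formSemigroup hq hd t u) := by
  refine tendsto_nhds_unique (tendsto_yosidaSemigroup hq hd (s + t) u) ?_
  simp only [yosidaSemigroup_add_apply]
  have herror : Tendsto (fun n => yosidaSemigroup hq n s
      (yosidaSemigroup hq n t u - formSemigroup hq hd t u)) atTop (𝓝 0) := by
    rw [tendsto_zero_iff_norm_tendsto_zero]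
    exact squeeze_zero (fun _ => norm_nonneg _)
      (fun n => norm_yosidaSemigroup_apply_le hq n s _)
      (tendsto_iff_norm_sub_tendsto_zero.1 (tendsto_yosidaSemigroup hq hd t u))
  simpa using herror.add (tendsto_yosidaSemigroup hq hd s (formSemigroup hq hd t u))

lemma inner_formSemigroup (t : ℝ≥0) (u v : H) :
    inner ℝ (formSemigroup hq hd t u) v = inner ℝ u (formSemigroup hq hd t v) :=
  tendsto_nhds_unique ((tendsto_yosidaSemigroup hq hd t u).inner tendsto_const_nhds)
    ((tendsto_const_nhds.inner (tendsto_yosidaSemigroup hq hd t v)).congr fun n =>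
      (inner_exp (inner_yosida hq n) t u v).symm)

lemma norm_formSemigroup_sub_self_le {u f : H} (hf : FormOperatorGraph q u f) (t : ℝ≥0) :
    ‖formSemigroup hq hd t u - u‖ ≤ t * ‖f‖ := by
  have hyosida := (tendsto_yosida hq hd hf).norm.const_mul (t : ℝ)
  rw [norm_neg] at hyosida
  exact le_of_tendsto_of_tendsto' ((tendsto_yosidaSemigroup hq hd t u).sub_const u).norm hyosida
    fun n => norm_exp_sub_self_le (inner_yosida_nonpos hq n) t.2 u

lemma lipschitzWith_formSemigroup_apply {u f : H} (hf : FormOperatorGraph q u f) :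
    LipschitzWith ‖f‖₊ fun t => formSemigroup hq hd t u := by
  have hle : ∀ s r : ℝ≥0,
      dist (formSemigroup hq hd s u) (formSemigroup hq hd (s + r) u) ≤ ‖f‖₊ * dist s (s + r) := by
    intro s r
    rw [formSemigroup_add_apply hq hd, dist_comm, dist_eq_norm, ← map_sub]
    refine (norm_formSemigroup_apply_le hq hd s _).trans
      ((norm_formSemigroup_sub_self_le hq hd hf r).trans_eq ?_)
    simp [NNReal.dist_eq, mul_comm]
  refine LipschitzWith.of_dist_le_mul fun s t => ?_
  rcases le_total s t with hst | hts
  · obtain ⟨r, rfl⟩ := exists_add_of_le hst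
    exact hle s r
  · obtain ⟨r, rfl⟩ := exists_add_of_le hts
    rw [dist_comm, dist_comm (t + r)]
    exact hle t r

lemma continuous_formSemigroup_apply (u : H) : Continuous fun t => formSemigroup hq hd t u := by
  refine continuous_of_uniform_approx_of_continuous fun U hU => ?_
  obtain ⟨ε, hε, hεU⟩ := Metric.mem_uniformity_dist.1 hU
  obtain ⟨v, ⟨f, hf⟩, huv⟩ := (dense_graph hq hd).exists_dist_lt u hε
  refine ⟨_, (lipschitzWith_formSemigroup_apply hq hd hf).continuous,
    fun t => hεU (lt_of_le_of_lt ?_ huv)⟩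
  rw [dist_eq_norm, dist_eq_norm, ← map_sub]
  exact norm_formSemigroup_apply_le hq hd t _

lemma norm_formSemigroup_sub_linear_le {u f g k : H} (hf : FormOperatorGraph q u f)
    (hk : FormOperatorGraph q g k) (t : ℝ≥0) :
    ‖formSemigroup hq hd t u - u + (t : ℝ) • f‖ ≤ t * (2 * ‖f - g‖ + t * ‖k‖) := by
  have hu := tendsto_yosida hq hd hf
  have hg := (tendsto_yosida hq hd hk).norm
  have hleft : Tendsto (fun n => ‖yosidaSemigroup hq n t u - u - (t : ℝ) • yosida hq n u‖) atTop
      (𝓝 ‖formSemigroup hq hd t u - u + (t : ℝ) • f‖) := by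
    simpa using (((tendsto_yosidaSemigroup hq hd t u).sub_const u).sub (hu.const_smul (t : ℝ))).norm
  have hright : Tendsto (fun n => t * (2 * ‖yosida hq n u + g‖ + t * ‖yosida hq n g‖)) atTop
      (𝓝 (t * (2 * ‖f - g‖ + t * ‖k‖))) := by
    have hlim := ((hu.add_const g).norm.const_mul 2).add (hg.const_mul (t : ℝ))
    rw [neg_add_eq_sub, norm_sub_rev, norm_neg] at hlim
    exact hlim.const_mul (t : ℝ)
  refine le_of_tendsto_of_tendsto' hleft hright fun n => ?_
  have hle := norm_exp_sub_linear_le (inner_yosida_nonpos hq n) t.2 u (-g)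
  rwa [map_neg, norm_neg (yosida hq n g), sub_neg_eq_add] at hle

lemma tendsto_formSemigroup_generator {u f : H} (hf : FormOperatorGraph q u f) :
    Tendsto (fun t : ℝ≥0 => (t : ℝ)⁻¹ • (u - formSemigroup hq hd t u)) (𝓝[>] 0) (𝓝 f) := by
  have hcoe : Tendsto (fun t : ℝ≥0 => (t : ℝ)) (𝓝[>] 0) (𝓝 0) :=
    (NNReal.continuous_coe.tendsto 0).mono_left nhdsWithin_le_nhds
  rw [Metric.tendsto_nhds]
  intro ε hε
  obtain ⟨g, ⟨k, hk⟩, hfg⟩ := (dense_graph hq hd).exists_dist_lt f (show 0 < ε / 2 by positivity)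
  have hlim : Tendsto (fun t : ℝ≥0 => 2 * ‖f - g‖ + t * ‖k‖) (𝓝[>] 0) (𝓝 (2 * ‖f - g‖)) := by
    simpa using (hcoe.mul_const ‖k‖).const_add (2 * ‖f - g‖)
  rw [dist_eq_norm] at hfg
  filter_upwards [hlim.eventually_lt_const (by linarith : 2 * ‖f - g‖ < ε), self_mem_nhdsWithin]
    with t hlt (ht : 0 < t)
  have ht' : (0 : ℝ) < t := ht
  have hneg : (t : ℝ)⁻¹ • (u - formSemigroup hq hd t u) - f =
      -((t : ℝ)⁻¹ • (formSemigroup hq hd t u - u + (t : ℝ) • f)) := by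
    rw [smul_add, smul_smul, inv_mul_cancel₀ ht'.ne']
    module
  rw [dist_eq_norm, hneg, norm_neg, norm_smul, norm_inv, Real.norm_of_nonneg ht'.le]
  refine lt_of_le_of_lt ?_ hlt
  rw [inv_mul_le_iff₀ ht']
  exact norm_formSemigroup_sub_linear_le hq hd hf hk t

theorem isFormSemigroup_formSemigroup : IsFormSemigroup q (formSemigroup hq hd) where
  zero := formSemigroup_zero hq hd
  add s t := ContinuousLinearMap.ext (formSemigroup_add_apply hq hd s t)
  continuous := continuous_formSemigroup_apply hq hd
  generator _ _ := ⟨tendsto_formSemigroup_generator hq hd, fun h =>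
    .of_tendsto_of_contractive hq (norm_formSemigroup_apply_le hq hd)
      (fun _ _ => tendsto_formSemigroup_generator hq hd) h⟩

end FormSemigroup

namespace IsFormSemigroup

variable {H : Type*} [NormedAddCommGroup H] [InnerProductSpace ℝ H] {q : H → ℝ≥0∞}
  {S S' : ℝ≥0 → H →L[ℝ] H}

lemma graph (hS : IsFormSemigroup q S) {u f : H} (hu : FormOperatorGraph q u f) (t : ℝ≥0) :
    FormOperatorGraph q (S t u) (S t f) := by
  rw [hS.generator] at hu ⊢
  refine (((S t).continuous.tendsto f).comp hu).congr fun s => ?_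
  have hcomm : S s (S t u) = S t (S s u) := by
    rw [← ContinuousLinearMap.comp_apply, ← ContinuousLinearMap.comp_apply, ← hS.add, ← hS.add,
      add_comm]
  rw [Function.comp_apply, map_smul, map_sub, hcomm]

lemma hasDerivWithinAt (hS : IsFormSemigroup q S) {u f : H} (hu : FormOperatorGraph q u f)
    {t : ℝ} (ht : 0 ≤ t) :
    HasDerivWithinAt (fun s : ℝ => S s.toNNReal u) (-(S t.toNNReal f)) (Set.Ici t) t := by
  rw [← hasDerivWithinAt_Ioi_iff_Ici, hasDerivWithinAt_iff_tendsto_slope' (by simp)]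
  have hshift : Tendsto (fun z : ℝ => (z - t).toNNReal) (𝓝[>] t) (𝓝[>] 0) := by
    refine tendsto_nhdsWithin_iff.2 ⟨?_, ?_⟩
    · have hcont : Continuous fun z : ℝ => (z - t).toNNReal := by fun_prop
      simpa using (hcont.tendsto t).mono_left nhdsWithin_le_nhds
    · filter_upwards [self_mem_nhdsWithin] with z hz
      simpa using hz
  refine ((((hS.generator _ _).1 (hS.graph hu t.toNNReal)).comp hshift).neg).congr' ?_
  filter_upwards [self_mem_nhdsWithin] with z (hz : t < z)
  have hsum : z.toNNReal = (z - t).toNNReal + t.toNNReal := by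
    rw [← Real.toNNReal_add (by linarith) ht, sub_add_cancel]
  rw [slope_def_module, Function.comp_apply, Real.coe_toNNReal _ (by linarith), hsum, hS.add,
    ContinuousLinearMap.comp_apply, ← smul_neg, neg_sub]

lemma continuous_toNNReal (hS : IsFormSemigroup q S) (u : H) :
    Continuous fun s : ℝ => S s.toNNReal u :=
  (hS.continuous u).comp continuous_real_toNNReal

theorem unique (hq : IsQuadraticForm q) (hd : Dense {u | ∃ f, FormOperatorGraph q u f})
    (hS : IsFormSemigroup q S) (hS' : IsFormSemigroup q S') : S = S' := by
  funext t
  refine DFunLike.coe_injective (Continuous.ext_on hd (S t).continuous (S' t).continuous ?_)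
  rintro u ⟨f, hf⟩
  have hle := image_le_of_deriv_right_le_deriv_boundary (a := 0) (b := t)
    (f := fun s : ℝ => ‖S s.toNNReal u - S' s.toNNReal u‖ ^ 2) (B := fun _ => 0)
    (B' := fun _ => 0)
    (((hS.continuous_toNNReal u).sub (hS'.continuous_toNNReal u)).norm.pow 2).continuousOn
    (fun s hs => ((hS.hasDerivWithinAt hf hs.1).sub (hS'.hasDerivWithinAt hf hs.1)).norm_sq)
    (by simp [hS.zero, hS'.zero]) continuousOn_const
    (fun s _ => hasDerivWithinAt_const _ _ _) (fun s _ => ?_) (Set.right_mem_Icc.2 t.2)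
  · simpa [sub_eq_zero] using hle
  · have hinner := ((hS.graph hf s.toNNReal).sub hq (hS'.graph hf s.toNNReal)).inner_nonneg hq
    rw [real_inner_comm] at hinner
    have hneg : -(S s.toNNReal f) - -(S' s.toNNReal f) = -(S s.toNNReal f - S' s.toNNReal f) := by
      abel
    rw [hneg, inner_neg_right, Pi.sub_apply]
    linarith

lemma inner_apply_comm [CompleteSpace H] (hq : IsClosedForm q) (hd : Dense {u | q u ≠ ∞})
    (hS : IsFormSemigroup q S) (t : ℝ≥0) (u v : H) :
    inner ℝ (S t u) v = inner ℝ u (S t v) := by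
  rw [unique hq.toIsQuadraticForm (dense_graph hq hd) hS (isFormSemigroup_formSemigroup hq hd)]
  exact inner_formSemigroup hq hd t u v

lemma polar_sub_nonneg (hq : IsQuadraticForm q) {u v : H} (hu : q u ≠ ∞) (hvu : q v ≤ q u) :
    0 ≤ polar q u (u - v) := by
  have hv : q v ≠ ∞ := ne_top_of_le_ne_top hu hvu
  rw [hq.polar_comm, hq.polar_sub_left hu hv hu, hq.polar_self]
  linarith [hq.abs_polar_le hv hu, (ENNReal.toReal_le_toReal hv hu).2 hvu,
    le_abs_self (polar q v u)]

theorem norm_sub_projection_le (hq : IsQuadraticForm q)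
    (hd : Dense {u | ∃ f, FormOperatorGraph q u f}) (hS : IsFormSemigroup q S) {P : H → H}
    (hP : ∀ u v, ‖v - P v‖ ≤ ‖v - P u‖) (hqP : ∀ u, q (P u) ≤ q u) (t : ℝ≥0) (u : H) :
    ‖S t u - P (S t u)‖ ≤ ‖u - P u‖ := by
  have hlip : LipschitzWith 1 fun u => ‖u - P u‖ := by
    refine LipschitzWith.of_le_add fun u v => ?_
    rw [dist_eq_norm]
    linarith [hP v u, norm_sub_le_norm_sub_add_norm_sub u v (P v)]
  refine hd.induction (P := fun u => ‖S t u - P (S t u)‖ ≤ ‖u - P u‖) ?_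
    (isClosed_le (hlip.continuous.comp (S t).continuous) hlip.continuous) u
  rintro u ⟨f, hf⟩
  let w : ℝ → H := fun s => S s.toNNReal u
  have hle := image_le_of_liminf_slope_right_le_deriv_boundary (a := 0) (b := t)
    (f := fun s : ℝ => ‖w s - P (w s)‖ ^ 2) (B := fun _ => ‖u - P u‖ ^ 2) (B' := fun _ => 0)
    ((hlip.continuous.comp (hS.continuous_toNNReal u)).pow 2).continuousOn
    (by simp [w, hS.zero]) continuousOn_const
    (fun s _ => hasDerivWithinAt_const _ _ _) (fun x hx r hr => ?_) (Set.right_mem_Icc.2 t.2)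
  · exact (sq_le_sq₀ (norm_nonneg _) (norm_nonneg _)).1 (by simpa [w] using hle)
  have hgraph : FormOperatorGraph q (w x) (S x.toNNReal f) := hS.graph hf x.toNNReal
  have hfin : q (P (w x)) ≠ ∞ := ne_top_of_le_ne_top hgraph.1 (hqP _)
  have hnonneg := polar_sub_nonneg hq hgraph.1 (hqP (w x))
  rw [hgraph.2 _ (hq.sub_ne_top hgraph.1 hfin), real_inner_comm] at hnonneg
  have hslope : 2 * inner ℝ (w x - P (w x)) (-(S x.toNNReal f)) < r := by
    rw [inner_neg_right]
    linarith
  have hderiv := ((hS.hasDerivWithinAt hf hx.1).sub_const (P (w x))).norm_sq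
  refine ((hderiv.liminf_right_slope_le hslope).and_eventually self_mem_nhdsWithin).mono ?_
  rintro z ⟨hz, (hxz : x < z)⟩
  refine lt_of_le_of_lt ?_ hz
  have hproj : ‖w z - P (w z)‖ ^ 2 ≤ ‖w z - P (w x)‖ ^ 2 := by
    gcongr
    exact hP _ _
  have : 0 < z - x := sub_pos.2 hxz
  rw [slope_def_field, slope_def_field]
  gcongr

end IsFormSemigroup

/-! ### Symmetric sub-Markovian operators -/

section LinftyExtension

variable {d : ℕ}

lemma inner_eq_integral (u v : L d 2) : inner ℝ u v = ∫ x, u x * v x := by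
  simp [L2.inner_def, mul_comm]

lemma integrable_mul_L2 (u v : L d 2) : Integrable fun x => u x * v x :=
  (Lp.memLp u).integrable_mul (Lp.memLp v)

lemma ae_abs_le_norm (f : L d ∞) : ∀ᵐ x : E d, |f x| ≤ ‖f‖ := by
  filter_upwards [ae_le_eLpNormEssSup (f := f) (μ := volume)] with x hx
  rw [Lp.norm_def, eLpNorm_exponent_top, ← Real.norm_eq_abs, ← toReal_enorm]
  exact ENNReal.toReal_mono (by simpa using Lp.eLpNorm_ne_top f) hx

lemma coeFn_oneLinfty : oneLinfty d =ᵐ[volume] fun _ => (1 : ℝ) :=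
  (memLp_top_const 1).coeFn_toLp

/-- The restriction of `f ∈ L_∞` to the ball of radius `n`, as an element of `L_2`. -/
def truncate (n : ℕ) : L d ∞ →L[ℝ] L d 2 :=
  ((ContinuousLinearMap.mul ℝ ℝ).holderL volume ∞ 2 2).flip
    (indicatorConstLp 2 (measurableSet_ball (x := 0) (ε := n)) measure_ball_lt_top.ne 1)

lemma coeFn_truncate (n : ℕ) (f : L d ∞) :
    truncate n f =ᵐ[volume] (Metric.ball (0 : E d) n).indicator f := by
  refine ((ContinuousLinearMap.mul ℝ ℝ).coeFn_holder f _).trans ?_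
  filter_upwards [indicatorConstLp_coeFn (p := 2) (hs := measurableSet_ball (x := (0 : E d)))
    (hμs := measure_ball_lt_top.ne) (c := (1 : ℝ))] with x hx
  rw [hx]
  by_cases hmem : x ∈ Metric.ball (0 : E d) n <;> simp [hmem]

lemma ae_abs_truncate_le (n : ℕ) (f : L d ∞) : ∀ᵐ x, |truncate n f x| ≤ ‖f‖ := by
  filter_upwards [coeFn_truncate n f, ae_abs_le_norm f] with x hx hle
  rw [hx, ← Real.norm_eq_abs]
  exact (norm_indicator_le_norm_self _ _).trans hle

lemma truncate_nonneg (n : ℕ) {f : L d ∞} (hf : 0 ≤ f) : 0 ≤ truncate n f := by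
  rw [← Lp.coeFn_nonneg] at hf ⊢
  filter_upwards [coeFn_truncate n f, hf] with x hx hfx
  rw [hx]
  exact Set.indicator_apply_nonneg fun _ => hfx

lemma monotone_truncate {f : L d ∞} (hf : 0 ≤ f) : Monotone fun n => truncate n f := by
  intro m n hmn
  rw [← Lp.coeFn_nonneg] at hf
  rw [← Lp.coeFn_le]
  filter_upwards [coeFn_truncate m f, coeFn_truncate n f, hf] with x hm hn hfx
  rw [hm, hn]
  exact Set.indicator_le_indicator_apply_of_subset
    (Metric.ball_subset_ball (by exact_mod_cast hmn)) hfx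

lemma ae_tendsto_truncate (f : L d ∞) :
    ∀ᵐ x, Tendsto (fun n => truncate n f x) atTop (𝓝 (f x)) := by
  filter_upwards [ae_all_iff.2 fun n => coeFn_truncate n f] with x hx
  obtain ⟨N, hN⟩ := exists_nat_gt ‖x‖
  refine tendsto_const_nhds.congr' ?_
  filter_upwards [eventually_ge_atTop N] with n hn
  have hxn : ‖x‖ < n := hN.trans_le (by exact_mod_cast hn)
  rw [hx, Set.indicator_of_mem (mem_ball_zero_iff.2 hxn)]

lemma setIntegral_ball_eq_inner (n : ℕ) (u : L d 2) :
    ∫ x in Metric.ball 0 n, u x = inner ℝ (truncate n (oneLinfty d)) u := by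
  rw [inner_eq_integral, ← integral_indicator measurableSet_ball]
  refine integral_congr_ae ?_
  filter_upwards [coeFn_truncate n (oneLinfty d), coeFn_oneLinfty (d := d)] with x hx hone
  rw [hx]
  by_cases hmem : x ∈ Metric.ball (0 : E d) n <;> simp [hmem, hone]

/-- Symmetric sub-Markovian operators on `L_2(ℝᵈ)`: symmetric, positivity preserving, and
contractive in the `L_∞`-norm. -/
structure IsSymmSubMarkovian (A : L d 2 →L[ℝ] L d 2) : Prop where
  inner_comm : ∀ u v : L d 2, inner ℝ (A u) v = inner ℝ u (A v)
  nonneg : ∀ u : L d 2, 0 ≤ u → 0 ≤ A u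
  ae_abs_le : ∀ (u : L d 2) (c : ℝ), (∀ᵐ x, |u x| ≤ c) → ∀ᵐ x, |A u x| ≤ c

namespace IsSymmSubMarkovian

variable {A : L d 2 →L[ℝ] L d 2}

lemma monotone (hA : IsSymmSubMarkovian A) : Monotone A := fun u v huv => by
  simpa using hA.nonneg (v - u) (sub_nonneg.2 huv)

lemma ae_abs_apply_truncate_le (hA : IsSymmSubMarkovian A) (f : L d ∞) :
    ∀ᵐ x, ∀ n, |A (truncate n f) x| ≤ ‖f‖ :=
  ae_all_iff.2 fun n => hA.ae_abs_le _ _ (ae_abs_truncate_le n f)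

lemma ae_exists_tendsto_truncate_of_nonneg (hA : IsSymmSubMarkovian A) {f : L d ∞} (hf : 0 ≤ f) :
    ∀ᵐ x, ∃ l, Tendsto (fun n => A (truncate n f) x) atTop (𝓝 l) := by
  have hmono : ∀ᵐ x, ∀ n, A (truncate n f) x ≤ A (truncate (n + 1) f) x :=
    ae_all_iff.2 fun n => (Lp.coeFn_le _ _).2 (hA.monotone (monotone_truncate hf n.le_succ))
  filter_upwards [hmono, hA.ae_abs_apply_truncate_le f] with x hx hbdd
  refine ⟨_, tendsto_atTop_ciSup (monotone_nat_of_le_succ hx) ⟨‖f‖, ?_⟩⟩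
  rintro _ ⟨n, rfl⟩
  exact (abs_le.1 (hbdd n)).2

lemma ae_exists_tendsto_truncate (hA : IsSymmSubMarkovian A) (f : L d ∞) :
    ∀ᵐ x, ∃ l, Tendsto (fun n => A (truncate n f) x) atTop (𝓝 l) := by
  have hsub : ∀ᵐ x, ∀ n, A (truncate n f) x = A (truncate n f⁺) x - A (truncate n f⁻) x := by
    refine ae_all_iff.2 fun n => ?_
    nth_rewrite 1 [← posPart_sub_negPart f]
    rw [map_sub, map_sub]
    exact Lp.coeFn_sub _ _
  filter_upwards [hsub, hA.ae_exists_tendsto_truncate_of_nonneg (posPart_nonneg f),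
    hA.ae_exists_tendsto_truncate_of_nonneg (negPart_nonneg f)] with x hx ⟨k, hk⟩ ⟨l, hl⟩
  exact ⟨k - l, (hk.sub hl).congr fun n => (hx n).symm⟩

lemma exists_limit_truncate (hA : IsSymmSubMarkovian A) (f : L d ∞) :
    ∃ g : L d ∞, (∀ᵐ x, Tendsto (fun n => A (truncate n f) x) atTop (𝓝 (g x))) ∧
      ‖g‖ ≤ ‖f‖ := by
  obtain ⟨g, hgm, hg⟩ := measurable_limit_of_tendsto_metrizable_ae
    (fun n => (Lp.aestronglyMeasurable (A (truncate n f))).aemeasurable)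
    (hA.ae_exists_tendsto_truncate f)
  have hbdd : ∀ᵐ x, ‖g x‖ ≤ ‖f‖ := by
    filter_upwards [hg, hA.ae_abs_apply_truncate_le f] with x hx hle
    exact le_of_tendsto' hx.norm hle
  have hgL : MemLp g ∞ volume := memLp_top_of_bound hgm.aestronglyMeasurable _ hbdd
  refine ⟨hgL.toLp g, ?_, ?_⟩
  · filter_upwards [hg, hgL.coeFn_toLp] with x hx heq
    rwa [heq]
  · rw [Lp.norm_toLp, eLpNorm_exponent_top]
    exact ENNReal.toReal_le_of_le_ofReal (norm_nonneg f) (eLpNormEssSup_le_of_ae_bound hbdd)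

/-- The extension of a symmetric sub-Markovian operator to `L_∞(ℝᵈ)`, which is the limit of its
values on truncations. -/
def linftyExtension (hA : IsSymmSubMarkovian A) : L d ∞ →L[ℝ] L d ∞ :=
  LinearMap.mkContinuous
    { toFun := fun f => (hA.exists_limit_truncate f).choose
      map_add' := fun f g => by
        refine Lp.ext ?_
        have hadd : ∀ᵐ x, ∀ n,
            A (truncate n (f + g)) x = A (truncate n f) x + A (truncate n g) x :=
          ae_all_iff.2 fun n => by
            rw [map_add, map_add]
            exact Lp.coeFn_add _ _
        filter_upwards [(hA.exists_limit_truncate (f + g)).choose_spec.1,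
          (hA.exists_limit_truncate f).choose_spec.1, (hA.exists_limit_truncate g).choose_spec.1,
          hadd, Lp.coeFn_add (hA.exists_limit_truncate f).choose
            (hA.exists_limit_truncate g).choose] with x hsum hf hg hn hx
        rw [hx]
        exact tendsto_nhds_unique hsum ((hf.add hg).congr fun n => (hn n).symm)
      map_smul' := fun c f => by
        refine Lp.ext ?_
        have hsmul : ∀ᵐ x, ∀ n, A (truncate n (c • f)) x = c • A (truncate n f) x :=
          ae_all_iff.2 fun n => by
            rw [map_smul, map_smul]
            exact Lp.coeFn_smul _ _
        filter_upwards [(hA.exists_limit_truncate (c • f)).choose_spec.1,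
          (hA.exists_limit_truncate f).choose_spec.1, hsmul,
          Lp.coeFn_smul c (hA.exists_limit_truncate f).choose] with x hcf hf hn hx
        rw [RingHom.id_apply, hx]
        exact tendsto_nhds_unique hcf ((hf.const_smul c).congr fun n => (hn n).symm) }
    1 fun f => by simpa using (hA.exists_limit_truncate f).choose_spec.2

lemma ae_tendsto_linftyExtension (hA : IsSymmSubMarkovian A) (f : L d ∞) :
    ∀ᵐ x, Tendsto (fun n => A (truncate n f) x) atTop (𝓝 (hA.linftyExtension f x)) :=
  (hA.exists_limit_truncate f).choose_spec.1

lemma abs_apply_le (hA : IsSymmSubMarkovian A) (u : L d 2) : |A u| ≤ A |u| :=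
  abs_le'.2 ⟨hA.monotone (le_abs_self u), by
    rw [← map_neg]
    exact hA.monotone (neg_le_abs u)⟩

lemma setIntegral_ball_abs_apply_le (hA : IsSymmSubMarkovian A) {u : L d 2} (hu : Integrable u)
    (n : ℕ) : ∫ x in Metric.ball 0 n, |A u x| ≤ ∫ x, |u x| := by
  calc ∫ x in Metric.ball 0 n, |A u x| = ∫ x in Metric.ball 0 n, |A u| x :=
        integral_congr_ae (ae_restrict_of_ae ((Lp.coeFn_abs (A u)).mono fun x hx => hx.symm))
    _ = inner ℝ (truncate n (oneLinfty d)) |A u| := setIntegral_ball_eq_inner n _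
    _ ≤ inner ℝ (truncate n (oneLinfty d)) (A |u|) := by
        rw [← sub_nonneg, ← inner_sub_right, inner_eq_integral]
        have hsub := (Lp.coeFn_nonneg _).2 (sub_nonneg.2 (hA.abs_apply_le u))
        have hone : 0 ≤ oneLinfty d :=
          (Lp.coeFn_nonneg _).1 (coeFn_oneLinfty.mono fun x hx => hx ▸ zero_le_one)
        refine integral_nonneg_of_ae ?_
        filter_upwards [hsub, (Lp.coeFn_nonneg _).2 (truncate_nonneg n hone)] with x hx hx'
        exact mul_nonneg hx' hx
    _ = ∫ x, A (truncate n (oneLinfty d)) x * |u| x := by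
        rw [← hA.inner_comm, inner_eq_integral]
    _ ≤ ∫ x, |u x| := by
        refine integral_mono_ae (integrable_mul_L2 _ _) hu.abs ?_
        have hone : ∀ᵐ x, |A (truncate n (oneLinfty d)) x| ≤ 1 := by
          refine hA.ae_abs_le _ _ ?_
          filter_upwards [coeFn_truncate n (oneLinfty d), coeFn_oneLinfty (d := d)] with x hx hx1
          rw [hx, ← Real.norm_eq_abs]
          exact (norm_indicator_le_norm_self _ _).trans (by simp [hx1])
        filter_upwards [hone, Lp.coeFn_abs u] with x hx habs
        rw [habs]
        exact mul_le_of_le_one_left (abs_nonneg _) ((le_abs_self _).trans hx)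

lemma integrable_apply (hA : IsSymmSubMarkovian A) {u : L d 2} (hu : Integrable u) :
    Integrable (A u) := by
  refine (aecover_ball tendsto_natCast_atTop_atTop).integrable_of_integral_norm_bounded
    (∫ x, |u x|) (fun n => ?_) (Eventually.of_forall (hA.setIntegral_ball_abs_apply_le hu))
  have : IsFiniteMeasure ((volume : Measure (E d)).restrict (Metric.ball 0 n)) :=
    ⟨by simpa using Metric.isBounded_ball.measure_lt_top⟩
  exact ((Lp.memLp (A u)).restrict _).integrable one_le_two

lemma integral_abs_apply_le (hA : IsSymmSubMarkovian A) {u : L d 2} (hu : Integrable u) :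
    ∫ x, |A u x| ≤ ∫ x, |u x| :=
  le_of_tendsto' ((aecover_ball tendsto_natCast_atTop_atTop).integral_tendsto_of_countably_generated
    (hA.integrable_apply hu).abs) (hA.setIntegral_ball_abs_apply_le hu)

lemma integral_linftyExtension_mul (hA : IsSymmSubMarkovian A) (f : L d ∞) {u : L d 2}
    (hu : Integrable u) : ∫ x, hA.linftyExtension f x * u x = ∫ x, f x * A u x := by
  have hleft : Tendsto (fun n => ∫ x, A (truncate n f) x * u x) atTop
      (𝓝 (∫ x, hA.linftyExtension f x * u x)) := by
    refine tendsto_integral_of_dominated_convergence (fun x => ‖f‖ * |u x|)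
      (fun n => (integrable_mul_L2 _ _).aestronglyMeasurable) (hu.abs.const_mul _) ?_ ?_
    · intro n
      filter_upwards [hA.ae_abs_apply_truncate_le f] with x hx
      rw [Real.norm_eq_abs, abs_mul]
      exact mul_le_mul_of_nonneg_right (hx n) (abs_nonneg _)
    · filter_upwards [hA.ae_tendsto_linftyExtension f] with x hx using hx.mul_const _
  have hright : Tendsto (fun n => ∫ x, truncate n f x * A u x) atTop (𝓝 (∫ x, f x * A u x)) := by
    refine tendsto_integral_of_dominated_convergence (fun x => ‖f‖ * |A u x|)
      (fun n => (integrable_mul_L2 _ _).aestronglyMeasurable)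
      ((hA.integrable_apply hu).abs.const_mul _) ?_ ?_
    · intro n
      filter_upwards [ae_abs_truncate_le n f] with x hx
      rw [Real.norm_eq_abs, abs_mul]
      exact mul_le_mul_of_nonneg_right hx (abs_nonneg _)
    · filter_upwards [ae_tendsto_truncate f] with x hx using hx.mul_const _
  refine tendsto_nhds_unique hleft (hright.congr fun n => ?_)
  rw [← inner_eq_integral, ← inner_eq_integral, hA.inner_comm]

end IsSymmSubMarkovian

/-- `L_1 ∩ L_2`, as a subspace of `L_2`. -/
def integrableSubmodule (d : ℕ) : Submodule ℝ (L d 2) where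
  carrier := {u | Integrable u volume}
  add_mem' {u v} hu hv := (Integrable.add hu hv).congr (Lp.coeFn_add u v).symm
  zero_mem' := (integrable_zero (E d) ℝ volume).congr (Lp.coeFn_zero ℝ 2 volume).symm
  smul_mem' c u hu := (Integrable.smul c hu).congr (Lp.coeFn_smul c u).symm

lemma integrableSubmodule.integrable (u : integrableSubmodule d) :
    Integrable (u : L d 2) :=
  u.2

/-- The inclusion of `L_1 ∩ L_2` in `L_1`. -/
def integrableSubmodule.toL1 : integrableSubmodule d →ₗ[ℝ] L d 1 where
  toFun u := (integrableSubmodule.integrable u).toL1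
  map_add' u v := by
    rw [← Integrable.toL1_add]
    exact (Integrable.toL1_eq_toL1_iff _ _ _ _).2 (Lp.coeFn_add (u : L d 2) v)
  map_smul' c u := by
    rw [RingHom.id_apply, ← Integrable.toL1_smul]
    exact (Integrable.toL1_eq_toL1_iff _ _ _ _).2 (Lp.coeFn_smul c (u : L d 2))

lemma integrableSubmodule.coeFn_toL1 (u : integrableSubmodule d) :
    toL1 u =ᵐ[volume] (u : L d 2) :=
  Integrable.coeFn_toL1 (integrable u)

lemma integrableSubmodule.norm_toL1 (u : integrableSubmodule d) :
    ‖toL1 u‖ = ∫ x, |(u : L d 2) x| := by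
  rw [L1.norm_eq_integral_norm]
  exact integral_congr_ae ((coeFn_toL1 u).mono fun x hx => by simp only [hx, Real.norm_eq_abs])

lemma integrableSubmodule.exists_coeFn_eq {η : E d → ℝ} (hη : Continuous η)
    (hsupp : HasCompactSupport η) : ∃ u : integrableSubmodule d, (u : L d 2) =ᵐ[volume] η := by
  have hmem : MemLp η 2 (volume : Measure (E d)) := hη.memLp_of_hasCompactSupport hsupp
  exact ⟨⟨hmem.toLp η, (integrable_congr hmem.coeFn_toLp).2
    (hη.integrable_of_hasCompactSupport hsupp)⟩, hmem.coeFn_toLp⟩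

lemma integrableSubmodule.denseRange_toL1 : DenseRange (toL1 (d := d)) := by
  refine (Lp.dense_hasCompactSupport_contDiff (F := ℝ) (μ := (volume : Measure (E d))) (p := 1)
    ENNReal.one_ne_top).mono ?_
  rintro a ⟨η, haη, hsupp, hη⟩
  obtain ⟨u, hu⟩ := exists_coeFn_eq hη.continuous hsupp
  exact ⟨u, Lp.ext ((coeFn_toL1 u).trans (hu.trans haη.symm))⟩

namespace IsSymmSubMarkovian

variable {A : L d 2 →L[ℝ] L d 2}

/-- The restriction to `L_1 ∩ L_2` of a symmetric sub-Markovian operator. -/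
def restrictIntegrable (hA : IsSymmSubMarkovian A) :
    integrableSubmodule d →ₗ[ℝ] integrableSubmodule d :=
  (A : L d 2 →ₗ[ℝ] L d 2).restrict fun _ => hA.integrable_apply

lemma exists_adjoint_linftyExtension (hA : IsSymmSubMarkovian A) :
    ∃ B : L d 1 →L[ℝ] L d 1, ∀ f g, ∫ x, hA.linftyExtension f x * g x = ∫ x, f x * B g x := by
  let B : L d 1 →L[ℝ] L d 1 :=
    (integrableSubmodule.toL1 ∘ₗ hA.restrictIntegrable).extendOfNorm integrableSubmodule.toL1
  have hB : ∀ u, B (integrableSubmodule.toL1 u) =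
      integrableSubmodule.toL1 (hA.restrictIntegrable u) :=
    LinearMap.extendOfNorm_eq integrableSubmodule.denseRange_toL1 ⟨1, fun u => by
      rw [one_mul, integrableSubmodule.norm_toL1]
      exact (integrableSubmodule.norm_toL1 _).trans_le (hA.integral_abs_apply_le u.2)⟩
  let pairing := (ContinuousLinearMap.mul ℝ ℝ).lpPairing (volume : Measure (E d)) ∞ 1
  have hpairing : ∀ f g, pairing f g = ∫ x, f x * g x :=
    (ContinuousLinearMap.mul ℝ ℝ).lpPairing_eq_integral
  refine ⟨B, fun f => congrFun ?_⟩
  simp_rw [← hpairing]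
  refine integrableSubmodule.denseRange_toL1.equalizer (by fun_prop) (by fun_prop) ?_
  funext u
  simp only [Function.comp_apply, hB, hpairing]
  rw [integral_congr_ae ((integrableSubmodule.coeFn_toL1 u).mono fun x hx => by rw [hx]),
    hA.integral_linftyExtension_mul f u.2]
  refine integral_congr_ae ?_
  filter_upwards [integrableSubmodule.coeFn_toL1 (hA.restrictIntegrable u)] with x hx
  rw [hx]
  rfl

theorem isLinftyExtension (hA : IsSymmSubMarkovian A) : IsLinftyExtension A hA.linftyExtension where
  agrees u f huf := by
    refine ae_eq_of_integral_contDiff_smul_eq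
      ((Lp.memLp (A u)).locallyIntegrable one_le_two)
      ((Lp.memLp _).locallyIntegrable le_top) fun η hη hsupp => ?_
    obtain ⟨v, hv⟩ := integrableSubmodule.exists_coeFn_eq hη.continuous hsupp
    have hswap : ∀ w : E d → ℝ, ∫ x, η x • w x = ∫ x, w x * (v : L d 2) x := fun w => by
      refine integral_congr_ae (hv.mono fun x hx => ?_)
      simp only [hx, smul_eq_mul, mul_comm]
    rw [hswap, hswap, hA.integral_linftyExtension_mul f v.2, ← inner_eq_integral, hA.inner_comm,
      inner_eq_integral]
    exact integral_congr_ae (huf.mono fun x hx => by simp only [hx])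
  weakStar g := by
    obtain ⟨B, hB⟩ := hA.exists_adjoint_linftyExtension
    exact ⟨B g, fun f => hB f g⟩

end IsSymmSubMarkovian

namespace IsLinftyExtension

lemma id :
    IsLinftyExtension (ContinuousLinearMap.id ℝ (L d 2)) (ContinuousLinearMap.id ℝ (L d ∞)) :=
  ⟨fun _ _ h => h, fun g => ⟨g, fun _ => rfl⟩⟩

lemma comp {A B : L d 2 →L[ℝ] L d 2} {T U : L d ∞ →L[ℝ] L d ∞}
    (hA : IsLinftyExtension A T) (hB : IsLinftyExtension B U) :
    IsLinftyExtension (A.comp B) (T.comp U) := by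
  refine ⟨fun u f h => hA.agrees _ _ (hB.agrees _ _ h), fun g => ?_⟩
  obtain ⟨g', hg'⟩ := hA.weakStar g
  obtain ⟨g'', hg''⟩ := hB.weakStar g'
  exact ⟨g'', fun f => (hg' (U f)).trans (hg'' f)⟩

end IsLinftyExtension

end LinftyExtension

/-! ### The energy form on Lipschitz functions -/

section Energy

open Gradient

variable {d : ℕ}

/-- The bilinear form `(a, b) ↦ ∑ aᵢ Mᵢⱼ bⱼ` on `ℝᵈ` given by the matrix `M`, in terms of the
operator on Euclidean space whose norm defines `nu`. -/
def cInner (M : Matrix (Fin d) (Fin d) ℝ) (a b : E d) : ℝ :=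
  inner ℝ a (Matrix.toEuclideanCLM (𝕜 := ℝ) M b)

lemma cInner_eq_sum (M : Matrix (Fin d) (Fin d) ℝ) (a b : E d) :
    cInner M a b = ∑ i, ∑ j, a i * (M i j * b j) := by
  rw [cInner, Matrix.inner_toEuclideanCLM]
  simp only [dotProduct, Matrix.mulVec, Finset.mul_sum]

section cInner

variable {M : Matrix (Fin d) (Fin d) ℝ} {a b c : E d}

lemma cInner_add_left : cInner M (a + b) c = cInner M a c + cInner M b c := inner_add_left _ _ _

lemma cInner_sub_left : cInner M (a - b) c = cInner M a c - cInner M b c := inner_sub_left _ _ _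

lemma cInner_smul_left (s : ℝ) : cInner M (s • a) b = s * cInner M a b :=
  real_inner_smul_left _ _ _

lemma cInner_add_right : cInner M a (b + c) = cInner M a b + cInner M a c := by
  simp [cInner, inner_add_right]

lemma cInner_smul_right (s : ℝ) : cInner M a (s • b) = s * cInner M a b := by
  simp [cInner, real_inner_smul_right]

lemma cInner_comm (hM : M.PosSemidef) : cInner M a b = cInner M b a := by
  rw [cInner_eq_sum, cInner_eq_sum, Finset.sum_comm]
  refine Finset.sum_congr rfl fun i _ => Finset.sum_congr rfl fun j _ => ?_
  have hM_symm : M j i = M i j := hM.isHermitian.apply i j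
  rw [hM_symm]
  ring

lemma cInner_self_nonneg (hM : M.PosSemidef) : 0 ≤ cInner M a a := by
  rw [cInner, Matrix.inner_toEuclideanCLM]
  simpa using hM.dotProduct_mulVec_nonneg a

lemma abs_cInner_le :
    |cInner M a b| ≤ ‖Matrix.toEuclideanCLM (𝕜 := ℝ) M‖ * (‖a‖ * ‖b‖) := calc
  |cInner M a b| ≤ ‖a‖ * ‖Matrix.toEuclideanCLM (𝕜 := ℝ) M b‖ := abs_real_inner_le_norm _ _
  _ ≤ ‖a‖ * (‖Matrix.toEuclideanCLM (𝕜 := ℝ) M‖ * ‖b‖) := by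
    gcongr
    exact ContinuousLinearMap.le_opNorm _ _
  _ = ‖Matrix.toEuclideanCLM (𝕜 := ℝ) M‖ * (‖a‖ * ‖b‖) := by ring

end cInner

variable {C : E d → Matrix (Fin d) (Fin d) ℝ}

namespace IsCoefficientMatrix

lemma aestronglyMeasurable (hC : IsCoefficientMatrix C) (i j : Fin d) :
    AEStronglyMeasurable (fun x => C x i j) volume := by
  have h : ∀ n : ℕ, AEStronglyMeasurable (fun x => C x i j)
      (volume.restrict (Metric.closedBall (0 : E d) n)) := fun n =>
    (hC.locallyBounded i j _ (isCompact_closedBall 0 n)).1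
  have h_iUnion := aestronglyMeasurable_iUnion_iff.2 h
  rwa [Metric.iUnion_closedBall_nat, Measure.restrict_univ] at h_iUnion

lemma memLp_toEuclideanCLM (hC : IsCoefficientMatrix C) {K : Set (E d)} (hK : IsCompact K) :
    MemLp (fun x => Matrix.toEuclideanCLM (𝕜 := ℝ) (C x)) ∞ (volume.restrict K) := by
  let A (i j : Fin d) : E d →L[ℝ] E d := Matrix.toEuclideanCLM (𝕜 := ℝ) (Matrix.single i j 1)
  have h_sum : (fun x => Matrix.toEuclideanCLM (𝕜 := ℝ) (C x)) =
      fun x => ∑ i, ∑ j, C x i j • A i j := by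
    funext x
    conv_lhs => rw [Matrix.matrix_eq_sum_single (C x)]
    simp only [A, map_sum, ← map_smul, Matrix.smul_single, smul_eq_mul, mul_one]
  have h_entry : ∀ i j, MemLp (fun x => C x i j • A i j) ∞ (volume.restrict K) := fun i j =>
    (ContinuousLinearMap.toSpanSingleton ℝ (A i j)).comp_memLp' (hC.locallyBounded i j K hK)
  rw [h_sum]
  exact memLp_finsetSum (f := fun i x => ∑ j, C x i j • A i j) _ fun i _ =>
    memLp_finsetSum (f := fun j x => C x i j • A i j) _ fun j _ => h_entry i j

lemma exists_opNorm_bound (hC : IsCoefficientMatrix C) {K : Set (E d)} (hK : IsCompact K) :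
    ∃ M : ℝ, 0 ≤ M ∧ ∀ᵐ x, x ∈ K → ‖Matrix.toEuclideanCLM (𝕜 := ℝ) (C x)‖ ≤ M := by
  set S := eLpNorm (fun x => Matrix.toEuclideanCLM (𝕜 := ℝ) (C x)) ∞ (volume.restrict K) with hS
  have hS_top : S ≠ ∞ := (hC.memLp_toEuclideanCLM hK).2.ne
  refine ⟨S.toReal, ENNReal.toReal_nonneg, (ae_restrict_iff' hK.measurableSet).1 ?_⟩
  rw [eLpNorm_exponent_top] at hS
  filter_upwards [hS ▸ ae_le_eLpNormEssSup] with x hx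
  rw [← toReal_enorm]
  exact ENNReal.toReal_mono hS_top hx

lemma aestronglyMeasurable_cInner (hC : IsCoefficientMatrix C) {a b : E d → E d}
    (ha : AEStronglyMeasurable a volume) (hb : AEStronglyMeasurable b volume) :
    AEStronglyMeasurable (fun x => cInner (C x) (a x) (b x)) volume := by
  simp only [cInner_eq_sum]
  have hcoord : ∀ {a : E d → E d}, AEStronglyMeasurable a volume → ∀ i,
      AEStronglyMeasurable (fun x => a x i) volume := fun {a} ha i =>
    (EuclideanSpace.proj (𝕜 := ℝ) i).continuous.comp_aestronglyMeasurable ha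
  exact Finset.aestronglyMeasurable_fun_sum _ fun i _ =>
    Finset.aestronglyMeasurable_fun_sum _ fun j _ =>
      (hcoord ha i).mul ((hC.aestronglyMeasurable i j).mul (hcoord hb j))

lemma integrable_cInner (hC : IsCoefficientMatrix C) {a b : E d → E d}
    (ha : MemLp a 2 volume) (hb : MemLp b 2 volume) {K : Set (E d)} (hK : IsCompact K)
    (ha0 : ∀ᵐ x, x ∉ K → a x = 0) : Integrable fun x => cInner (C x) (a x) (b x) := by
  obtain ⟨M, hM, hCM⟩ := hC.exists_opNorm_bound hK
  refine Integrable.mono' ((ha.norm.integrable_mul hb.norm).const_mul M)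
    (hC.aestronglyMeasurable_cInner ha.1 hb.1) ?_
  filter_upwards [hCM, ha0] with x hCMx ha0x
  by_cases hx : x ∈ K
  · exact abs_cInner_le.trans (mul_le_mul_of_nonneg_right (hCMx hx) (by positivity))
  · rw [ha0x hx, cInner, inner_zero_left, norm_zero]
    exact mul_nonneg hM (mul_nonneg (norm_nonneg _) (norm_nonneg _))

end IsCoefficientMatrix

section Gradient

variable {f g : E d → ℝ} {x : E d}

lemma gradient_add (hf : DifferentiableAt ℝ f x) (hg : DifferentiableAt ℝ g x) :
    ∇ (fun y => f y + g y) x = ∇ f x + ∇ g x := by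
  simp only [gradient, fderiv_fun_add hf hg, map_add]

lemma gradient_sub (hf : DifferentiableAt ℝ f x) (hg : DifferentiableAt ℝ g x) :
    ∇ (fun y => f y - g y) x = ∇ f x - ∇ g x := by
  simp only [gradient, fderiv_fun_sub hf hg, map_sub]

lemma gradient_mul (hf : DifferentiableAt ℝ f x) (hg : DifferentiableAt ℝ g x) :
    ∇ (fun y => f y * g y) x = f x • ∇ g x + g x • ∇ f x := by
  simp [gradient, fderiv_fun_mul hf hg]

lemma gradient_const_mul (c : ℝ) (hf : DifferentiableAt ℝ f x) :
    ∇ (fun y => c * f y) x = c • ∇ f x := by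
  simp [gradient, fderiv_const_mul hf]

lemma norm_gradient (f : E d → ℝ) (x : E d) : ‖∇ f x‖ = ‖fderiv ℝ f x‖ := by
  simp [gradient]

lemma gradient_apply (f : E d → ℝ) (x : E d) (i : Fin d) :
    ∇ f x i = fderiv ℝ f x (EuclideanSpace.single i 1) := by
  rw [← inner_gradient_left, EuclideanSpace.inner_single_right]
  simp

lemma measurable_gradient (f : E d → ℝ) : Measurable (∇ f) :=
  (InnerProductSpace.toDual ℝ (E d)).symm.continuous.measurable.comp (measurable_fderiv ℝ f)

lemma gradient_eq_zero_of_notMem_tsupport (hx : x ∉ tsupport f) : ∇ f x = 0 := by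
  rw [gradient, fderiv_of_notMem_tsupport (𝕜 := ℝ) hx, map_zero]

end Gradient

/-- The class `Lip_c(ℝᵈ)` of Lipschitz continuous functions with compact support, a core on which
the form is computed with almost everywhere defined gradients. -/
structure IsLipc (f : E d → ℝ) : Prop where
  lipschitz : ∃ K, LipschitzWith K f
  hasCompactSupport : HasCompactSupport f

namespace IsLipc

variable {f g : E d → ℝ}

lemma continuous (hf : IsLipc f) : Continuous f := hf.lipschitz.choose_spec.continuous

lemma ae_differentiableAt (hf : IsLipc f) : ∀ᵐ x, DifferentiableAt ℝ f x :=
  hf.lipschitz.choose_spec.ae_differentiableAt_of_real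

lemma memLp (hf : IsLipc f) (p : ℝ≥0∞) : MemLp f p (volume : Measure (E d)) :=
  hf.continuous.memLp_of_hasCompactSupport hf.hasCompactSupport

lemma memLp_gradient (hf : IsLipc f) (p : ℝ≥0∞) : MemLp (∇ f) p (volume : Measure (E d)) := by
  obtain ⟨K, hK⟩ := hf.lipschitz
  have h_indicator : (tsupport f).indicator (∇ f) = ∇ f :=
    Set.indicator_eq_self.2 fun x hx =>
      not_not.1 (mt gradient_eq_zero_of_notMem_tsupport hx)
  have h_finite : IsFiniteMeasure ((volume : Measure (E d)).restrict (tsupport f)) :=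
    ⟨by simpa using hf.hasCompactSupport.measure_lt_top⟩
  rw [← h_indicator, memLp_indicator_iff_restrict (isClosed_tsupport f).measurableSet]
  refine MemLp.of_bound (measurable_gradient f).aestronglyMeasurable K (ae_of_all _ fun x => ?_)
  rw [norm_gradient]
  exact norm_fderiv_le_of_lipschitz ℝ hK

protected lemma zero : IsLipc fun _ : E d => 0 :=
  ⟨⟨0, LipschitzWith.const 0⟩, HasCompactSupport.zero⟩

lemma add (hf : IsLipc f) (hg : IsLipc g) : IsLipc fun x => f x + g x := by
  obtain ⟨⟨K, hK⟩, hfc⟩ := hf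
  obtain ⟨⟨K', hK'⟩, hgc⟩ := hg
  exact ⟨⟨_, hK.add hK'⟩, hfc.add hgc⟩

lemma comp (hf : IsLipc f) {F : ℝ → ℝ} {K : ℝ≥0} (hF : LipschitzWith K F) (hF0 : F 0 = 0) :
    IsLipc fun x => F (f x) := by
  obtain ⟨⟨K', hK'⟩, hfc⟩ := hf
  exact ⟨⟨_, hF.comp hK'⟩, hfc.comp_left hF0⟩

lemma const_mul (hf : IsLipc f) (c : ℝ) : IsLipc fun x => c * f x :=
  hf.comp (lipschitzWith_smul c) (mul_zero c)

lemma sub (hf : IsLipc f) (hg : IsLipc g) : IsLipc fun x => f x - g x := by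
  simpa [sub_eq_add_neg] using hf.add (hg.const_mul (-1))

lemma bounded_mul (hf : IsLipc f) {ψ : E d → ℝ} {K : ℝ≥0} (hψ : LipschitzWith K ψ) {B : ℝ}
    (hB : ∀ x, |ψ x| ≤ B) : IsLipc fun x => ψ x * f x := by
  obtain ⟨⟨K', hK'⟩, hfc⟩ := hf
  obtain ⟨A, hA⟩ := hfc.exists_bound_of_continuous hK'.continuous
  have hA0 : 0 ≤ A := (norm_nonneg _).trans (hA 0)
  have hB0 : 0 ≤ B := (abs_nonneg _).trans (hB 0)
  refine ⟨⟨B.toNNReal * K' + A.toNNReal * K, LipschitzWith.of_dist_le_mul fun x y => ?_⟩,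
    hfc.mul_left⟩
  have hf_dist : |f x - f y| ≤ K' * dist x y := hK'.dist_le_mul x y
  have hψ_dist : |ψ x - ψ y| ≤ K * dist x y := hψ.dist_le_mul x y
  push_cast
  rw [Real.coe_toNNReal B hB0, Real.coe_toNNReal A hA0]
  calc dist (ψ x * f x) (ψ y * f y)
      = |ψ x * (f x - f y) + f y * (ψ x - ψ y)| := by rw [Real.dist_eq]; ring_nf
    _ ≤ |ψ x| * |f x - f y| + |f y| * |ψ x - ψ y| := by
      rw [← abs_mul, ← abs_mul]
      exact abs_add_le _ _
    _ ≤ B * (K' * dist x y) + A * (K * dist x y) := by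
      gcongr
      exacts [hB x, hA y]
    _ = (B * K' + A * K) * dist x y := by ring

end IsLipc

/-- The energy density `∑ ∂ᵢf cᵢⱼ ∂ⱼg`. -/
def energyDensity (C : E d → Matrix (Fin d) (Fin d) ℝ) (f g : E d → ℝ) (x : E d) : ℝ :=
  cInner (C x) (∇ f x) (∇ g x)

/-- The energy form `∑ (∂ᵢf, cᵢⱼ ∂ⱼg)`. -/
def energy (C : E d → Matrix (Fin d) (Fin d) ℝ) (f g : E d → ℝ) : ℝ :=
  ∫ x, energyDensity C f g x

section energy

variable {f g h : E d → ℝ}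

lemma IsLipc.integrable_energyDensity (hC : IsCoefficientMatrix C) (hf : IsLipc f)
    (hg : IsLipc g) : Integrable (energyDensity C f g) :=
  hC.integrable_cInner (hf.memLp_gradient 2) (hg.memLp_gradient 2) hf.hasCompactSupport
    (ae_of_all _ fun _ hx => gradient_eq_zero_of_notMem_tsupport hx)

lemma energy_self_nonneg (hC : IsCoefficientMatrix C) (f : E d → ℝ) : 0 ≤ energy C f f :=
  integral_nonneg_of_ae (hC.posSemidef.mono fun _ hx => cInner_self_nonneg hx)

lemma energy_comm (hC : IsCoefficientMatrix C) (f g : E d → ℝ) : energy C f g = energy C g f :=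
  integral_congr_ae (hC.posSemidef.mono fun _ hx => cInner_comm hx)

lemma energy_add_left (hC : IsCoefficientMatrix C) (hf : IsLipc f) (hg : IsLipc g)
    (hh : IsLipc h) : energy C (fun x => f x + g x) h = energy C f h + energy C g h := by
  rw [energy, energy, energy, ← integral_add (hf.integrable_energyDensity hC hh)
    (hg.integrable_energyDensity hC hh)]
  refine integral_congr_ae ?_
  filter_upwards [hf.ae_differentiableAt, hg.ae_differentiableAt] with x hfx hgx
  simp only [energyDensity, gradient_add hfx hgx, cInner_add_left]

lemma energy_sub_left (hC : IsCoefficientMatrix C) (hf : IsLipc f) (hg : IsLipc g)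
    (hh : IsLipc h) : energy C (fun x => f x - g x) h = energy C f h - energy C g h := by
  rw [energy, energy, energy, ← integral_sub (hf.integrable_energyDensity hC hh)
    (hg.integrable_energyDensity hC hh)]
  refine integral_congr_ae ?_
  filter_upwards [hf.ae_differentiableAt, hg.ae_differentiableAt] with x hfx hgx
  simp only [energyDensity, gradient_sub hfx hgx, cInner_sub_left]

lemma energy_const_mul (hf : IsLipc f) (c : ℝ) :
    energy C (fun x => c * f x) (fun x => c * f x) = c ^ 2 * energy C f f := by
  rw [energy, energy, ← integral_const_mul]
  refine integral_congr_ae ?_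
  filter_upwards [hf.ae_differentiableAt] with x hfx
  simp only [energyDensity, gradient_const_mul c hfx, cInner_smul_left, cInner_smul_right]
  ring

lemma energy_add_add (hC : IsCoefficientMatrix C) (hf : IsLipc f) (hg : IsLipc g) :
    energy C (fun x => f x + g x) (fun x => f x + g x) =
      energy C f f + 2 * energy C f g + energy C g g := by
  rw [energy_add_left hC hf hg (hf.add hg), energy_comm hC f, energy_comm hC g,
    energy_add_left hC hf hg hf, energy_add_left hC hf hg hg, energy_comm hC g f]
  ring

lemma energy_sub_sub (hC : IsCoefficientMatrix C) (hf : IsLipc f) (hg : IsLipc g) :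
    energy C (fun x => f x - g x) (fun x => f x - g x) =
      energy C f f - 2 * energy C f g + energy C g g := by
  rw [energy_sub_left hC hf hg (hf.sub hg), energy_comm hC f, energy_comm hC g,
    energy_sub_left hC hf hg hf, energy_sub_left hC hf hg hg, energy_comm hC g f]
  ring

end energy

open Classical in
/-- The energy form with domain `Lip_c(ℝᵈ)`, extended by `∞` to `L_2(ℝᵈ)`. A class in `L_2(ℝᵈ)` has
at most one continuous representative, so the value does not depend on the choice. -/
def lipForm (C : E d → Matrix (Fin d) (Fin d) ℝ) (u : L d 2) : ℝ≥0∞ :=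
  if h : ∃ f : E d → ℝ, IsLipc f ∧ u =ᵐ[volume] f then
    ENNReal.ofReal (energy C h.choose h.choose) else ∞

section lipForm

variable {u v : L d 2} {f g : E d → ℝ}

lemma lipForm_eq (hf : IsLipc f) (hu : u =ᵐ[volume] f) :
    lipForm C u = ENNReal.ofReal (energy C f f) := by
  have h : ∃ f : E d → ℝ, IsLipc f ∧ u =ᵐ[volume] f := ⟨f, hf, hu⟩
  have h_choose : h.choose = f :=
    (Continuous.ae_eq_iff_eq volume h.choose_spec.1.continuous hf.continuous).1
      (h.choose_spec.2.symm.trans hu)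
  rw [lipForm, dif_pos h, h_choose]

lemma lipForm_ne_top_iff : lipForm C u ≠ ∞ ↔ ∃ f : E d → ℝ, IsLipc f ∧ u =ᵐ[volume] f := by
  refine ⟨fun h => not_not.1 fun hn => h (dif_neg hn), ?_⟩
  rintro ⟨f, hf, hu⟩
  rw [lipForm_eq hf hu]
  exact ENNReal.ofReal_ne_top

lemma coeFn_add_of (hu : u =ᵐ[volume] f) (hv : v =ᵐ[volume] g) :
    (u + v : L d 2) =ᵐ[volume] fun x => f x + g x :=
  (Lp.coeFn_add u v).trans (hu.add hv)

lemma coeFn_sub_of (hu : u =ᵐ[volume] f) (hv : v =ᵐ[volume] g) :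
    (u - v : L d 2) =ᵐ[volume] fun x => f x - g x :=
  (Lp.coeFn_sub u v).trans (hu.sub hv)

lemma coeFn_smul_of (c : ℝ) (hu : u =ᵐ[volume] f) :
    (c • u : L d 2) =ᵐ[volume] fun x => c * f x :=
  (Lp.coeFn_smul c u).trans (hu.const_smul c)

theorem isQuadraticForm_lipForm (hC : IsCoefficientMatrix C) : IsQuadraticForm (lipForm C) := by
  refine IsQuadraticForm.of_ne_top ?_ (fun c u hu => ?_) fun u v hu hv => ?_
  · exact lipForm_ne_top_iff.2 ⟨_, IsLipc.zero, Lp.coeFn_zero _ _ _⟩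
  · obtain ⟨f, hf, huf⟩ := lipForm_ne_top_iff.1 hu
    rw [lipForm_eq hf huf, lipForm_eq (hf.const_mul c) (coeFn_smul_of c huf),
      energy_const_mul hf, ENNReal.ofReal_mul (sq_nonneg c)]
  · obtain ⟨f, hf, huf⟩ := lipForm_ne_top_iff.1 hu
    obtain ⟨g, hg, hvg⟩ := lipForm_ne_top_iff.1 hv
    have hff := energy_self_nonneg hC f
    have hgg := energy_self_nonneg hC g
    rw [lipForm_eq hf huf, lipForm_eq hg hvg, lipForm_eq (hf.add hg) (coeFn_add_of huf hvg),
      lipForm_eq (hf.sub hg) (coeFn_sub_of huf hvg), ← ENNReal.ofReal_ofNat 2,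
      ← ENNReal.ofReal_mul two_pos.le, ← ENNReal.ofReal_mul two_pos.le,
      ← ENNReal.ofReal_add (energy_self_nonneg hC _) (energy_self_nonneg hC _),
      ← ENNReal.ofReal_add (by positivity) (by positivity),
      energy_add_add hC hf hg, energy_sub_sub hC hf hg]
    congr 1
    ring

theorem polar_lipForm (hC : IsCoefficientMatrix C) (hf : IsLipc f) (hg : IsLipc g)
    (hu : u =ᵐ[volume] f) (hv : v =ᵐ[volume] g) : polar (lipForm C) u v = energy C f g := by
  rw [polar, lipForm_eq (hf.add hg) (coeFn_add_of hu hv),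
    lipForm_eq (hf.sub hg) (coeFn_sub_of hu hv),
    ENNReal.toReal_ofReal (energy_self_nonneg hC _),
    ENNReal.toReal_ofReal (energy_self_nonneg hC _),
    energy_add_add hC hf hg, energy_sub_sub hC hf hg]
  ring

theorem dense_lipForm (C : E d → Matrix (Fin d) (Fin d) ℝ) :
    Dense {u : L d 2 | lipForm C u ≠ ∞} := by
  refine (Lp.dense_hasCompactSupport_contDiff (F := ℝ) (μ := (volume : Measure (E d))) (p := 2)
    ENNReal.ofNat_ne_top).mono ?_
  rintro u ⟨g, hug, hgc, hg⟩
  exact lipForm_ne_top_iff.2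
    ⟨g, ⟨ContDiff.lipschitzWith_of_hasCompactSupport hgc hg (by simp), hgc⟩, hug⟩

end lipForm

end Energy

/-! ### Weak gradients -/

section WeakGradient

open Gradient

variable {d : ℕ} {C : E d → Matrix (Fin d) (Fin d) ℝ}

lemma memLp_coord (G : Lp (E d) 2 (volume : Measure (E d))) (i : Fin d) :
    MemLp (fun x => G x i) 2 volume :=
  MemLp.eval_piLp (Lp.memLp G) i

namespace IsWeakGradient

variable {u : L d 2} {G G' : Lp (E d) 2 (volume : Measure (E d))}

lemma unique (hG : IsWeakGradient u G) (hG' : IsWeakGradient u G') : G = G' := by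
  have h_coord : ∀ i, ∀ᵐ x, G x i = G' x i := fun i => by
    refine ae_eq_of_integral_contDiff_smul_eq ((memLp_coord G i).locallyIntegrable one_le_two)
      ((memLp_coord G' i).locallyIntegrable one_le_two) fun η hη hηc => ?_
    simpa only [smul_eq_mul, mul_comm (η _), hG' η hη hηc i, neg_inj] using
      (hG η hη hηc i).symm
  refine Lp.ext ?_
  filter_upwards [ae_all_iff.2 h_coord] with x hx
  ext i
  exact hx i

lemma weakGradient_eq (hG : IsWeakGradient u G) : weakGradient u = G := by
  have h : ∃ G, IsWeakGradient u G := ⟨G, hG⟩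
  rw [weakGradient, dif_pos h]
  exact h.choose_spec.unique hG

lemma ae_eq_zero (hG : IsWeakGradient u G) {K : Set (E d)} (hK : IsClosed K)
    (hu : ∀ᵐ x, x ∉ K → u x = 0) : ∀ᵐ x, x ∉ K → G x = 0 := by
  have h_coord : ∀ i, ∀ᵐ x, x ∈ Kᶜ → G x i = 0 := fun i => by
    refine hK.isOpen_compl.ae_eq_zero_of_integral_contDiff_smul_eq_zero
      (((memLp_coord G i).locallyIntegrable one_le_two).locallyIntegrableOn _)
      fun η hη hηc hsupp => ?_
    have h_test : ∫ x, u x * fderiv ℝ η x (EuclideanSpace.single i 1) = 0 := by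
      refine integral_eq_zero_of_ae ?_
      filter_upwards [hu] with x hx
      by_cases hxK : x ∈ K
      · simp [fderiv_of_notMem_tsupport (𝕜 := ℝ) fun h => hsupp h hxK]
      · simp [hx hxK]
    simpa only [smul_eq_mul, mul_comm (η _), h_test, zero_eq_neg] using hG η hη hηc i
  filter_upwards [ae_all_iff.2 h_coord] with x hx hxK
  ext i
  exact hx i hxK

end IsWeakGradient

lemma IsLipc.isWeakGradient {f : E d → ℝ} (hf : IsLipc f) {u : L d 2} (hu : u =ᵐ[volume] f) :
    IsWeakGradient u (hf.memLp_gradient 2).toLp := by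
  intro η hη hηc i
  obtain ⟨K, hK⟩ := hf.lipschitz
  obtain ⟨K', hK'⟩ := ContDiff.lipschitzWith_of_hasCompactSupport hηc hη (by simp)
  calc ∫ x, u x * fderiv ℝ η x (EuclideanSpace.single i 1)
      = -∫ x, lineDeriv ℝ η x (-(EuclideanSpace.single i 1)) * f x := by
        rw [← integral_neg]
        refine integral_congr_ae ?_
        filter_upwards [hu] with x hx
        rw [hx, ((hη.differentiable (by simp)).differentiableAt).lineDeriv_eq_fderiv, map_neg]
        ring
    _ = -∫ x, lineDeriv ℝ f x (EuclideanSpace.single i 1) * η x := by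
        rw [hK.integral_lineDeriv_mul_eq hK' hηc]
    _ = -∫ x, (hf.memLp_gradient 2).toLp (∇ f) x i * η x := by
        congr 1
        refine integral_congr_ae ?_
        filter_upwards [hf.ae_differentiableAt, (hf.memLp_gradient 2).coeFn_toLp] with x hfx hx
        rw [hx, gradient_apply, hfx.lineDeriv_eq_fderiv]

lemma sum_integral_eq_integral_cInner (hC : IsCoefficientMatrix C)
    (G : Lp (E d) 2 (volume : Measure (E d))) {K : Set (E d)} (hK : IsCompact K)
    (hG : ∀ᵐ x, x ∉ K → G x = 0) :
    ∑ i, ∑ j, ∫ x, G x i * (C x i j * G x j) = ∫ x, cInner (C x) (G x) (G x) := by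
  have h_component : ∀ i : Fin d, MemLp (fun x => G x i • EuclideanSpace.single i (1 : ℝ)) 2
      (volume : Measure (E d)) := fun i =>
    (ContinuousLinearMap.toSpanSingleton ℝ (EuclideanSpace.single i (1 : ℝ))).comp_memLp'
      (memLp_coord G i)
  have h_int : ∀ i j, Integrable fun x => G x i * (C x i j * G x j) := by
    intro i j
    refine (hC.integrable_cInner (h_component i) (h_component j) hK ?_).congr (ae_of_all _ ?_)
    · filter_upwards [hG] with x hx hxK
      simp [hx hxK]
    · intro x
      simp [cInner_eq_sum]
  simp only [cInner_eq_sum]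
  rw [integral_finsetSum _ fun i _ => integrable_finsetSum _ fun j _ => h_int i j]
  exact Finset.sum_congr rfl fun i _ => (integral_finsetSum _ fun j _ => h_int i j).symm

lemma form_eq (hC : IsCoefficientMatrix C) {u : L d 2}
    {G : Lp (E d) 2 (volume : Measure (E d))} (hG : IsWeakGradient u G) {K : Set (E d)}
    (hK : IsCompact K) (hu : ∀ᵐ x, x ∉ K → u x = 0) :
    form C u = ENNReal.ofReal (∫ x, cInner (C x) (G x) (G x)) := by
  have hW : u ∈ W₀ d := ⟨⟨G, hG⟩, K, hK, hu⟩
  rw [form, if_pos hW, hG.weakGradient_eq,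
    sum_integral_eq_integral_cInner hC G hK (hG.ae_eq_zero hK.isClosed hu)]

lemma form_le_lipForm (hC : IsCoefficientMatrix C) : form C ≤ lipForm C := by
  intro u
  by_cases hu : lipForm C u = ∞
  · exact hu ▸ le_top
  obtain ⟨f, hf, huf⟩ := lipForm_ne_top_iff.1 hu
  have hu_supp : ∀ᵐ x, x ∉ tsupport f → u x = 0 :=
    huf.mono fun x hx hxK => hx.trans (image_eq_zero_of_notMem_tsupport hxK)
  rw [lipForm_eq hf huf, form_eq hC (hf.isWeakGradient huf) hf.hasCompactSupport hu_supp]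
  refine le_of_eq (congrArg _ (integral_congr_ae ?_))
  filter_upwards [(hf.memLp_gradient 2).coeFn_toLp] with x hx
  rw [hx, energyDensity]

lemma integral_norm_mul_norm_le {α F : Type*} [MeasurableSpace α] {μ : Measure α}
    [NormedAddCommGroup F] (A B : Lp F 2 μ) : ∫ x, ‖A x‖ * ‖B x‖ ∂μ ≤ ‖A‖ * ‖B‖ := by
  have h_norm : ∀ A : Lp F 2 μ, ‖(Lp.memLp A).norm.toLp‖ = ‖A‖ := fun A => by
    rw [Lp.norm_toLp, Lp.norm_def, eLpNorm_norm]
  calc ∫ x, ‖A x‖ * ‖B x‖ ∂μ = inner ℝ (Lp.memLp A).norm.toLp (Lp.memLp B).norm.toLp := by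
        rw [L2.inner_def]
        refine integral_congr_ae ?_
        filter_upwards [(Lp.memLp A).norm.coeFn_toLp, (Lp.memLp B).norm.coeFn_toLp] with x hA hB
        rw [hA, hB, Real.inner_apply]
    _ ≤ ‖(Lp.memLp A).norm.toLp‖ * ‖(Lp.memLp B).norm.toLp‖ := real_inner_le_norm _ _
    _ = ‖A‖ * ‖B‖ := by rw [h_norm, h_norm]

lemma abs_integral_cInner_le {K : Set (E d)} {M : ℝ} (hM : 0 ≤ M)
    (hCM : ∀ᵐ x, x ∈ K → ‖Matrix.toEuclideanCLM (𝕜 := ℝ) (C x)‖ ≤ M)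
    (A B : Lp (E d) 2 (volume : Measure (E d))) (hA : ∀ᵐ x, x ∉ K → A x = 0) :
    |∫ x, cInner (C x) (A x) (B x)| ≤ M * (‖A‖ * ‖B‖) := by
  have h_int : Integrable fun x => ‖A x‖ * ‖B x‖ :=
    (Lp.memLp A).norm.integrable_mul (Lp.memLp B).norm
  calc |∫ x, cInner (C x) (A x) (B x)| ≤ ∫ x, M * (‖A x‖ * ‖B x‖) := by
        refine norm_integral_le_of_norm_le (G := ℝ) (h_int.const_mul M) ?_
        filter_upwards [hCM, hA] with x hCMx hAx
        by_cases hx : x ∈ K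
        · exact abs_cInner_le.trans (mul_le_mul_of_nonneg_right (hCMx hx) (by positivity))
        · simp [cInner, hAx hx]
    _ = M * ∫ x, ‖A x‖ * ‖B x‖ := integral_const_mul _ _
    _ ≤ M * (‖A‖ * ‖B‖) := by
        gcongr
        exact integral_norm_mul_norm_le A B

lemma tendsto_integral_cInner (hC : IsCoefficientMatrix C) {K : Set (E d)} (hK : IsCompact K)
    {ι : Type*} {l : Filter ι} {A : ι → Lp (E d) 2 (volume : Measure (E d))}
    {G : Lp (E d) 2 (volume : Measure (E d))}
    (hA : ∀ n, ∀ᵐ x, x ∉ K → A n x = 0) (hG : ∀ᵐ x, x ∉ K → G x = 0)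
    (hlim : Tendsto A l (𝓝 G)) :
    Tendsto (fun n => ∫ x, cInner (C x) (A n x) (A n x)) l
      (𝓝 (∫ x, cInner (C x) (G x) (G x))) := by
  obtain ⟨M, hM, hCM⟩ := hC.exists_opNorm_bound hK
  have h_diff : ∀ n, ∀ᵐ x, x ∉ K → (A n - G) x = 0 := fun n => by
    filter_upwards [hA n, hG, Lp.coeFn_sub (A n) G] with x hAx hGx h_sub hxK
    rw [h_sub, Pi.sub_apply, hAx hxK, hGx hxK, sub_zero]
  have h_expand : ∀ n, ∫ x, cInner (C x) (A n x) (A n x) = (∫ x, cInner (C x) (G x) (G x)) +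
      (2 * (∫ x, cInner (C x) ((A n - G) x) (G x)) +
        ∫ x, cInner (C x) ((A n - G) x) ((A n - G) x)) := fun n => by
    have h_cross := hC.integrable_cInner (Lp.memLp (A n - G)) (Lp.memLp G) hK (h_diff n)
    have h_square := hC.integrable_cInner (Lp.memLp (A n - G)) (Lp.memLp (A n - G)) hK (h_diff n)
    rw [← integral_const_mul, ← integral_add (h_cross.const_mul 2) h_square,
      ← integral_add (g := fun x => 2 * cInner (C x) ((A n - G) x) (G x) +
          cInner (C x) ((A n - G) x) ((A n - G) x))
        (hC.integrable_cInner (Lp.memLp G) (Lp.memLp G) hK hG)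
        ((h_cross.const_mul 2).add h_square)]
    refine integral_congr_ae ?_
    filter_upwards [hC.posSemidef, Lp.coeFn_sub (A n) G] with x hCx h_sub
    have h_add : A n x = G x + (A n - G) x := by rw [h_sub, Pi.sub_apply, add_sub_cancel]
    rw [h_add, cInner_add_left, cInner_add_right, cInner_add_right,
      cInner_comm hCx (a := G x) (b := (A n - G) x)]
    ring
  have h_norm : Tendsto (fun n => ‖A n - G‖) l (𝓝 0) := tendsto_iff_norm_sub_tendsto_zero.1 hlim
  have h_cross : Tendsto (fun n => ∫ x, cInner (C x) ((A n - G) x) (G x)) l (𝓝 0) :=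
    squeeze_zero_norm (fun n => abs_integral_cInner_le hM hCM (A n - G) G (h_diff n))
      (by simpa using (h_norm.mul_const ‖G‖).const_mul M)
  have h_square : Tendsto (fun n => ∫ x, cInner (C x) ((A n - G) x) ((A n - G) x)) l (𝓝 0) :=
    squeeze_zero_norm (fun n => abs_integral_cInner_le hM hCM _ _ (h_diff n))
      (by simpa using (h_norm.mul h_norm).const_mul M)
  simpa only [h_expand, mul_zero, add_zero] using
    ((h_cross.const_mul 2).add h_square).const_add (∫ x, cInner (C x) (G x) (G x))

end WeakGradient

/-! ### Mollification -/

section Mollification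

open Gradient Convolution ContinuousLinearMap Pointwise

variable {d : ℕ} {C : E d → Matrix (Fin d) (Fin d) ℝ}
variable {F : Type*} [NormedAddCommGroup F]

lemma tendsto_eLpNorm_translate_sub {p : ℝ≥0∞} [Fact (1 ≤ p)] (hp : p ≠ ∞) {g : E d → F}
    (hg : MemLp g p (volume : Measure (E d))) :
    Tendsto (fun t : E d => eLpNorm (fun x => g (x - t) - g x) p volume) (𝓝 0) (𝓝 0) := by
  let τ : C(E d, C(E d, E d)) :=
    (ContinuousMap.mk (fun z : E d × E d => z.2 - z.1) (by fun_prop)).curry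
  have hτ : ∀ t, MeasurePreserving (τ t) (volume : Measure (E d)) volume := fun t =>
    measurePreserving_sub_right volume t
  have h_lim := Filter.Tendsto.compMeasurePreservingLp (p := p)
    (tendsto_const_nhds (x := hg.toLp g) (f := 𝓝 (0 : E d))) (τ.continuous.tendsto 0) hτ (hτ 0) hp
  have h_zero : Lp.compMeasurePreserving (τ 0) (hτ 0) (hg.toLp g) = hg.toLp g := by
    refine Lp.ext ((Lp.coeFn_compMeasurePreserving _ (hτ 0)).trans
      (Eventually.of_forall fun x => ?_))
    simp [τ]
  rw [h_zero, Lp.tendsto_Lp_iff_tendsto_eLpNorm'] at h_lim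
  refine h_lim.congr fun t => eLpNorm_congr_ae ?_
  filter_upwards [Lp.coeFn_compMeasurePreserving (hg.toLp g) (hτ t), hg.coeFn_toLp,
    (hτ t).quasiMeasurePreserving.ae hg.coeFn_toLp] with x h_comp hx h_translate
  rw [Pi.sub_apply, h_comp, hx, Function.comp_apply, h_translate]
  rfl

lemma eLpNorm_two_sq {X : Type*} [MeasurableSpace X] (μ : Measure X) (f : X → F) :
    eLpNorm f 2 μ ^ 2 = ∫⁻ x, ‖f x‖ₑ ^ 2 ∂μ := by
  have h_two : ((2 : ℝ≥0) : ℝ) = ((2 : ℕ) : ℝ) := by norm_num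
  simpa only [h_two, ENNReal.rpow_natCast, ENNReal.coe_ofNat] using
    eLpNorm_nnreal_pow_eq_lintegral (p := 2) (μ := μ) (f := f) two_ne_zero

lemma lintegral_lintegral_translate_sub_le {m : Measure (E d)} [IsProbabilityMeasure m]
    {g : E d → F} (hg : StronglyMeasurable g) {ε : ℝ≥0∞}
    (hε : ∀ᵐ t ∂m, eLpNorm (fun x => g (x - t) - g x) 2 volume ≤ ε) :
    ∫⁻ x, ∫⁻ t, ‖g (x - t) - g x‖ₑ ^ 2 ∂m ≤ ε ^ 2 := by
  have h_meas : Measurable fun z : E d × E d => ‖g (z.1 - z.2) - g z.1‖ₑ ^ 2 :=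
    ((hg.comp_measurable (measurable_fst.sub measurable_snd)).sub
      (hg.comp_measurable measurable_fst)).enorm.pow_const 2
  calc ∫⁻ x, ∫⁻ t, ‖g (x - t) - g x‖ₑ ^ 2 ∂m
      = ∫⁻ t, eLpNorm (fun x => g (x - t) - g x) 2 volume ^ 2 ∂m := by
        rw [lintegral_lintegral_swap h_meas.aemeasurable]
        simp only [eLpNorm_two_sq]
    _ ≤ ∫⁻ _, ε ^ 2 ∂m := lintegral_mono_ae (hε.mono fun t ht => by gcongr)
    _ = ε ^ 2 := by simp

lemma tendsto_toLp_of_eLpNorm_sub {ι : Type*} {l : Filter ι} {p : ℝ≥0∞} [Fact (1 ≤ p)]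
    {f : ι → E d → F} (hf : ∀ n, MemLp (f n) p volume) {g : Lp F p (volume : Measure (E d))}
    (h : Tendsto (fun n => eLpNorm (f n - ⇑g) p volume) l (𝓝 0)) :
    Tendsto (fun n => (hf n).toLp (f n)) l (𝓝 g) := by
  rw [Lp.tendsto_Lp_iff_tendsto_eLpNorm']
  exact h.congr fun n => eLpNorm_congr_ae ((hf n).coeFn_toLp.symm.sub (EventuallyEq.refl _ _))

variable [NormedSpace ℝ F]

lemma enorm_integral_sq_le {X : Type*} [MeasurableSpace X] {m : Measure X}
    [IsProbabilityMeasure m] {f : X → F} (hf : AEStronglyMeasurable f m) :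
    ‖∫ x, f x ∂m‖ₑ ^ 2 ≤ ∫⁻ x, ‖f x‖ₑ ^ 2 ∂m := by
  rw [← eLpNorm_two_sq]
  gcongr
  calc ‖∫ x, f x ∂m‖ₑ ≤ eLpNorm f 1 m := by
        rw [eLpNorm_one_eq_lintegral_enorm]
        exact enorm_integral_le_lintegral_enorm f
    _ ≤ eLpNorm f 2 m := eLpNorm_le_eLpNorm_of_exponent_le one_le_two hf

lemma eLpNorm_integral_translate_sub_le {m : Measure (E d)} [IsProbabilityMeasure m]
    {g : E d → F} (hg : StronglyMeasurable g) {ε : ℝ≥0∞}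
    (hε : ∀ᵐ t ∂m, eLpNorm (fun x => g (x - t) - g x) 2 volume ≤ ε) :
    eLpNorm (fun x => ∫ t, (g (x - t) - g x) ∂m) 2 volume ≤ ε := by
  refine (ENNReal.pow_le_pow_left_iff two_ne_zero).1 ?_
  rw [eLpNorm_two_sq]
  refine (lintegral_mono fun x => enorm_integral_sq_le ?_).trans
    (lintegral_lintegral_translate_sub_le hg hε)
  exact ((hg.comp_measurable (measurable_const.sub measurable_id)).sub
    stronglyMeasurable_const).aestronglyMeasurable

/-- The probability measure whose density is the normalized bump function `φ`; convolution with
`φ` averages translates with respect to it. -/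
def bumpMeasure (φ : ContDiffBump (0 : E d)) : Measure (E d) :=
  volume.withDensity fun t => ENNReal.ofReal (φ.normed volume t)

instance isProbabilityMeasure_bumpMeasure (φ : ContDiffBump (0 : E d)) :
    IsProbabilityMeasure (bumpMeasure φ) := by
  refine ⟨?_⟩
  rw [bumpMeasure, withDensity_apply _ MeasurableSet.univ, Measure.restrict_univ,
    ← ofReal_integral_eq_lintegral_ofReal φ.integrable_normed
      (Eventually.of_forall φ.nonneg_normed), φ.integral_normed, ENNReal.ofReal_one]

lemma ae_bumpMeasure_mem_ball (φ : ContDiffBump (0 : E d)) :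
    ∀ᵐ t ∂bumpMeasure φ, t ∈ Metric.ball (0 : E d) φ.rOut := by
  rw [bumpMeasure, ae_withDensity_iff φ.continuous_normed.measurable.ennreal_ofReal]
  refine Eventually.of_forall fun t ht => ?_
  rw [← φ.support_normed_eq (μ := volume)]
  exact fun h => ht (by rw [h, ENNReal.ofReal_zero])

lemma integral_bumpMeasure (φ : ContDiffBump (0 : E d)) (f : E d → F) :
    ∫ t, f t ∂bumpMeasure φ = ∫ t, φ.normed volume t • f t := by
  rw [bumpMeasure, integral_withDensity_eq_integral_toReal_smul
    φ.continuous_normed.measurable.ennreal_ofReal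
    (Eventually.of_forall fun t => ENNReal.ofReal_lt_top)]
  simp only [ENNReal.toReal_ofReal (φ.nonneg_normed _)]

/-- The convolution of `g` with the normalized bump function `φ`. -/
def mollify (φ : ContDiffBump (0 : E d)) (g : E d → F) : E d → F :=
  φ.normed volume ⋆[lsmul ℝ ℝ, volume] g

lemma integrable_normed_smul {g : E d → F} (hg : LocallyIntegrable g)
    (φ : ContDiffBump (0 : E d)) (x : E d) :
    Integrable fun t => φ.normed volume t • g (x - t) :=
  φ.hasCompactSupport_normed.convolutionExists_left (lsmul ℝ ℝ) φ.continuous_normed hg x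

lemma mollify_apply (φ : ContDiffBump (0 : E d)) (g : E d → F) (x : E d) :
    mollify φ g x = ∫ t, φ.normed volume t • g (x - t) := by
  rw [mollify, convolution_lsmul]

lemma mollify_eq_zero {g : E d → F} {K : Set (E d)} (hg : ∀ᵐ x, x ∉ K → g x = 0)
    (φ : ContDiffBump (0 : E d)) {x : E d} (hx : x ∉ K + Metric.ball (0 : E d) φ.rOut) :
    mollify φ g x = 0 := by
  rw [mollify_apply]
  refine integral_eq_zero_of_ae ?_
  filter_upwards [(quasiMeasurePreserving_sub_left (volume : Measure (E d)) x).ae hg] with t ht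
  by_cases h_ball : t ∈ Metric.ball (0 : E d) φ.rOut
  · have h_notMem : x - t ∉ K := fun hK => hx ⟨x - t, hK, t, h_ball, sub_add_cancel x t⟩
    simp [ht h_notMem]
  · rw [← φ.support_normed_eq (μ := volume), Function.notMem_support] at h_ball
    simp [h_ball]

lemma hasFDerivAt_mollify {g : E d → ℝ} (hg : LocallyIntegrable g) (φ : ContDiffBump (0 : E d))
    (x : E d) : HasFDerivAt (mollify φ g)
      ((fderiv ℝ (φ.normed volume) ⋆[(lsmul ℝ ℝ).precompL (E d), volume] g) x) x :=
  φ.hasCompactSupport_normed.hasFDerivAt_convolution_left _ (φ.contDiff_normed (n := 1)) hg x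

lemma fderiv_mollify_apply {g : E d → ℝ} (hg : LocallyIntegrable g) (φ : ContDiffBump (0 : E d))
    (x v : E d) :
    fderiv ℝ (mollify φ g) x v = ∫ t, fderiv ℝ (φ.normed volume) t v * g (x - t) := by
  have h_int : Integrable fun t =>
      ((lsmul ℝ ℝ).precompL (E d)) (fderiv ℝ (φ.normed volume) t) (g (x - t)) :=
    (φ.hasCompactSupport_normed.fderiv ℝ).convolutionExists_left _
      ((φ.contDiff_normed (n := 1)).continuous_fderiv one_ne_zero) hg x
  rw [(hasFDerivAt_mollify hg φ x).fderiv, convolution_def,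
    ContinuousLinearMap.integral_apply h_int]
  rfl

lemma fderiv_comp_const_sub {f : E d → ℝ} (hf : Differentiable ℝ f) (x s v : E d) :
    fderiv ℝ (fun s => f (x - s)) s v = -fderiv ℝ f (x - s) v := by
  have h_sub : HasFDerivAt (fun s : E d => x - s) (-(ContinuousLinearMap.id ℝ (E d))) s :=
    (hasFDerivAt_id s).const_sub x
  have h_comp := (hf (x - s)).hasFDerivAt.comp s h_sub
  simp only [Function.comp_def] at h_comp
  simp [h_comp.fderiv]

/-- Test the weak gradient with the reflected bump function `s ↦ φ (x - s)`. -/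
lemma gradient_mollify {u : L d 2} {G : Lp (E d) 2 (volume : Measure (E d))}
    (hG : IsWeakGradient u G) (φ : ContDiffBump (0 : E d)) (x : E d) :
    ∇ (mollify φ u) x = mollify φ G x := by
  have hu := (Lp.memLp u).locallyIntegrable one_le_two
  have hGi := integrable_normed_smul ((Lp.memLp G).locallyIntegrable one_le_two) φ x
  have h_diff : Differentiable ℝ (φ.normed volume) :=
    (φ.contDiff_normed (n := 1)).differentiable one_ne_zero
  have h_weak := fun i => hG (fun s => φ.normed volume (x - s))
    (φ.contDiff_normed.comp (contDiff_const.sub contDiff_id))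
    (φ.hasCompactSupport_normed.comp_homeomorph (Homeomorph.subLeft x)) i
  simp only [fderiv_comp_const_sub h_diff, mul_neg, integral_neg, neg_inj] at h_weak
  ext i
  calc ∇ (mollify φ u) x i
      = ∫ t, fderiv ℝ (φ.normed volume) t (EuclideanSpace.single i 1) * u (x - t) := by
        rw [gradient_apply, fderiv_mollify_apply hu]
    _ = ∫ s, u s * fderiv ℝ (φ.normed volume) (x - s) (EuclideanSpace.single i 1) := by
        rw [← integral_sub_left_eq_self _ volume x]
        simp only [sub_sub_cancel, mul_comm]
    _ = ∫ s, G s i * φ.normed volume (x - s) := h_weak i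
    _ = ∫ t, φ.normed volume t * G (x - t) i := by
        rw [← integral_sub_left_eq_self _ volume x]
        simp only [sub_sub_cancel, mul_comm]
    _ = mollify φ G x i := by
        rw [mollify_apply]
        exact (EuclideanSpace.proj (𝕜 := ℝ) i).integral_comp_comm hGi

lemma isLipc_mollify {u : L d 2} {K : Set (E d)} (hK : IsCompact K)
    (hu : ∀ᵐ x, x ∉ K → u x = 0) (φ : ContDiffBump (0 : E d)) : IsLipc (mollify φ u) := by
  have h_smooth : ContDiff ℝ 1 (mollify φ u) :=
    φ.hasCompactSupport_normed.contDiff_convolution_left _ φ.contDiff_normed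
      ((Lp.memLp u).locallyIntegrable one_le_two)
  have h_supp : HasCompactSupport (mollify φ u) :=
    HasCompactSupport.intro (hK.add (isCompact_closedBall 0 φ.rOut)) fun x hx =>
      mollify_eq_zero hu φ fun h =>
        hx (Set.add_subset_add_left Metric.ball_subset_closedBall h)
  exact ⟨⟨_, (h_smooth.lipschitzWith_of_hasCompactSupport h_supp one_ne_zero).choose_spec⟩, h_supp⟩

lemma mollify_sub_eq [CompleteSpace F] {g : E d → F} (hg : LocallyIntegrable g)
    (φ : ContDiffBump (0 : E d)) (x : E d) :
    mollify φ g x - g x = ∫ t, (g (x - t) - g x) ∂bumpMeasure φ := by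
  rw [integral_bumpMeasure, mollify_apply]
  simp only [smul_sub]
  rw [integral_sub (integrable_normed_smul hg φ x) (φ.integrable_normed.smul_const _),
    φ.integral_normed_smul]

lemma tendsto_eLpNorm_mollify_sub [CompleteSpace F] {ι : Type*} {l : Filter ι}
    {φ : ι → ContDiffBump (0 : E d)} (hφ : Tendsto (fun n => (φ n).rOut) l (𝓝 0))
    (g : Lp F 2 (volume : Measure (E d))) :
    Tendsto (fun n => eLpNorm (mollify (φ n) g - ⇑g) 2 volume) l (𝓝 0) := by
  rw [ENNReal.tendsto_nhds_zero]
  intro ε hε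
  obtain ⟨δ, hδ, h_translate⟩ := Metric.eventually_nhds_iff_ball.1
    ((tendsto_eLpNorm_translate_sub ENNReal.ofNat_ne_top (Lp.memLp g)).eventually_le_const hε)
  filter_upwards [hφ.eventually_lt_const hδ] with n hn
  have h_avg : mollify (φ n) g - ⇑g = fun x => ∫ t, (g (x - t) - g x) ∂bumpMeasure (φ n) :=
    funext fun x => mollify_sub_eq ((Lp.memLp g).locallyIntegrable one_le_two) (φ n) x
  rw [h_avg]
  exact eLpNorm_integral_translate_sub_le (Lp.stronglyMeasurable g)
    ((ae_bumpMeasure_mem_ball (φ n)).mono fun t ht =>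
      h_translate t (Metric.ball_subset_ball hn.le ht))

lemma exists_contDiffBump_tendsto_rOut (d : ℕ) : ∃ φ : ℕ → ContDiffBump (0 : E d),
    (∀ n, (φ n).rOut ≤ 1) ∧ Tendsto (fun n => (φ n).rOut) atTop (𝓝 0) := by
  refine ⟨fun n => ⟨1 / ((n : ℝ) + 1) / 2, 1 / ((n : ℝ) + 1), by positivity,
    half_lt_self (by positivity)⟩, fun n => ?_, tendsto_one_div_add_atTop_nhds_zero_nat⟩
  simpa using Nat.one_div_le_one_div (α := ℝ) (Nat.zero_le n)

lemma lscEnvelope_lipForm_le (hC : IsCoefficientMatrix C) : lscEnvelope (lipForm C) ≤ form C := by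
  intro u
  by_cases hu : u ∈ W₀ d
  swap
  · rw [form, if_neg hu]; exact le_top
  obtain ⟨⟨G, hG⟩, K, hK, huK⟩ := hu
  have hGK := hG.ae_eq_zero hK.isClosed huK
  obtain ⟨φ, hφ_le, hφ⟩ := exists_contDiffBump_tendsto_rOut d
  have h_lipc : ∀ n, IsLipc (mollify (φ n) u) := fun n => isLipc_mollify hK huK (φ n)
  have h_grad : ∀ n, ∇ (mollify (φ n) u) = mollify (φ n) G := fun n =>
    funext (gradient_mollify hG (φ n))
  set K' : Set (E d) := K + Metric.closedBall (0 : E d) 1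
  have h_zero : ∀ n, ∀ x ∉ K', ∇ (mollify (φ n) u) x = 0 := fun n x hx => by
    rw [h_grad]
    refine mollify_eq_zero hGK (φ n) fun h => hx (Set.add_subset_add_left ?_ h)
    exact (Metric.ball_subset_ball (hφ_le n)).trans Metric.ball_subset_closedBall
  have h_lim := tendsto_toLp_of_eLpNorm_sub (fun n => (h_lipc n).memLp 2)
    (tendsto_eLpNorm_mollify_sub hφ u)
  have h_lim_grad := tendsto_toLp_of_eLpNorm_sub (g := G)
    (fun n => (h_lipc n).memLp_gradient 2) (by
      simpa only [h_grad] using tendsto_eLpNorm_mollify_sub hφ G)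
  have h_energy := tendsto_integral_cInner hC (hK.add (isCompact_closedBall (0 : E d) 1))
    (fun n => ((h_lipc n).memLp_gradient 2).coeFn_toLp.mono fun x hx hxK =>
      hx.trans (h_zero n x hxK))
    (hGK.mono fun x hx hxK => hx fun h => hxK ⟨x, h, 0, by simp, add_zero x⟩) h_lim_grad
  rw [form_eq hC hG hK huK]
  refine le_of_lowerSemicontinuous_of_tendsto (lowerSemicontinuous_lscEnvelope _) h_lim
    (ENNReal.tendsto_ofReal h_energy) fun n => ?_
  refine (lscEnvelope_le _ _).trans_eq ?_
  rw [lipForm_eq (h_lipc n) ((h_lipc n).memLp 2).coeFn_toLp]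
  refine congrArg _ (integral_congr_ae ?_)
  filter_upwards [((h_lipc n).memLp_gradient 2).coeFn_toLp] with x hx
  rw [hx]
  rfl

theorem isRelaxation_form (hC : IsCoefficientMatrix C) :
    IsRelaxation (form C) (lscEnvelope (lipForm C)) :=
  isRelaxation_lscEnvelope (isQuadraticForm_lipForm hC) (form_le_lipForm hC)
    (lscEnvelope_lipForm_le hC)

end Mollification

/-! ### The Markov property -/

section Markov

open Gradient

variable {d : ℕ} {C : E d → Matrix (Fin d) (Fin d) ℝ}

lemma tendsto_slope_fderiv {f : E d → ℝ} {x : E d} (hf : DifferentiableAt ℝ f x) (v : E d) :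
    Tendsto (fun t : ℝ => t⁻¹ * (f (x + t • v) - f x)) (𝓝[>] 0) (𝓝 (fderiv ℝ f x v)) :=
  (hf.hasFDerivAt.hasLineDerivAt v).tendsto_slope_zero_right

lemma abs_fderiv_le_abs_fderiv {f g : E d → ℝ} {x : E d} (hf : DifferentiableAt ℝ f x)
    (hg : DifferentiableAt ℝ g x) (hgf : ∀ y, |g y - g x| ≤ |f y - f x|) (v : E d) :
    |fderiv ℝ g x v| ≤ |fderiv ℝ f x v| := by
  refine le_of_tendsto_of_tendsto' (tendsto_slope_fderiv hg v).abs
    (tendsto_slope_fderiv hf v).abs fun t => ?_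
  rw [abs_mul, abs_mul]
  exact mul_le_mul_of_nonneg_left (hgf _) (abs_nonneg _)

lemma two_mul_abs_cInner_le {M : Matrix (Fin d) (Fin d) ℝ} (hM : M.PosSemidef) (a b : E d) :
    2 * |cInner M a b| ≤ cInner M a a + cInner M b b := by
  have h_expand : ∀ s : ℝ, 0 ≤ cInner M a a + 2 * s * cInner M a b + s ^ 2 * cInner M b b :=
    fun s => by
      have h_nonneg : 0 ≤ cInner M (a + s • b) (a + s • b) := cInner_self_nonneg hM
      rw [cInner_add_left, cInner_add_right, cInner_add_right, cInner_smul_left, cInner_smul_left,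
        cInner_smul_right, cInner_smul_right, cInner_comm hM (a := b) (b := a)] at h_nonneg
      linarith
  have h_pos := h_expand 1
  have h_neg := h_expand (-1)
  rcases abs_cases (cInner M a b) with h | h <;> linarith

/-- Apply the contraction of directional derivatives in the direction `C ∇g`. -/
lemma energyDensity_le_of_abs_sub_le {f g : E d → ℝ} {x : E d} (hx : (C x).PosSemidef)
    (hf : DifferentiableAt ℝ f x) (hg : DifferentiableAt ℝ g x)
    (hgf : ∀ y, |g y - g x| ≤ |f y - f x|) : energyDensity C g g x ≤ energyDensity C f f x := by
  have h_deriv := abs_fderiv_le_abs_fderiv hf hg hgf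
    (Matrix.toEuclideanCLM (𝕜 := ℝ) (C x) (∇ g x))
  rw [← inner_gradient_left, ← inner_gradient_left] at h_deriv
  change |cInner (C x) (∇ g x) (∇ g x)| ≤ |cInner (C x) (∇ f x) (∇ g x)| at h_deriv
  have h_cauchy := two_mul_abs_cInner_le hx (∇ f x) (∇ g x)
  have h_abs := le_abs_self (cInner (C x) (∇ g x) (∇ g x))
  simp only [energyDensity]
  linarith

lemma compLp_ae_eq {F : ℝ → ℝ} (hF : LipschitzWith 1 F) (hF0 : F 0 = 0) {u : L d 2}
    {f : E d → ℝ} (huf : u =ᵐ[volume] f) : hF.compLp hF0 u =ᵐ[volume] fun x => F (f x) :=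
  (hF.coeFn_compLp hF0 u).trans (huf.fun_comp F)

lemma lipForm_compLp_le (hC : IsCoefficientMatrix C) {F : ℝ → ℝ} (hF : LipschitzWith 1 F)
    (hF0 : F 0 = 0) (u : L d 2) : lipForm C (hF.compLp hF0 u) ≤ lipForm C u := by
  by_cases hu : lipForm C u = ∞
  · rw [hu]; exact le_top
  obtain ⟨f, hf, huf⟩ := lipForm_ne_top_iff.1 hu
  have hFf : IsLipc fun x => F (f x) := hf.comp hF hF0
  rw [lipForm_eq hf huf, lipForm_eq hFf (compLp_ae_eq hF hF0 huf)]
  refine ENNReal.ofReal_le_ofReal (integral_mono_ae (hFf.integrable_energyDensity hC hFf)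
    (hf.integrable_energyDensity hC hf) ?_)
  filter_upwards [hC.posSemidef, hf.ae_differentiableAt, hFf.ae_differentiableAt]
    with x hx hfx hFfx
  refine energyDensity_le_of_abs_sub_le hx hfx hFfx fun y => ?_
  simpa only [NNReal.coe_one, one_mul, Real.dist_eq] using hF.dist_le_mul (f y) (f x)

lemma lscEnvelope_apply_le_of_continuous {H : Type*} [NormedAddCommGroup H] {q : H → ℝ≥0∞}
    {P : H → H} (hP : Continuous P) (hq : ∀ u, q (P u) ≤ q u) (u : H) :
    lscEnvelope q (P u) ≤ lscEnvelope q u :=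
  calc liminf q (𝓝 (P u)) ≤ liminf q (map P (𝓝 u)) := liminf_le_liminf_of_le (hP.tendsto u)
    _ ≤ liminf q (𝓝 u) := liminf_le_liminf (u := q ∘ P) (Eventually.of_forall hq)

/-- Dirichlet forms on `L_2(ℝᵈ)`: densely defined closed forms on which normal contractions
operate. -/
structure IsDirichletForm (q : L d 2 → ℝ≥0∞) : Prop extends IsClosedForm q where
  dense : Dense {u | q u ≠ ∞}
  compLp_le : ∀ (F : ℝ → ℝ) (hF : LipschitzWith 1 F) (hF0 : F 0 = 0) (u : L d 2),
    q (hF.compLp hF0 u) ≤ q u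

/-- The form `h₀`: it is the relaxation of `form C` by `isRelaxation_form`. -/
abbrev relaxedForm (C : E d → Matrix (Fin d) (Fin d) ℝ) : L d 2 → ℝ≥0∞ := lscEnvelope (lipForm C)

theorem isDirichletForm_relaxedForm (hC : IsCoefficientMatrix C) :
    IsDirichletForm (relaxedForm C) where
  toIsClosedForm := (isRelaxation_form hC).1.1
  dense := (dense_lipForm C).mono fun _ hu => ne_top_of_le_ne_top hu (lscEnvelope_le _ _)
  compLp_le _ hF hF0 := lscEnvelope_apply_le_of_continuous (hF.continuous_compLp hF0)
    (lipForm_compLp_le hC hF hF0)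

namespace IsDirichletForm

variable {q : L d 2 → ℝ≥0∞} {S : ℝ≥0 → L d 2 →L[ℝ] L d 2}

/-- The hypothesis `hproj` says that `F` is a nearest point projection onto its fixed points. -/
lemma ae_comp_apply_eq (hq : IsDirichletForm q) (hS : IsFormSemigroup q S) {F : ℝ → ℝ}
    (hF : LipschitzWith 1 F) (hF0 : F 0 = 0) (hproj : ∀ s r, |s - F s| ≤ |s - F r|) (t : ℝ≥0)
    {u : L d 2} (hu : ∀ᵐ x, F (u x) = u x) : ∀ᵐ x, F (S t u x) = S t u x := by
  have h_fixed : hF.compLp hF0 u = u := Lp.ext ((hF.coeFn_compLp hF0 u).trans hu)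
  have h_nearest : ∀ v w : L d 2, ‖w - hF.compLp hF0 w‖ ≤ ‖w - hF.compLp hF0 v‖ := fun v w => by
    refine Lp.norm_le_norm_of_ae_le ?_
    filter_upwards [hF.coeFn_compLp hF0 v, hF.coeFn_compLp hF0 w,
      Lp.coeFn_sub w (hF.compLp hF0 v), Lp.coeFn_sub w (hF.compLp hF0 w)]
      with x hv hw h_subv h_subw
    rw [h_subv, h_subw, Pi.sub_apply, Pi.sub_apply, hv, hw]
    exact hproj _ _
  have h_dist := hS.norm_sub_projection_le hq.toIsQuadraticForm
    (dense_graph hq.toIsClosedForm hq.dense) h_nearest (hq.compLp_le F hF hF0) t u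
  rw [h_fixed, sub_self, norm_zero, norm_le_zero_iff, sub_eq_zero] at h_dist
  have h_comp := hF.coeFn_compLp hF0 (S t u)
  rw [← h_dist] at h_comp
  exact h_comp.symm

lemma apply_nonneg (hq : IsDirichletForm q) (hS : IsFormSemigroup q S) (t : ℝ≥0) {u : L d 2}
    (hu : 0 ≤ u) : 0 ≤ S t u := by
  rw [← Lp.coeFn_nonneg] at hu ⊢
  have h_proj : ∀ s r : ℝ, |s - max 0 s| ≤ |s - max 0 r| := fun s r => by
    rcases le_total 0 s with hs | hs
    · simp [hs]
    · rw [max_eq_left hs, sub_zero, abs_of_nonpos hs,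
        abs_of_nonpos (sub_nonpos.2 (hs.trans (le_max_left _ _)))]
      linarith [le_max_left 0 r]
  have h_fixed := hq.ae_comp_apply_eq hS (LipschitzWith.id.const_max 0) (max_self 0) h_proj t
    (hu.mono fun _ => max_eq_right)
  exact h_fixed.mono fun _ => max_eq_right_iff.1

lemma ae_abs_apply_le (hq : IsDirichletForm q) (hS : IsFormSemigroup q S) (t : ℝ≥0) {u : L d 2}
    {c : ℝ} (hu : ∀ᵐ x, |u x| ≤ c) : ∀ᵐ x, |S t u x| ≤ c := by
  obtain ⟨y, hy⟩ := hu.exists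
  have hc : -c ≤ c := neg_le_self ((abs_nonneg _).trans hy)
  have h_proj : ∀ s r : ℝ, |s - max (-c) (min s c)| ≤ |s - max (-c) (min r c)| := fun s r => by
    have h_lower : -c ≤ max (-c) (min r c) := le_max_left _ _
    have h_upper : max (-c) (min r c) ≤ c := max_le hc (min_le_right _ _)
    rcases abs_cases (s - max (-c) (min r c)) with h | h <;>
    rcases max_cases (-c) (min s c) with h' | h' <;>
    rcases min_cases s c with h'' | h'' <;>
    exact abs_le.2 ⟨by linarith, by linarith⟩
  have h_fixed := hq.ae_comp_apply_eq hS ((LipschitzWith.id.min_const c).const_max (-c))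
    (by simp [neg_le_self_iff.1 hc]) h_proj t (hu.mono fun x hx => by
      rw [id, min_eq_left (abs_le.1 hx).2, max_eq_right (abs_le.1 hx).1])
  filter_upwards [h_fixed] with x hx
  rw [← hx, abs_le]
  exact ⟨le_max_left _ _, max_le hc (min_le_right _ _)⟩

theorem isSymmSubMarkovian (hq : IsDirichletForm q) (hS : IsFormSemigroup q S) (t : ℝ≥0) :
    IsSymmSubMarkovian (S t) where
  inner_comm := hS.inner_apply_comm hq.toIsClosedForm hq.dense t
  nonneg _ := hq.apply_nonneg hS t
  ae_abs_le _ _ := hq.ae_abs_apply_le hS t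

end IsDirichletForm

end Markov

/-! ### The intrinsic distance -/

section Distance

open Gradient

variable {d : ℕ} {C : E d → Matrix (Fin d) (Fin d) ℝ}

lemma nu_nonneg (C : E d → Matrix (Fin d) (Fin d) ℝ) (s : ℝ) : 0 ≤ nu C s :=
  ENNReal.toReal_nonneg

lemma essSup_opNorm_ne_top (hC : IsCoefficientMatrix C) (s : ℝ) :
    essSup (fun x => ‖Matrix.toEuclideanCLM (𝕜 := ℝ) (C x)‖ₑ)
      (volume.restrict (Metric.closedBall (0 : E d) s)) ≠ ∞ := by
  have h := (hC.memLp_toEuclideanCLM (isCompact_closedBall 0 s)).eLpNorm_ne_top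
  rwa [eLpNorm_exponent_top] at h

lemma monotone_nu (hC : IsCoefficientMatrix C) : Monotone (nu C) := fun _ _ hst =>
  ENNReal.toReal_mono (essSup_opNorm_ne_top hC _) (essSup_mono_measure'
    (Measure.restrict_mono_set _ (Metric.closedBall_subset_closedBall hst)))

lemma ae_opNorm_le_nu (hC : IsCoefficientMatrix C) :
    ∀ᵐ x : E d, ∀ s, ‖x‖ < s → ‖Matrix.toEuclideanCLM (𝕜 := ℝ) (C x)‖ ≤ nu C s := by
  have h_rat : ∀ r : ℚ, ∀ᵐ x : E d, ‖x‖ ≤ r →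
      ‖Matrix.toEuclideanCLM (𝕜 := ℝ) (C x)‖ ≤ nu C r := fun r => by
    have h_ball := ENNReal.ae_le_essSup (μ := volume.restrict (Metric.closedBall (0 : E d) r))
      (fun x => ‖Matrix.toEuclideanCLM (𝕜 := ℝ) (C x)‖ₑ)
    rw [ae_restrict_iff' Metric.isClosed_closedBall.measurableSet] at h_ball
    filter_upwards [h_ball] with x hx hxr
    rw [← toReal_enorm]
    exact ENNReal.toReal_mono (essSup_opNorm_ne_top hC _) (hx (mem_closedBall_zero_iff.2 hxr))
  filter_upwards [ae_all_iff.2 h_rat] with x hx s hs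
  obtain ⟨r, hxr, hrs⟩ := exists_rat_btwn hs
  exact (hx r hxr.le).trans (monotone_nu hC hrs.le)

lemma antitone_rho_integrand (hC : IsCoefficientMatrix C) :
    Antitone fun t => (1 + nu C t) ^ (-(1 / 2) : ℝ) := fun s _ hst =>
  Real.rpow_le_rpow_of_nonpos (by linarith [nu_nonneg C s])
    (by linarith [monotone_nu hC hst]) (by norm_num)

lemma rho_sub (hC : IsCoefficientMatrix C) (s t : ℝ) :
    rho C t - rho C s = ∫ r in s..t, (1 + nu C r) ^ (-(1 / 2) : ℝ) :=
  intervalIntegral.integral_interval_sub_left (antitone_rho_integrand hC).intervalIntegrable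
    (antitone_rho_integrand hC).intervalIntegrable

lemma monotone_rho (hC : IsCoefficientMatrix C) : Monotone (rho C) := fun s t hst => by
  rw [← sub_nonneg, rho_sub hC]
  exact intervalIntegral.integral_nonneg hst fun r _ =>
    Real.rpow_nonneg (by linarith [nu_nonneg C r]) _

lemma rho_sub_le (hC : IsCoefficientMatrix C) {s t K : ℝ} (hst : s ≤ t) (hK : 0 ≤ K)
    (h : ∀ r, s < r → K ≤ nu C r) : rho C t - rho C s ≤ (t - s) * (1 + K) ^ (-(1 / 2) : ℝ) := by
  rw [rho_sub hC, ← smul_eq_mul, ← intervalIntegral.integral_const]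
  refine intervalIntegral.integral_mono_on_of_le_Ioo hst
    (antitone_rho_integrand hC).intervalIntegrable intervalIntegrable_const fun r hr => ?_
  exact Real.rpow_le_rpow_of_nonpos (by linarith) (by linarith [h r hr.1]) (by norm_num)

lemma abs_rho_sub_le (hC : IsCoefficientMatrix C) (s t : ℝ) :
    |rho C s - rho C t| ≤ |s - t| := by
  wlog hst : s ≤ t generalizing s t
  · rw [abs_sub_comm, abs_sub_comm s]
    exact this t s (le_of_not_ge hst)
  have h := rho_sub_le hC hst le_rfl fun r _ => nu_nonneg C r
  rw [add_zero, Real.one_rpow, mul_one] at h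
  rw [abs_sub_comm, abs_sub_comm s, abs_of_nonneg (sub_nonneg.2 hst),
    abs_of_nonneg (sub_nonneg.2 (monotone_rho hC hst))]
  exact h

lemma lipschitzWith_rho_norm (hC : IsCoefficientMatrix C) :
    LipschitzWith 1 fun x : E d => rho C ‖x‖ :=
  LipschitzWith.of_dist_le_mul fun x y => by
    rw [NNReal.coe_one, one_mul, Real.dist_eq]
    exact (abs_rho_sub_le hC _ _).trans
      ((abs_norm_sub_norm_le x y).trans_eq (dist_eq_norm x y).symm)

-- Only outward increments are controlled by `ν` at radii larger than `‖x‖`; the inward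
-- directions follow because the derivative is odd.
lemma norm_gradient_rho_le (hC : IsCoefficientMatrix C) {x : E d} {K : ℝ} (hK : 0 ≤ K)
    (h_nu : ∀ r, ‖x‖ < r → K ≤ nu C r)
    (h_diff : DifferentiableAt ℝ (fun x : E d => rho C ‖x‖) x) :
    ‖∇ (fun x : E d => rho C ‖x‖) x‖ ≤ (1 + K) ^ (-(1 / 2) : ℝ) := by
  have h_pow_nonneg : 0 ≤ (1 + K) ^ (-(1 / 2) : ℝ) := Real.rpow_nonneg (by linarith) _
  have h_outward : ∀ v : E d, 0 ≤ inner ℝ x v →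
      |fderiv ℝ (fun x : E d => rho C ‖x‖) x v| ≤ (1 + K) ^ (-(1 / 2) : ℝ) * ‖v‖ := by
    intro v hv
    refine le_of_tendsto (tendsto_slope_fderiv h_diff v).abs ?_
    filter_upwards [self_mem_nhdsWithin] with t (ht : 0 < t)
    have h_norm_le : ‖x‖ ≤ ‖x + t • v‖ := by
      refine le_of_sq_le_sq ?_ (norm_nonneg _)
      rw [norm_add_sq_real, real_inner_smul_right]
      nlinarith [mul_nonneg ht.le hv, sq_nonneg ‖t • v‖]
    have h_norm_sub_le : ‖x + t • v‖ - ‖x‖ ≤ t * ‖v‖ := by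
      rw [← Real.norm_of_nonneg ht.le, ← norm_smul, Real.norm_of_nonneg ht.le]
      linarith [norm_add_le x (t • v)]
    rw [abs_mul, abs_of_pos (inv_pos.2 ht),
      abs_of_nonneg (sub_nonneg.2 (monotone_rho hC h_norm_le)), inv_mul_le_iff₀ ht]
    calc rho C ‖x + t • v‖ - rho C ‖x‖
        ≤ (‖x + t • v‖ - ‖x‖) * (1 + K) ^ (-(1 / 2) : ℝ) := rho_sub_le hC h_norm_le hK h_nu
      _ ≤ (t * ‖v‖) * (1 + K) ^ (-(1 / 2) : ℝ) :=
          mul_le_mul_of_nonneg_right h_norm_sub_le h_pow_nonneg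
      _ = t * ((1 + K) ^ (-(1 / 2) : ℝ) * ‖v‖) := by ring
  rw [norm_gradient]
  refine ContinuousLinearMap.opNorm_le_bound _ h_pow_nonneg fun v => ?_
  rw [Real.norm_eq_abs]
  rcases le_total 0 (inner ℝ x v) with hv | hv
  · exact h_outward v hv
  · have h_neg := h_outward (-v) (by rwa [inner_neg_right, neg_nonneg])
    rwa [map_neg, abs_neg, norm_neg] at h_neg

lemma ae_energyDensity_rho_le_one (hC : IsCoefficientMatrix C) :
    ∀ᵐ x : E d, energyDensity C (fun x => rho C ‖x‖) (fun x => rho C ‖x‖) x ≤ 1 := by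
  filter_upwards [ae_opNorm_le_nu hC, (lipschitzWith_rho_norm hC).ae_differentiableAt_of_real]
    with x hx h_diff
  have hK := norm_nonneg (Matrix.toEuclideanCLM (𝕜 := ℝ) (C x))
  have h_gradient := norm_gradient_rho_le hC hK hx h_diff
  refine (le_abs_self _).trans (abs_cInner_le.trans ?_)
  set K := ‖Matrix.toEuclideanCLM (𝕜 := ℝ) (C x)‖
  have h_pow : (1 + K) ^ (-(1 / 2) : ℝ) * (1 + K) ^ (-(1 / 2) : ℝ) = (1 + K)⁻¹ := by
    rw [← Real.rpow_add (by linarith), ← Real.rpow_neg_one]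
    norm_num
  calc K * (‖∇ (fun x : E d => rho C ‖x‖) x‖ * ‖∇ (fun x : E d => rho C ‖x‖) x‖)
      ≤ K * ((1 + K) ^ (-(1 / 2) : ℝ) * (1 + K) ^ (-(1 / 2) : ℝ)) := by gcongr
    _ ≤ 1 := by rw [h_pow, ← div_eq_mul_inv, div_le_one (by linarith)]; linarith

lemma lipschitzWith_of_abs_sub_le_rho (hC : IsCoefficientMatrix C) {g : E d → ℝ}
    (hg : ∀ x y, |g y - g x| ≤ |rho C ‖y‖ - rho C ‖x‖|) : LipschitzWith 1 g :=
  LipschitzWith.of_dist_le_mul fun x y =>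
    (hg y x).trans ((lipschitzWith_rho_norm hC).dist_le_mul x y)

lemma ae_energyDensity_le_one (hC : IsCoefficientMatrix C) {g : E d → ℝ}
    (hg : ∀ x y, |g y - g x| ≤ |rho C ‖y‖ - rho C ‖x‖|) :
    ∀ᵐ x : E d, energyDensity C g g x ≤ 1 := by
  filter_upwards [ae_energyDensity_rho_le_one hC, hC.posSemidef,
    (lipschitzWith_of_abs_sub_le_rho hC hg).ae_differentiableAt_of_real,
    (lipschitzWith_rho_norm hC).ae_differentiableAt_of_real]
    with x h_rho h_pos hg_diff h_rho_diff
  exact (energyDensity_le_of_abs_sub_le h_pos h_rho_diff hg_diff (hg x)).trans h_rho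

lemma exists_rhoBall_subset_closedBall (hC : IsCoefficientMatrix C) {r : ℝ}
    (hr : volume (rhoBall C r) ≠ ∞) :
    ∃ s, rhoBall C r ⊆ Metric.closedBall (0 : E d) s := by
  by_cases h_compact : CompactSpace (E d)
  · obtain ⟨s, hs⟩ := (isCompact_univ (X := E d)).isBounded.subset_closedBall 0
    exact ⟨s, (Set.subset_univ _).trans hs⟩
  · have : NoncompactSpace (E d) := not_compactSpace_iff.1 h_compact
    have h_ne_univ : rhoBall C r ≠ Set.univ := fun h => by
      rw [h, measure_univ_of_isAddLeftInvariant] at hr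
      exact hr rfl
    obtain ⟨y, hy⟩ := (Set.ne_univ_iff_exists_notMem _).1 h_ne_univ
    refine ⟨‖y‖, fun x hx => ?_⟩
    rw [mem_closedBall_zero_iff]
    by_contra! hlt
    exact hy ((monotone_rho hC hlt.le).trans_lt hx)

end Distance

/-! ### Weighted energy estimates -/

section Weights

open Gradient

variable {d : ℕ} {C : E d → Matrix (Fin d) (Fin d) ℝ}

/-- A Lipschitz function, bounded above by `R` and with energy density at most `1`: the exponents
`m` for which the energy can be controlled after multiplication by `e^{2αm}`. -/
structure IsWeight (C : E d → Matrix (Fin d) (Fin d) ℝ) (m : E d → ℝ) (R : ℝ) : Prop where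
  lipschitz : LipschitzWith 1 m
  le : ∀ x, m x ≤ R
  energyDensity_le : ∀ᵐ x, energyDensity C m m x ≤ 1

/-- The exponential weight `e^{2αm}`. -/
def expWeight (α : ℝ) (m : E d → ℝ) (x : E d) : ℝ := Real.exp (2 * α * m x)

lemma expWeight_pos (α : ℝ) (m : E d → ℝ) (x : E d) : 0 < expWeight α m x := Real.exp_pos _

lemma hasFDerivAt_expWeight (α : ℝ) {m : E d → ℝ} {x : E d} (hm : DifferentiableAt ℝ m x) :
    HasFDerivAt (expWeight α m) (expWeight α m x • ((2 * α) • fderiv ℝ m x)) x :=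
  (hm.hasFDerivAt.const_mul (2 * α)).exp

lemma gradient_expWeight (α : ℝ) {m : E d → ℝ} {x : E d} (hm : DifferentiableAt ℝ m x) :
    ∇ (expWeight α m) x = (2 * α * expWeight α m x) • ∇ m x := by
  rw [gradient, (hasFDerivAt_expWeight α hm).fderiv, smul_smul, map_smulₛₗ, mul_comm (2 * α)]
  rfl

lemma lipschitzOnWith_exp (c : ℝ) :
    LipschitzOnWith (Real.exp c).toNNReal Real.exp (Set.Iic c) := by
  refine (convex_Iic c).lipschitzOnWith_of_nnnorm_deriv_le
    (fun x _ => Real.differentiableAt_exp) fun x hx => ?_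
  rw [Real.deriv_exp, ← NNReal.coe_le_coe, coe_nnnorm, Real.norm_of_nonneg (Real.exp_pos x).le,
    Real.coe_toNNReal _ (Real.exp_pos c).le]
  exact Real.exp_le_exp.2 hx

lemma cInner_add_smul_self_le {M : Matrix (Fin d) (Fin d) ℝ} (hM : M.PosSemidef) {a b : E d}
    (hb : cInner M b b ≤ 1) (s : ℝ) :
    cInner M (a + s • b) (a + s • b) ≤ 2 * cInner M a a + 2 * s ^ 2 := by
  have h_nonneg : 0 ≤ cInner M (a - s • b) (a - s • b) := cInner_self_nonneg hM
  rw [sub_eq_add_neg, ← neg_smul] at h_nonneg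
  simp only [cInner_add_left, cInner_add_right, cInner_smul_left, cInner_smul_right,
    cInner_comm hM (a := b) (b := a)] at h_nonneg ⊢
  nlinarith [mul_nonneg (sq_nonneg s) (sub_nonneg.2 hb)]

lemma cInner_self_le_cInner_add_smul {M : Matrix (Fin d) (Fin d) ℝ} (hM : M.PosSemidef)
    {a b : E d} (hb : cInner M b b ≤ 1) (s : ℝ) :
    cInner M a a / 2 ≤ cInner M a (a + (2 * s) • b) + 2 * s ^ 2 := by
  have h_nonneg : 0 ≤ cInner M (a + (2 * s) • b) (a + (2 * s) • b) := cInner_self_nonneg hM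
  simp only [cInner_add_left, cInner_add_right, cInner_smul_left, cInner_smul_right,
    cInner_comm hM (a := b) (b := a)] at h_nonneg ⊢
  nlinarith [mul_nonneg (sq_nonneg s) (sub_nonneg.2 hb)]

lemma abs_cInner_le_weighted {M : Matrix (Fin d) (Fin d) ℝ} (hM : M.PosSemidef) {a b e : E d}
    (hb : cInner M b b ≤ 1) (s : ℝ) {w δ : ℝ} (hw : 0 < w) (hδ : 0 < δ) :
    |cInner M a e| ≤ δ * (cInner M a (w • (a + (2 * s) • b)) + 2 * (w * s ^ 2)) +
      w⁻¹ * cInner M e e / (2 * δ) := by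
  have hδw : 0 < δ * w := mul_pos hδ hw
  have h_young : |cInner M a e| ≤ δ * w * (cInner M a a / 2) + w⁻¹ * cInner M e e / (2 * δ) := by
    have h_two_mul := two_mul_abs_cInner_le hM ((δ * w) • a) e
    rw [cInner_smul_left, cInner_smul_left, cInner_smul_right, abs_mul, abs_of_pos hδw]
      at h_two_mul
    have h_common : δ * w * (cInner M a a / 2) + w⁻¹ * cInner M e e / (2 * δ) =
        (δ * w * (δ * w * cInner M a a) + cInner M e e) / (2 * (δ * w)) := by
      field_simp
    rw [h_common, le_div_iff₀ (by positivity)]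
    linarith
  have h_weight :=
    mul_le_mul_of_nonneg_left (cInner_self_le_cInner_add_smul hM (a := a) hb s) hδw.le
  rw [cInner_smul_right]
  linarith

lemma IsLipc.relaxedForm_ne_top {f : E d → ℝ} (hf : IsLipc f) {u : L d 2}
    (hu : u =ᵐ[volume] f) : relaxedForm C u ≠ ∞ :=
  ne_top_of_le_ne_top (lipForm_ne_top_iff.2 ⟨f, hf, hu⟩) (lscEnvelope_le _ _)

namespace IsWeight

variable {m : E d → ℝ} {R α : ℝ}

lemma expWeight_le (hm : IsWeight C m R) (hα : 0 ≤ α) (x : E d) :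
    expWeight α m x ≤ Real.exp (2 * α * R) :=
  Real.exp_le_exp.2 (mul_le_mul_of_nonneg_left (hm.le x) (by positivity))

lemma abs_expWeight_le (hm : IsWeight C m R) (hα : 0 ≤ α) (x : E d) :
    |expWeight α m x| ≤ Real.exp (2 * α * R) := by
  rw [abs_of_pos (expWeight_pos α m x)]
  exact hm.expWeight_le hα x

lemma lipschitz_expWeight (hm : IsWeight C m R) (hα : 0 ≤ α) :
    ∃ K, LipschitzWith K (expWeight α m) := by
  have h_exponent : LipschitzWith (‖2 * α‖₊ * 1) fun x => 2 * α * m x :=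
    (lipschitzWith_smul (2 * α)).comp hm.lipschitz
  refine ⟨(Real.exp (2 * α * R)).toNNReal * (‖2 * α‖₊ * 1), ?_⟩
  rw [← lipschitzOnWith_univ] at h_exponent ⊢
  exact (lipschitzOnWith_exp (2 * α * R)).comp h_exponent fun x _ =>
    mul_le_mul_of_nonneg_left (hm.le x) (by positivity)

lemma memLp_expWeight (hm : IsWeight C m R) (hα : 0 ≤ α) :
    MemLp (expWeight α m) ∞ (volume : Measure (E d)) :=
  memLp_top_of_bound (hm.lipschitz_expWeight hα).choose_spec.continuous.aestronglyMeasurable _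
    (.of_forall (hm.abs_expWeight_le hα))

lemma isLipc_mul (hm : IsWeight C m R) (hα : 0 ≤ α) {f : E d → ℝ} (hf : IsLipc f) :
    IsLipc fun x => expWeight α m x * f x :=
  hf.bounded_mul (hm.lipschitz_expWeight hα).choose_spec (hm.abs_expWeight_le hα)

lemma ae_gradient_mul (hm : IsWeight C m R) {f : E d → ℝ} (hf : IsLipc f) :
    ∀ᵐ x, ∇ (fun y => expWeight α m y * f y) x =
      expWeight α m x • (∇ f x + (2 * (α * f x)) • ∇ m x) := by
  filter_upwards [hf.ae_differentiableAt, hm.lipschitz.ae_differentiableAt_of_real] with x hfx hmx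
  rw [gradient_mul (hasFDerivAt_expWeight α hmx).differentiableAt hfx, gradient_expWeight α hmx,
    smul_add, smul_smul, smul_smul]
  congr 2
  ring

theorem abs_energy_le (hm : IsWeight C m R) (hC : IsCoefficientMatrix C) (hα : 0 ≤ α)
    {f χ g : E d → ℝ} (hf : IsLipc f) (hχ : IsLipc χ) (hg : Integrable g)
    (hχg : ∀ᵐ x, (expWeight α m x)⁻¹ * energyDensity C χ χ x ≤ g x) {δ : ℝ} (hδ : 0 < δ) :
    |energy C f χ| ≤ δ * (energy C f (fun x => expWeight α m x * f x) +
      2 * α ^ 2 * ∫ x, f x * (expWeight α m x * f x)) + (∫ x, g x) / (2 * δ) := by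
  have hwf := hm.isLipc_mul hα hf
  have h_int_energy := hf.integrable_energyDensity hC hwf
  have h_int_mul : Integrable fun x => f x * (expWeight α m x * f x) :=
    (hf.memLp 2).integrable_mul (hwf.memLp 2)
  have h_int_sum : Integrable fun x => energyDensity C f (fun x => expWeight α m x * f x) x +
      2 * α ^ 2 * (f x * (expWeight α m x * f x)) := h_int_energy.add (h_int_mul.const_mul _)
  have h_bound_eq : δ * (energy C f (fun x => expWeight α m x * f x) +
      2 * α ^ 2 * ∫ x, f x * (expWeight α m x * f x)) + (∫ x, g x) / (2 * δ) =
      ∫ x, (δ * (energyDensity C f (fun x => expWeight α m x * f x) x +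
        2 * α ^ 2 * (f x * (expWeight α m x * f x))) + g x / (2 * δ)) := by
    rw [integral_add (h_int_sum.const_mul δ) (hg.div_const _), integral_const_mul,
      integral_add h_int_energy (h_int_mul.const_mul _), integral_const_mul, integral_div, energy]
  rw [h_bound_eq]
  refine abs_integral_le_integral_abs.trans (integral_mono_ae
    (hf.integrable_energyDensity hC hχ).abs ((h_int_sum.const_mul δ).add (hg.div_const _)) ?_)
  filter_upwards [hC.posSemidef, hm.energyDensity_le, hm.ae_gradient_mul (α := α) hf, hχg]
    with x h_pos h_density h_grad h_le
  have h_pointwise := abs_cInner_le_weighted h_pos (a := ∇ f x) (e := ∇ χ x) h_density (α * f x)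
    (expWeight_pos α m x) hδ
  rw [← h_grad] at h_pointwise
  have h_div : (expWeight α m x)⁻¹ * cInner (C x) (∇ χ x) (∇ χ x) / (2 * δ) ≤ g x / (2 * δ) :=
    div_le_div_of_nonneg_right h_le (by positivity)
  refine h_pointwise.trans ((add_le_add_right h_div _).trans (le_of_eq ?_))
  simp only [energyDensity]
  ring

lemma energy_mul_le (hm : IsWeight C m R) (hC : IsCoefficientMatrix C) (hα : 0 ≤ α)
    {f : E d → ℝ} (hf : IsLipc f) :
    energy C (fun x => expWeight α m x * f x) (fun x => expWeight α m x * f x) ≤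
      Real.exp (2 * α * R) ^ 2 * (2 * energy C f f + 8 * α ^ 2 * ∫ x, f x * f x) := by
  have hwf := hm.isLipc_mul hα hf
  have h_int_energy := hf.integrable_energyDensity hC hf
  have h_int_mul : Integrable fun x => f x * f x := (hf.memLp 2).integrable_mul (hf.memLp 2)
  rw [energy, energy, ← integral_const_mul, ← integral_const_mul,
    ← integral_add (h_int_energy.const_mul _) (h_int_mul.const_mul _), ← integral_const_mul]
  refine integral_mono_ae (hwf.integrable_energyDensity hC hwf)
    (((h_int_energy.const_mul _).add (h_int_mul.const_mul _)).const_mul _) ?_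
  filter_upwards [hC.posSemidef, hm.energyDensity_le, hm.ae_gradient_mul (α := α) hf]
    with x h_pos h_density h_grad
  simp only [energyDensity]
  rw [h_grad, cInner_smul_left, cInner_smul_right, ← mul_assoc, ← sq]
  refine mul_le_mul (pow_le_pow_left₀ (expWeight_pos α m x).le (hm.expWeight_le hα x) 2) ?_
    (cInner_self_nonneg h_pos) (by positivity)
  exact (cInner_add_smul_self_le h_pos h_density _).trans_eq (by ring)

/-- Multiplication by the weight `e^{2αm}`, as an operator on `L_2`. -/
def mulExp (hm : IsWeight C m R) (hα : 0 ≤ α) : L d 2 →L[ℝ] L d 2 :=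
  (ContinuousLinearMap.mul ℝ ℝ).holderL volume ∞ 2 2 (hm.memLp_expWeight hα).toLp

section mulExp

variable (hm : IsWeight C m R) (hα : 0 ≤ α)

lemma coeFn_mulExp (u : L d 2) : hm.mulExp hα u =ᵐ[volume] fun x => expWeight α m x * u x := by
  refine ((ContinuousLinearMap.mul ℝ ℝ).coeFn_holder _ u).trans ?_
  filter_upwards [(hm.memLp_expWeight hα).coeFn_toLp] with x hx
  rw [hx, ContinuousLinearMap.mul_apply']

lemma inner_mulExp_eq_integral (u v : L d 2) :
    inner ℝ u (hm.mulExp hα v) = ∫ x, u x * (expWeight α m x * v x) := by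
  rw [inner_eq_integral]
  refine integral_congr_ae ?_
  filter_upwards [hm.coeFn_mulExp hα v] with x hx
  rw [hx]

lemma inner_mulExp_comm (u v : L d 2) :
    inner ℝ (hm.mulExp hα u) v = inner ℝ u (hm.mulExp hα v) := by
  rw [real_inner_comm, inner_mulExp_eq_integral, inner_mulExp_eq_integral]
  exact integral_congr_ae (.of_forall fun x => by ring)

lemma inner_mulExp_self_nonneg (u : L d 2) : 0 ≤ inner ℝ u (hm.mulExp hα u) := by
  rw [inner_mulExp_eq_integral]
  refine integral_nonneg fun x => ?_
  rw [mul_left_comm]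
  exact mul_nonneg (expWeight_pos α m x).le (mul_self_nonneg _)

lemma inner_mulExp_self_le {u : L d 2} {r : ℝ} (hu : ∀ᵐ x, u x ≠ 0 → m x ≤ r) :
    inner ℝ u (hm.mulExp hα u) ≤ Real.exp (2 * α * r) * ‖u‖ ^ 2 := by
  rw [← real_inner_self_eq_norm_sq, inner_eq_integral, inner_eq_integral, ← integral_const_mul]
  refine integral_mono_ae (integrable_mul_L2 _ _) ((integrable_mul_L2 _ _).const_mul _) ?_
  filter_upwards [hm.coeFn_mulExp hα u, hu] with x h_mul hx
  rw [h_mul, mul_left_comm]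
  rcases eq_or_ne (u x) 0 with h_zero | h_ne
  · simp [h_zero]
  · exact mul_le_mul_of_nonneg_right (Real.exp_le_exp.2
      (mul_le_mul_of_nonneg_left (hx h_ne) (by positivity))) (mul_self_nonneg _)

lemma mulExp_ae_eq {u : L d 2} {f : E d → ℝ} (hu : u =ᵐ[volume] f) :
    hm.mulExp hα u =ᵐ[volume] fun x => expWeight α m x * f x :=
  (hm.coeFn_mulExp hα u).trans (hu.mono fun _ hx => congrArg _ hx)

lemma lipForm_mulExp_le (hC : IsCoefficientMatrix C) (u : L d 2) :
    lipForm C (hm.mulExp hα u) ≤ ENNReal.ofReal (Real.exp (2 * α * R) ^ 2) *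
      (2 * lipForm C u + ENNReal.ofReal (8 * α ^ 2 * inner ℝ u u)) := by
  by_cases hu : lipForm C u = ∞
  · rw [hu, ENNReal.mul_top two_ne_zero, top_add, ENNReal.mul_top]
    · exact le_top
    · exact (ENNReal.ofReal_pos.2 (by positivity)).ne'
  obtain ⟨f, hf, huf⟩ := lipForm_ne_top_iff.1 hu
  have h_norm : inner ℝ u u = ∫ x, f x * f x := by
    rw [inner_eq_integral]
    exact integral_congr_ae (huf.mul huf)
  have h_int_nonneg : 0 ≤ 8 * α ^ 2 * inner ℝ u u :=
    mul_nonneg (by positivity) real_inner_self_nonneg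
  have h_two : 2 * ENNReal.ofReal (energy C f f) = ENNReal.ofReal (2 * energy C f f) := by
    rw [ENNReal.ofReal_mul two_pos.le, ENNReal.ofReal_ofNat]
  rw [lipForm_eq (hm.isLipc_mul hα hf) (hm.mulExp_ae_eq hα huf), lipForm_eq hf huf, h_two,
    ← ENNReal.ofReal_add (mul_nonneg two_pos.le (energy_self_nonneg hC f)) h_int_nonneg,
    ← ENNReal.ofReal_mul (by positivity), h_norm]
  exact ENNReal.ofReal_le_ofReal (hm.energy_mul_le hC hα hf)

lemma abs_polar_lipForm_le (hC : IsCoefficientMatrix C) {χ g : E d → ℝ} (hχ : IsLipc χ)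
    (hg : Integrable g) (hχg : ∀ᵐ x, (expWeight α m x)⁻¹ * energyDensity C χ χ x ≤ g x)
    {δ : ℝ} (hδ : 0 < δ) {v : L d 2} (hv : v =ᵐ[volume] χ) {u : L d 2} (hu : lipForm C u ≠ ∞) :
    |polar (lipForm C) u v| ≤ δ * (polar (lipForm C) u (hm.mulExp hα u) +
      2 * α ^ 2 * inner ℝ u (hm.mulExp hα u)) + (∫ x, g x) / (2 * δ) := by
  obtain ⟨f, hf, huf⟩ := lipForm_ne_top_iff.1 hu
  have h_inner : inner ℝ u (hm.mulExp hα u) = ∫ x, f x * (expWeight α m x * f x) := by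
    rw [inner_eq_integral]
    exact integral_congr_ae (huf.mul (hm.mulExp_ae_eq hα huf))
  rw [polar_lipForm hC hf hχ huf hv,
    polar_lipForm hC hf (hm.isLipc_mul hα hf) huf (hm.mulExp_ae_eq hα huf), h_inner]
  exact hm.abs_energy_le hC hα hf hχ hg hχg hδ

end mulExp

section relaxedForm

variable (hm : IsWeight C m R) (hα : 0 ≤ α) {u : L d 2}

lemma exists_forall_lipForm_mulExp_le (hC : IsCoefficientMatrix C) {a : ℕ → L d 2}
    (ha : Tendsto a atTop (𝓝 u)) (hfin : ∀ n, lipForm C (a n) ≠ ∞)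
    (hqa : Tendsto (fun n => lipForm C (a n)) atTop (𝓝 (relaxedForm C u)))
    (hu : relaxedForm C u ≠ ∞) : ∃ K : ℝ≥0, ∀ n, lipForm C (hm.mulExp hα (a n)) ≤ K := by
  let bound (q : ℝ≥0∞) (s : ℝ) : ℝ≥0∞ := ENNReal.ofReal (Real.exp (2 * α * R) ^ 2) *
    (2 * q + ENNReal.ofReal (8 * α ^ 2 * s))
  have h_ne_top : ∀ {q : ℝ≥0∞} {s : ℝ}, q ≠ ∞ → bound q s ≠ ∞ := fun hq =>
    ENNReal.mul_ne_top ENNReal.ofReal_ne_top (ENNReal.add_ne_top.2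
      ⟨ENNReal.mul_ne_top ENNReal.ofNat_ne_top hq, ENNReal.ofReal_ne_top⟩)
  have h_tendsto : Tendsto (fun n => bound (lipForm C (a n)) (inner ℝ (a n) (a n))) atTop
      (𝓝 (bound (relaxedForm C u) (inner ℝ u u))) :=
    ENNReal.Tendsto.const_mul ((ENNReal.Tendsto.const_mul hqa (.inr ENNReal.ofNat_ne_top)).add
      (ENNReal.tendsto_ofReal ((ha.inner ha).const_mul _))) (.inr ENNReal.ofReal_ne_top)
  obtain ⟨K, hK⟩ := ((ENNReal.tendsto_toNNReal (h_ne_top hu)).comp h_tendsto).bddAbove_range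
  refine ⟨K, fun n => (hm.lipForm_mulExp_le hα hC (a n)).trans ?_⟩
  exact (ENNReal.coe_toNNReal (h_ne_top (hfin n))).ge.trans
    (ENNReal.coe_le_coe.2 (hK ⟨n, rfl⟩))

lemma relaxedForm_mulExp_ne_top (hC : IsCoefficientMatrix C) (hu : relaxedForm C u ≠ ∞) :
    relaxedForm C (hm.mulExp hα u) ≠ ∞ := by
  obtain ⟨a, hfin, ha, hqa⟩ := exists_tendsto_lscEnvelope hu
  obtain ⟨K, hK⟩ := hm.exists_forall_lipForm_mulExp_le hα hC ha hfin hqa hu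
  exact ne_top_of_le_ne_top ENNReal.coe_ne_top
    (le_of_lowerSemicontinuous_of_tendsto (lowerSemicontinuous_lscEnvelope _)
      (((hm.mulExp hα).continuous.tendsto u).comp ha) (tendsto_const_nhds (x := (K : ℝ≥0∞)))
      fun n => (lscEnvelope_le _ _).trans (hK n))

theorem abs_polar_relaxedForm_le (hC : IsCoefficientMatrix C) {χ g : E d → ℝ} (hχ : IsLipc χ)
    (hg : Integrable g) (hχg : ∀ᵐ x, (expWeight α m x)⁻¹ * energyDensity C χ χ x ≤ g x)
    {δ : ℝ} (hδ : 0 < δ) {v : L d 2} (hv : v =ᵐ[volume] χ) (hu : relaxedForm C u ≠ ∞) :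
    |polar (relaxedForm C) u v| ≤ δ * (polar (relaxedForm C) u (hm.mulExp hα u) +
      2 * α ^ 2 * inner ℝ u (hm.mulExp hα u)) + (∫ x, g x) / (2 * δ) := by
  obtain ⟨a, hfin, ha, hqa⟩ := exists_tendsto_lscEnvelope hu
  obtain ⟨K, hK⟩ := hm.exists_forall_lipForm_mulExp_le hα hC ha hfin hqa hu
  have h_mul : Tendsto (fun n => hm.mulExp hα (a n)) atTop (𝓝 (hm.mulExp hα u)) :=
    ((hm.mulExp hα).continuous.tendsto u).comp ha
  have h_polar_mul := tendsto_polar_lscEnvelope (isQuadraticForm_lipForm hC) ha hqa hfin hu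
    h_mul hK (hm.relaxedForm_mulExp_ne_top hα hC hu)
  have h_polar := tendsto_polar_lscEnvelope (isQuadraticForm_lipForm hC) ha hqa hfin hu
    (tendsto_const_nhds (x := v)) (fun _ => (lipForm_eq hχ hv).le) (hχ.relaxedForm_ne_top hv)
  exact le_of_tendsto_of_tendsto' h_polar.abs
    (((h_polar_mul.add ((ha.inner h_mul).const_mul _)).const_mul δ).add_const _)
    fun n => hm.abs_polar_lipForm_le hα hC hχ hg hχg hδ hv (hfin n)

end relaxedForm

end IsWeight

end Weights

/-! ### Weighted estimates along the semigroup -/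

section Evolution

section Comparison

variable {F F' G G' : ℝ → ℝ} {K δ κ T : ℝ}

lemma le_mul_exp_of_deriv_right_le (hFc : ContinuousOn F (Set.Icc 0 T))
    (hF : ∀ t ∈ Set.Ico 0 T, HasDerivWithinAt F (F' t) (Set.Ici t) t)
    (hF' : ∀ t ∈ Set.Ico 0 T, F' t ≤ K * F t) :
    ∀ t ∈ Set.Icc 0 T, F t ≤ F 0 * Real.exp (K * t) := by
  intro t ht
  have h_gronwall := le_gronwallBound_of_liminf_deriv_right_le (ε := 0) hFc
    (fun x hx r hr => (hF x hx).liminf_right_slope_le hr) le_rfl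
    (fun x hx => (hF' x hx).trans_eq (add_zero _).symm) t ht
  rwa [gronwallBound_ε0, sub_zero] at h_gronwall

lemma sub_le_of_deriv_right_le (hFc : ContinuousOn F (Set.Icc 0 T))
    (hGc : ContinuousOn G (Set.Icc 0 T)) (hF0 : 0 ≤ F T) (hT : 0 ≤ T) (hδ : 0 ≤ δ) (hK : 0 ≤ K)
    (hF : ∀ t ∈ Set.Ico 0 T, HasDerivWithinAt F (F' t) (Set.Ici t) t)
    (hG : ∀ t ∈ Set.Ico 0 T, HasDerivWithinAt G (G' t) (Set.Ici t) t)
    (hF' : ∀ t ∈ Set.Ico 0 T, F' t ≤ K * F t)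
    (hG' : ∀ t ∈ Set.Ico 0 T, G' t + δ * F' t ≤ δ * (K * F t) + κ) :
    G T - G 0 ≤ δ * (F 0 * Real.exp (K * T)) + κ * T := by
  let barrier : ℝ → ℝ := fun t => G 0 + (δ * (F 0 * Real.exp (K * t)) + κ * t)
  have h_barrier (t : ℝ) :
      HasDerivAt barrier (δ * (K * (F 0 * Real.exp (K * t))) + κ) t := by
    have h_exp : HasDerivAt (fun t => Real.exp (K * t)) (Real.exp (K * t) * (K * 1)) t :=
      ((hasDerivAt_id t).const_mul K).exp
    exact ((((h_exp.const_mul (F 0)).const_mul δ).add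
      ((hasDerivAt_id t).const_mul κ)).const_add (G 0)).congr_deriv (by ring)
  have h_le : G T + δ * F T ≤ barrier T :=
    image_le_of_deriv_right_le_deriv_boundary (hGc.add (hFc.const_mul δ))
      (fun t ht => (hG t ht).add ((hF t ht).const_mul δ)) (B := barrier)
      (by simp [barrier]) (fun t _ => (h_barrier t).continuousAt.continuousWithinAt)
      (fun t _ => (h_barrier t).hasDerivWithinAt)
      (fun t ht => (hG' t ht).trans (by
        have h_exp := le_mul_exp_of_deriv_right_le hFc hF hF' t ⟨ht.1, ht.2.le⟩
        gcongr)) (Set.right_mem_Icc.2 hT)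
  have h_mul_nonneg : 0 ≤ δ * F T := mul_nonneg hδ hF0
  simp only [barrier] at h_le
  linarith

lemma abs_sub_le_of_deriv_right_le (hFc : ContinuousOn F (Set.Icc 0 T))
    (hGc : ContinuousOn G (Set.Icc 0 T)) (hF0 : 0 ≤ F T) (hT : 0 ≤ T) (hδ : 0 ≤ δ) (hK : 0 ≤ K)
    (hF : ∀ t ∈ Set.Ico 0 T, HasDerivWithinAt F (F' t) (Set.Ici t) t)
    (hG : ∀ t ∈ Set.Ico 0 T, HasDerivWithinAt G (G' t) (Set.Ici t) t)
    (hF' : ∀ t ∈ Set.Ico 0 T, F' t ≤ K * F t)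
    (hG' : ∀ t ∈ Set.Ico 0 T, |G' t| + δ * F' t ≤ δ * (K * F t) + κ) :
    |G T - G 0| ≤ δ * (F 0 * Real.exp (K * T)) + κ * T := by
  have h_upper := sub_le_of_deriv_right_le hFc hGc hF0 hT hδ hK hF hG hF' fun t ht =>
    (add_le_add_left (le_abs_self _) _).trans (hG' t ht)
  have h_lower := sub_le_of_deriv_right_le hFc hGc.neg hF0 hT hδ hK hF
    (fun t ht => (hG t ht).neg) hF' fun t ht =>
      (add_le_add_left (neg_le_abs _) _).trans (hG' t ht)
  simp only [Pi.neg_apply] at h_lower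
  exact abs_le.2 ⟨by linarith, h_upper⟩

end Comparison

section FormSemigroup

variable {H : Type*} [NormedAddCommGroup H] [InnerProductSpace ℝ H]
  {q : H → ℝ≥0∞} {S : ℝ≥0 → H →L[ℝ] H} {u f : H} {t : ℝ}

lemma IsFormSemigroup.hasDerivWithinAt_inner_const (hS : IsFormSemigroup q S)
    (hu : FormOperatorGraph q u f) (ht : 0 ≤ t) (w : H) :
    HasDerivWithinAt (fun s : ℝ => inner ℝ (S s.toNNReal u) w) (-inner ℝ (S t.toNNReal f) w)
      (Set.Ici t) t := by
  refine ((hS.hasDerivWithinAt hu ht).inner ℝ (hasDerivWithinAt_const t _ w)).congr_deriv ?_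
  rw [inner_zero_right, inner_neg_left, zero_add]

lemma IsFormSemigroup.hasDerivWithinAt_inner_apply_self (hS : IsFormSemigroup q S)
    (hu : FormOperatorGraph q u f) (ht : 0 ≤ t) {M : H →L[ℝ] H}
    (hM : ∀ v w, inner ℝ (M v) w = inner ℝ v (M w)) :
    HasDerivWithinAt (fun s : ℝ => inner ℝ (S s.toNNReal u) (M (S s.toNNReal u)))
      (-2 * inner ℝ (S t.toNNReal f) (M (S t.toNNReal u))) (Set.Ici t) t := by
  have h_deriv := hS.hasDerivWithinAt hu ht
  refine (h_deriv.inner ℝ (M.hasFDerivAt.comp_hasDerivWithinAt t h_deriv)).congr_deriv ?_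
  rw [map_neg, inner_neg_left, inner_neg_right, ← hM, real_inner_comm, Function.comp_apply]
  ring

end FormSemigroup

variable {d : ℕ} {C : E d → Matrix (Fin d) (Fin d) ℝ} {m : E d → ℝ} {R α : ℝ}
  {S : ℝ≥0 → L d 2 →L[ℝ] L d 2} {u f : L d 2}

namespace IsWeight

lemma abs_inner_le_of_graph (hm : IsWeight C m R) (hα : 0 ≤ α) (hC : IsCoefficientMatrix C)
    {χ g : E d → ℝ} (hχ : IsLipc χ) (hg : Integrable g)
    (hχg : ∀ᵐ x, (expWeight α m x)⁻¹ * energyDensity C χ χ x ≤ g x) {δ : ℝ} (hδ : 0 < δ)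
    {v : L d 2} (hv : v =ᵐ[volume] χ) (huf : FormOperatorGraph (relaxedForm C) u f) :
    |inner ℝ f v| ≤ δ * (inner ℝ f (hm.mulExp hα u) +
      2 * α ^ 2 * inner ℝ u (hm.mulExp hα u)) + (∫ x, g x) / (2 * δ) := by
  rw [← huf.2 _ (hχ.relaxedForm_ne_top hv),
    ← huf.2 _ (hm.relaxedForm_mulExp_ne_top hα hC huf.1)]
  exact hm.abs_polar_relaxedForm_le hα hC hχ hg hχg hδ hv huf.1

lemma neg_inner_mulExp_le_of_graph (hm : IsWeight C m R) (hα : 0 ≤ α)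
    (hC : IsCoefficientMatrix C) (huf : FormOperatorGraph (relaxedForm C) u f) :
    -inner ℝ f (hm.mulExp hα u) ≤ 2 * α ^ 2 * inner ℝ u (hm.mulExp hα u) := by
  have h_zero := hm.abs_inner_le_of_graph hα hC IsLipc.zero (integrable_zero (E d) ℝ volume)
    (.of_forall fun x => by simp [energyDensity, cInner, gradient]) one_pos
    (Lp.coeFn_zero ℝ 2 volume) huf
  simp only [inner_zero_right, abs_zero, one_mul, Pi.zero_apply, integral_zero,
    zero_div, add_zero] at h_zero
  linarith

theorem abs_inner_semigroup_sub_le_of_graph (hm : IsWeight C m R) (hα : 0 ≤ α)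
    (hC : IsCoefficientMatrix C) (hS : IsFormSemigroup (relaxedForm C) S)
    {χ g : E d → ℝ} (hχ : IsLipc χ) (hg : Integrable g)
    (hχg : ∀ᵐ x, (expWeight α m x)⁻¹ * energyDensity C χ χ x ≤ g x) {δ : ℝ} (hδ : 0 < δ)
    {v : L d 2} (hv : v =ᵐ[volume] χ) (huf : FormOperatorGraph (relaxedForm C) u f) (T : ℝ≥0) :
    |inner ℝ (S T u) v - inner ℝ u v| ≤
      δ / 2 * (inner ℝ u (hm.mulExp hα u) * Real.exp (4 * α ^ 2 * T)) +
        (∫ x, g x) / (2 * δ) * T := by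
  have h_cont := hS.continuous_toNNReal u
  have h_le := abs_sub_le_of_deriv_right_le (T := T) (K := 4 * α ^ 2) (δ := δ / 2)
    (F := fun t : ℝ => inner ℝ (S t.toNNReal u) (hm.mulExp hα (S t.toNNReal u)))
    (κ := (∫ x, g x) / (2 * δ)) (h_cont.inner ((hm.mulExp hα).continuous.comp h_cont)).continuousOn
    (h_cont.inner (continuous_const (y := v))).continuousOn
    (hm.inner_mulExp_self_nonneg hα _) T.2 (by positivity) (by positivity)
    (fun t ht => hS.hasDerivWithinAt_inner_apply_self huf ht.1 (hm.inner_mulExp_comm hα))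
    (fun t ht => hS.hasDerivWithinAt_inner_const huf ht.1 v)
    (fun t _ => by
      have := hm.neg_inner_mulExp_le_of_graph hα hC (hS.graph huf t.toNNReal)
      linarith)
    (fun t _ => by
      have := hm.abs_inner_le_of_graph hα hC hχ hg hχg hδ hv (hS.graph huf t.toNNReal)
      rw [abs_neg]
      linarith)
  simpa only [Real.toNNReal_coe, Real.toNNReal_zero, hS.zero, ContinuousLinearMap.id_apply]
    using h_le

theorem abs_inner_semigroup_sub_le (hm : IsWeight C m R) (hα : 0 ≤ α)
    (hC : IsCoefficientMatrix C) (hS : IsFormSemigroup (relaxedForm C) S)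
    {χ g : E d → ℝ} (hχ : IsLipc χ) (hg : Integrable g)
    (hχg : ∀ᵐ x, (expWeight α m x)⁻¹ * energyDensity C χ χ x ≤ g x) {δ : ℝ} (hδ : 0 < δ)
    {v : L d 2} (hv : v =ᵐ[volume] χ) (u : L d 2) (T : ℝ≥0) :
    |inner ℝ (S T u) v - inner ℝ u v| ≤
      δ / 2 * (inner ℝ u (hm.mulExp hα u) * Real.exp (4 * α ^ 2 * T)) +
        (∫ x, g x) / (2 * δ) * T := by
  have hq := isDirichletForm_relaxedForm hC
  refine isClosed_property (dense_graph hq.toIsClosedForm hq.dense).denseRange_val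
    (p := fun u => |inner ℝ (S T u) v - inner ℝ u v| ≤
      δ / 2 * (inner ℝ u (hm.mulExp hα u) * Real.exp (4 * α ^ 2 * T)) + (∫ x, g x) / (2 * δ) * T)
    (isClosed_le (by fun_prop) (by fun_prop)) ?_ u
  rintro ⟨w, f, hf⟩
  exact hm.abs_inner_semigroup_sub_le_of_graph hα hC hS hχ hg hχg hδ hv hf T

end IsWeight

end Evolution

/-! ### Cutoff functions and conservation of mass -/

section Conservation

open Gradient

variable {d : ℕ} {C : E d → Matrix (Fin d) (Fin d) ℝ}

/-- The truncated distance `min(ρ(|x|), R)` from the origin, which serves as a weight. -/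
def truncDist (C : E d → Matrix (Fin d) (Fin d) ℝ) (R : ℝ) (x : E d) : ℝ := min (rho C ‖x‖) R

/-- The cutoff function of the balls `B_ρ`: it is `1` where `ρ(|x|) ≤ R`, it is `0` where
`ρ(|x|) ≥ R + 1`, and it is affine in `ρ(|x|)` in between. -/
def cutoff (C : E d → Matrix (Fin d) (Fin d) ℝ) (R : ℝ) (x : E d) : ℝ :=
  max 0 (min (R + 1 - rho C ‖x‖) 1)

lemma abs_truncDist_sub_le (R : ℝ) (x y : E d) :
    |truncDist C R y - truncDist C R x| ≤ |rho C ‖y‖ - rho C ‖x‖| := by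
  have h_lip := (LipschitzWith.id.min_const R).dist_le_mul (rho C ‖y‖) (rho C ‖x‖)
  rwa [NNReal.coe_one, one_mul, Real.dist_eq, Real.dist_eq] at h_lip

lemma abs_cutoff_sub_le (R : ℝ) (x y : E d) :
    |cutoff C R y - cutoff C R x| ≤ |rho C ‖y‖ - rho C ‖x‖| := by
  have h_lip := ((LipschitzWith.id.min_const 1).const_max 0).dist_le_mul
    (R + 1 - rho C ‖y‖) (R + 1 - rho C ‖x‖)
  rwa [NNReal.coe_one, one_mul, Real.dist_eq, Real.dist_eq, sub_sub_sub_cancel_left,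
    abs_sub_comm (rho C ‖x‖)] at h_lip

lemma isWeight_truncDist (hC : IsCoefficientMatrix C) (R : ℝ) : IsWeight C (truncDist C R) R where
  lipschitz := lipschitzWith_of_abs_sub_le_rho hC (abs_truncDist_sub_le R)
  le _ := min_le_right _ _
  energyDensity_le := ae_energyDensity_le_one hC (abs_truncDist_sub_le R)

lemma cutoff_eq_one {R : ℝ} {x : E d} (hx : rho C ‖x‖ ≤ R) : cutoff C R x = 1 := by
  rw [cutoff, min_eq_right (by linarith), max_eq_right zero_le_one]

lemma cutoff_eq_zero {R : ℝ} {x : E d} (hx : R + 1 ≤ rho C ‖x‖) : cutoff C R x = 0 := by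
  rw [cutoff, max_eq_left]
  exact (min_le_left _ _).trans (by linarith)

lemma abs_cutoff_le_one (R : ℝ) (x : E d) : |cutoff C R x| ≤ 1 := by
  rw [cutoff, abs_of_nonneg (le_max_left _ _)]
  exact max_le zero_le_one (min_le_right _ _)

lemma lipschitzWith_cutoff (hC : IsCoefficientMatrix C) (R : ℝ) :
    LipschitzWith 1 (cutoff C R) :=
  lipschitzWith_of_abs_sub_le_rho hC (abs_cutoff_sub_le R)

lemma isLipc_cutoff (hC : IsCoefficientMatrix C) {R : ℝ}
    (hvol : volume (rhoBall C (R + 1)) ≠ ∞) : IsLipc (cutoff C R) := by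
  refine ⟨⟨1, lipschitzWith_cutoff hC R⟩, ?_⟩
  obtain ⟨s, hs⟩ := exists_rhoBall_subset_closedBall hC hvol
  refine HasCompactSupport.intro (isCompact_closedBall 0 s) fun x hx => cutoff_eq_zero ?_
  by_contra! h_lt
  exact hx (hs h_lt)

lemma gradient_eq_zero_of_eventually_eq {f : E d → ℝ} {x : E d} {c : ℝ}
    (h : ∀ᶠ y in 𝓝 x, f y = c) : ∇ f x = 0 := by
  have h_eq : f =ᶠ[𝓝 x] fun _ => c := h
  rw [gradient, h_eq.fderiv_eq, fderiv_const_apply, map_zero]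

lemma gradient_cutoff_eq_zero (hC : IsCoefficientMatrix C) {R : ℝ} {x : E d}
    (hx : rho C ‖x‖ ∉ Set.Icc R (R + 1)) : ∇ (cutoff C R) x = 0 := by
  have h_cont : ContinuousAt (fun x : E d => rho C ‖x‖) x :=
    (lipschitzWith_rho_norm hC).continuous.continuousAt
  rcases lt_or_ge (rho C ‖x‖) R with h_lt | h_ge
  · exact gradient_eq_zero_of_eventually_eq
      ((h_cont.eventually_lt_const h_lt).mono fun y hy => cutoff_eq_one hy.le)
  · have h_gt : R + 1 < rho C ‖x‖ := lt_of_not_ge fun h_le => hx ⟨h_ge, h_le⟩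
    exact gradient_eq_zero_of_eventually_eq
      ((h_cont.eventually_const_lt h_gt).mono fun y hy => cutoff_eq_zero hy.le)

lemma ae_inv_expWeight_mul_energyDensity_cutoff_le (hC : IsCoefficientMatrix C) (R α : ℝ) :
    ∀ᵐ x, (expWeight α (truncDist C R) x)⁻¹ * energyDensity C (cutoff C R) (cutoff C R) x ≤
      (rhoBall C (R + 2)).indicator (fun _ => Real.exp (-(2 * α * R))) x := by
  filter_upwards [ae_energyDensity_le_one hC (abs_cutoff_sub_le R)] with x hx
  by_cases h_shell : rho C ‖x‖ ∈ Set.Icc R (R + 1)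
  · have h_mem : x ∈ rhoBall C (R + 2) := show rho C ‖x‖ < R + 2 by linarith [h_shell.2]
    rw [Set.indicator_of_mem h_mem, expWeight, truncDist, min_eq_right h_shell.1, ← Real.exp_neg]
    exact mul_le_of_le_one_right (Real.exp_pos _).le hx
  · have h_zero : energyDensity C (cutoff C R) (cutoff C R) x = 0 := by
      simp [energyDensity, cInner, gradient_cutoff_eq_zero hC h_shell]
    rw [h_zero, mul_zero]
    exact Set.indicator_nonneg (fun _ _ => (Real.exp_pos _).le) x

lemma tendsto_integral_cutoff_mul (hC : IsCoefficientMatrix C) {g : E d → ℝ}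
    (hg : Integrable g) :
    Tendsto (fun R => ∫ x, cutoff C R x * g x) atTop (𝓝 (∫ x, g x)) := by
  refine tendsto_integral_filter_of_dominated_convergence (fun x => ‖g x‖)
    (.of_forall fun R =>
      (lipschitzWith_cutoff hC R).continuous.aestronglyMeasurable.mul hg.aestronglyMeasurable)
    (.of_forall fun R => .of_forall fun x => ?_) hg.norm (.of_forall fun x => ?_)
  · rw [norm_mul]
    exact mul_le_of_le_one_left (norm_nonneg _) (abs_cutoff_le_one R x)
  · refine tendsto_const_nhds.congr' ?_
    filter_upwards [eventually_ge_atTop (rho C ‖x‖)] with R hR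
    rw [cutoff_eq_one hR, one_mul]

lemma measurableSet_rhoBall (hC : IsCoefficientMatrix C) (r : ℝ) :
    MeasurableSet (rhoBall C r) :=
  (isOpen_lt (lipschitzWith_rho_norm hC).continuous continuous_const).measurableSet

lemma rhoBall_mono {r s : ℝ} (hrs : r ≤ s) : rhoBall C r ⊆ rhoBall C s :=
  fun _ hx => lt_of_lt_of_le hx hrs

lemma volume_rhoBall_ne_top {a b : ℝ} (hgrowth : ∀ᶠ r : ℝ in atTop,
    volume (rhoBall C r) ≤ ENNReal.ofReal (a * Real.exp (b * r ^ 2))) (r : ℝ) :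
    volume (rhoBall C r) ≠ ∞ := by
  obtain ⟨s, hs, hrs⟩ := (hgrowth.and (eventually_ge_atTop r)).exists
  exact ne_top_of_le_ne_top ENNReal.ofReal_ne_top ((measure_mono (rhoBall_mono hrs)).trans hs)

namespace IsFormSemigroup

variable {S : ℝ≥0 → L d 2 →L[ℝ] L d 2} {u : L d 2} {r : ℝ}

lemma abs_inner_cutoff_sub_le (hS : IsFormSemigroup (relaxedForm C) S)
    (hC : IsCoefficientMatrix C) {R : ℝ} (hvol : volume (rhoBall C (R + 2)) ≠ ∞) {α δ : ℝ}
    (hα : 0 ≤ α) (hδ : 0 < δ) (hu : ∀ᵐ x, u x ≠ 0 → rho C ‖x‖ ≤ r) {χ : L d 2}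
    (hχ : χ =ᵐ[volume] cutoff C R) (T : ℝ≥0) :
    |inner ℝ (S T u) χ - inner ℝ u χ| ≤
      δ / 2 * (Real.exp (2 * α * r) * ‖u‖ ^ 2 * Real.exp (4 * α ^ 2 * T)) +
        volume.real (rhoBall C (R + 2)) * Real.exp (-(2 * α * R)) / (2 * δ) * T := by
  have h_weight := isWeight_truncDist hC R
  have h_lipc : IsLipc (cutoff C R) := isLipc_cutoff hC
    (ne_top_of_le_ne_top hvol (measure_mono (rhoBall_mono (by linarith))))
  have h_int : Integrable ((rhoBall C (R + 2)).indicator fun _ => Real.exp (-(2 * α * R))) :=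
    (integrable_indicator_iff (measurableSet_rhoBall hC _)).2 (integrableOn_const hvol)
  have h_estimate := h_weight.abs_inner_semigroup_sub_le hα hC hS h_lipc h_int
    (ae_inv_expWeight_mul_energyDensity_cutoff_le hC R α) hδ hχ u T
  rw [integral_indicator_const _ (measurableSet_rhoBall hC _), smul_eq_mul] at h_estimate
  have h_mass := h_weight.inner_mulExp_self_le hα
    (hu.mono fun x hx h_ne => (min_le_left _ _).trans (hx h_ne))
  refine h_estimate.trans ?_
  gcongr

-- The choice `α = R / (4T)`, `δ = e^{-3R²/(8T)}` balances the two terms of the estimate.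
lemma abs_inner_cutoff_sub_le_exp (hS : IsFormSemigroup (relaxedForm C) S)
    (hC : IsCoefficientMatrix C) {a b R : ℝ} (ha : 0 ≤ a) (hR : 0 ≤ R)
    (hvol : volume (rhoBall C (R + 2)) ≤ ENNReal.ofReal (a * Real.exp (b * (R + 2) ^ 2)))
    (hu : ∀ᵐ x, u x ≠ 0 → rho C ‖x‖ ≤ r) {χ : L d 2} (hχ : χ =ᵐ[volume] cutoff C R)
    {T : ℝ≥0} (hT : 0 < T) :
    |inner ℝ (S T u) χ - inner ℝ u χ| ≤
      ‖u‖ ^ 2 / 2 * Real.exp (-(1 / (8 * T) * R ^ 2) + r / (2 * T) * R) +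
        a * T / 2 * Real.exp (-((1 / (8 * T) - b) * R ^ 2) + 4 * b * R + 4 * b) := by
  have : (0 : ℝ) < T := hT
  have h_real : volume.real (rhoBall C (R + 2)) ≤ a * Real.exp (b * (R + 2) ^ 2) :=
    ENNReal.toReal_le_of_le_ofReal (by positivity) hvol
  set α : ℝ := R / (4 * T) with hα
  set δ : ℝ := Real.exp (-(3 / (8 * T) * R ^ 2)) with hδ
  refine (hS.abs_inner_cutoff_sub_le hC (ne_top_of_le_ne_top ENNReal.ofReal_ne_top hvol)
    (by positivity : 0 ≤ α) (Real.exp_pos _ : 0 < δ) hu hχ T).trans (add_le_add (le_of_eq ?_) ?_)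
  · calc δ / 2 * (Real.exp (2 * α * r) * ‖u‖ ^ 2 * Real.exp (4 * α ^ 2 * T))
        = ‖u‖ ^ 2 / 2 * (δ * Real.exp (2 * α * r) * Real.exp (4 * α ^ 2 * T)) := by ring
      _ = _ := by
          rw [hδ, ← Real.exp_add, ← Real.exp_add, hα]
          congr 2
          field_simp
          ring
  · calc volume.real (rhoBall C (R + 2)) * Real.exp (-(2 * α * R)) / (2 * δ) * T
        ≤ a * Real.exp (b * (R + 2) ^ 2) * Real.exp (-(2 * α * R)) / (2 * δ) * T := by gcongr
      _ = a * T / 2 * (Real.exp (b * (R + 2) ^ 2) * Real.exp (-(2 * α * R)) * δ⁻¹) := by ring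
      _ = _ := by
          rw [hδ, ← Real.exp_neg, ← Real.exp_add, ← Real.exp_add, hα]
          congr 2
          field_simp
          ring

end IsFormSemigroup

lemma tendsto_exp_neg_sq {c : ℝ} (hc : 0 < c) (k l : ℝ) :
    Tendsto (fun x => Real.exp (-(c * x ^ 2) + k * x + l)) atTop (𝓝 0) := by
  refine Real.tendsto_exp_atBot.comp (tendsto_atBot_add_const_right _ l ?_)
  have h_linear : Tendsto (fun x => -(c * x) + k) atTop atBot :=
    tendsto_atBot_add_const_right _ k
      (tendsto_neg_atTop_atBot.comp (tendsto_id.const_mul_atTop hc))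
  exact (tendsto_id.atTop_mul_atBot₀ h_linear).congr fun x => by
    simp only [id]
    ring

namespace IsFormSemigroup

variable {S : ℝ≥0 → L d 2 →L[ℝ] L d 2} {u : L d 2} {r : ℝ}

lemma tendsto_inner_cutoff_sub (hS : IsFormSemigroup (relaxedForm C) S)
    (hC : IsCoefficientMatrix C) {a b : ℝ} (ha : 0 ≤ a)
    (hgrowth : ∀ᶠ r : ℝ in atTop,
      volume (rhoBall C r) ≤ ENNReal.ofReal (a * Real.exp (b * r ^ 2)))
    {T : ℝ≥0} (hT : 0 < T) (hTb : 8 * b * T < 1) (hu : ∀ᵐ x, u x ≠ 0 → rho C ‖x‖ ≤ r)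
    {χ : ℝ → L d 2} (hχ : ∀ R, χ R =ᵐ[volume] cutoff C R) :
    Tendsto (fun R => inner ℝ (S T u) (χ R) - inner ℝ u (χ R)) atTop (𝓝 0) := by
  have : (0 : ℝ) < T := hT
  have hTb' : b < 1 / (8 * T) := by
    rw [lt_div_iff₀ (by positivity)]
    linarith
  have h_first : Tendsto (fun R => Real.exp (-(1 / (8 * (T : ℝ)) * R ^ 2) + r / (2 * T) * R))
      atTop (𝓝 0) := by
    simpa only [add_zero] using tendsto_exp_neg_sq (by positivity) (r / (2 * T)) 0
  have h_lim := (h_first.const_mul (‖u‖ ^ 2 / 2)).add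
    ((tendsto_exp_neg_sq (sub_pos.2 hTb') (4 * b) (4 * b)).const_mul (a * T / 2))
  rw [mul_zero, mul_zero, add_zero] at h_lim
  refine squeeze_zero_norm' ?_ h_lim
  filter_upwards [(tendsto_atTop_add_const_right _ 2 tendsto_id).eventually hgrowth,
    eventually_ge_atTop 0] with R h_vol hR
  exact hS.abs_inner_cutoff_sub_le_exp hC ha hR h_vol hu (hχ R) hT

theorem integral_apply (hS : IsFormSemigroup (relaxedForm C) S) (hC : IsCoefficientMatrix C)
    {a b : ℝ} (ha : 0 ≤ a) (hgrowth : ∀ᶠ r : ℝ in atTop,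
      volume (rhoBall C r) ≤ ENNReal.ofReal (a * Real.exp (b * r ^ 2)))
    {T : ℝ≥0} (hT : 0 < T) (hTb : 8 * b * T < 1) (hu_int : Integrable u)
    (hu : ∀ᵐ x, u x ≠ 0 → rho C ‖x‖ ≤ r) : ∫ x, S T u x = ∫ x, u x := by
  let χ : ℝ → L d 2 := fun R =>
    ((isLipc_cutoff hC (volume_rhoBall_ne_top hgrowth (R + 1))).memLp 2).toLp _
  have hχ (R : ℝ) : χ R =ᵐ[volume] cutoff C R := MemLp.coeFn_toLp _
  have h_tendsto_inner (v : L d 2) (hv : Integrable v) :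
      Tendsto (fun R => inner ℝ v (χ R)) atTop (𝓝 (∫ x, v x)) := by
    refine (tendsto_integral_cutoff_mul hC hv).congr fun R => ?_
    rw [real_inner_comm, inner_eq_integral]
    exact integral_congr_ae ((hχ R).mono fun x hx => by simp only [hx])
  have h_symm := (isDirichletForm_relaxedForm hC).isSymmSubMarkovian hS T
  have h_sub := (h_tendsto_inner _ (h_symm.integrable_apply hu_int)).sub (h_tendsto_inner u hu_int)
  exact sub_eq_zero.1 (tendsto_nhds_unique h_sub
    (hS.tendsto_inner_cutoff_sub hC ha hgrowth hT hTb hu hχ))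

end IsFormSemigroup

lemma IsSymmSubMarkovian.linftyExtension_one {A : L d 2 →L[ℝ] L d 2} (hA : IsSymmSubMarkovian A)
    (h_mass : ∀ (u : L d 2) (η : E d → ℝ), Continuous η → HasCompactSupport η →
      u =ᵐ[volume] η → ∫ x, A u x = ∫ x, u x) :
    hA.linftyExtension (oneLinfty d) = oneLinfty d := by
  refine Lp.ext (ae_eq_of_integral_contDiff_smul_eq ((Lp.memLp _).locallyIntegrable le_top)
    ((Lp.memLp _).locallyIntegrable le_top) fun η hη h_supp => ?_)
  obtain ⟨u, hu⟩ := integrableSubmodule.exists_coeFn_eq hη.continuous h_supp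
  have h_one (v : E d → ℝ) : ∫ x, oneLinfty d x * v x = ∫ x, v x :=
    integral_congr_ae (coeFn_oneLinfty.mono fun x hx => by simp only [hx, one_mul])
  have h_swap (w : E d → ℝ) : ∫ x, η x • w x = ∫ x, w x * (u : L d 2) x :=
    integral_congr_ae (hu.mono fun x hx => by simp only [hx, smul_eq_mul, mul_comm])
  rw [h_swap, h_swap, hA.integral_linftyExtension_mul _ (integrableSubmodule.integrable u),
    h_one, h_one, h_mass u η hη.continuous h_supp hu]

namespace IsFormSemigroup

variable {S : ℝ≥0 → L d 2 →L[ℝ] L d 2}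

theorem exists_isLinftyExtension_one (hS : IsFormSemigroup (relaxedForm C) S)
    (hC : IsCoefficientMatrix C) {a b : ℝ} (ha : 0 ≤ a) (hgrowth : ∀ᶠ r : ℝ in atTop,
      volume (rhoBall C r) ≤ ENNReal.ofReal (a * Real.exp (b * r ^ 2)))
    {t : ℝ≥0} (ht : 0 < t) (htb : 8 * b * t < 1) :
    ∃ T : L d ∞ →L[ℝ] L d ∞, IsLinftyExtension (S t) T ∧ T (oneLinfty d) = oneLinfty d := by
  have h_symm := (isDirichletForm_relaxedForm hC).isSymmSubMarkovian hS t
  refine ⟨_, h_symm.isLinftyExtension, h_symm.linftyExtension_one fun u η hη h_supp hu => ?_⟩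
  obtain ⟨r, hr⟩ := (h_supp.image (lipschitzWith_rho_norm hC).continuous).bddAbove
  exact hS.integral_apply hC ha hgrowth ht htb
    ((integrable_congr hu).2 (hη.integrable_of_hasCompactSupport h_supp))
    (hu.mono fun x hx h_ne => hr ⟨x, subset_tsupport η (by rwa [hx] at h_ne), rfl⟩)

theorem exists_isLinftyExtension_one_nsmul {q : L d 2 → ℝ≥0∞} (hS : IsFormSemigroup q S) {t : ℝ≥0}
    (ht : ∃ T : L d ∞ →L[ℝ] L d ∞, IsLinftyExtension (S t) T ∧ T (oneLinfty d) = oneLinfty d)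
    (n : ℕ) : ∃ T : L d ∞ →L[ℝ] L d ∞,
      IsLinftyExtension (S (n • t)) T ∧ T (oneLinfty d) = oneLinfty d := by
  obtain ⟨T, hT, hT_one⟩ := ht
  induction n with
  | zero =>
    rw [zero_smul, hS.zero]
    exact ⟨_, IsLinftyExtension.id, rfl⟩
  | succ n ih =>
    obtain ⟨U, hU, hU_one⟩ := ih
    rw [succ_nsmul, hS.add]
    exact ⟨U.comp T, hU.comp hT, by rw [ContinuousLinearMap.comp_apply, hT_one, hU_one]⟩

theorem isConservative (hS : IsFormSemigroup (relaxedForm C) S) (hC : IsCoefficientMatrix C)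
    (hgrowth : TikhonovGrowth C) : IsConservative S := by
  obtain ⟨a, b, ha, hb, hab⟩ := hgrowth
  intro t ht
  obtain ⟨n, hn⟩ := exists_nat_gt (8 * b * t)
  have hn_pos : (0 : ℝ) < n := lt_of_le_of_lt (by positivity) hn
  have h_step_pos : 0 < t / n := div_pos ht (by exact_mod_cast hn_pos)
  have h_step_lt : 8 * b * ((t / n : ℝ≥0) : ℝ) < 1 := by
    rwa [NNReal.coe_div, NNReal.coe_natCast, ← mul_div_assoc, div_lt_one hn_pos]
  have h_steps := hS.exists_isLinftyExtension_one_nsmul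
    (hS.exists_isLinftyExtension_one hC ha.le hab h_step_pos h_step_lt) n
  rwa [nsmul_eq_mul, mul_div_cancel₀ t (by exact_mod_cast hn_pos.ne')] at h_steps

end IsFormSemigroup

end Conservation

end DegenerateElliptic

end

theorem theorem3p1 (d : ℕ)
    (C : DegenerateElliptic.E d → Matrix (Fin d) (Fin d) ℝ)
    (hC : DegenerateElliptic.IsCoefficientMatrix C)
    (hgrowth : DegenerateElliptic.TikhonovGrowth C) :
    ∃ h₀ : DegenerateElliptic.L d 2 → ENNReal,
      DegenerateElliptic.IsRelaxation (DegenerateElliptic.form C) h₀ ∧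
      (∃ S, DegenerateElliptic.IsFormSemigroup h₀ S) ∧
      ∀ S, DegenerateElliptic.IsFormSemigroup h₀ S → DegenerateElliptic.IsConservative S := by
  have hq := DegenerateElliptic.isDirichletForm_relaxedForm hC
  exact ⟨_, DegenerateElliptic.isRelaxation_form hC,
    ⟨_, DegenerateElliptic.isFormSemigroup_formSemigroup hq.toIsClosedForm hq.dense⟩,
    fun _ hS => hS.isConservative hC hgrowth⟩
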